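/- Let $p$ be a prime number and let $f=\sum_{\omega}a_\omega x^\omega\in\mathbb{Z}_p[x_1,x_2,x_3]$ be a nonzero polynomial with $f(0,0,0)=0$. **Newton polyhedron.** Let $\Gamma_f\subset\mathbb{R}_{\ge 0}^3$ be the Newton polyhedron of $f$, i.e. the convex hull of $\bigcup_{a_\omega\ne 0}(\omega+\mathbb{R}_{\ge 0}^3)$. Its faces are $\Gamma_f$ and its intersections with supporting planes; its facets are its two-dimensional faces. For a face $\tau$ put $f_\tau=\sum_{\omega\in\tau}a_\omega x^\omega$. For $v\in\mathbb{Z}_{\ge 0}^3$ put $\sigma(v)=v_1+v_2+v_3$ and $m(v)=\inf_{x\in\Gamma_f}v\cdot x$. Each facet $\tau$ has a unique primitive normal vector $v_\tau\in\mathbb{Z}_{\ge 0}^3\setminus\{0\}$. **Non-degeneracy.** Suppose that $f$ is non-degenerated over $\mathbb{F}_p$ with respect to all the compact faces of $\Gamma_f$: for every compact face $\tau$, the reduction $\overline{f_\tau}$ of $f_\tau$ modulo $p$ and its three partial derivatives have no common zero in $(\mathbb{F}_p^\times)^3$. **Zeta function.** Let $\chi:\mathbb{Z}_p^\times\to\mathbb{C}^\times$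 be a non-trivial character that is trivial on $1+p\mathbb{Z}_p$; put $\chi(0)=0$, and write $\operatorname{ac}a=|a|a$ for $a\in\mathbb{Q}_p$. Let $Z_{f,\chi}^0$ be the meromorphic continuation to $\mathbb{C}$ of $$s\mapsto\int_{(p\mathbb{Z}_p)^3}\chi(\operatorname{ac}f(x))\,|f(x)|^s\,|dx|,\qquad \operatorname{Re}(s)>0,$$ where $|dx|$ is the Haar measure on $\mathbb{Q}_p^3$ that gives $\mathbb{Z}_p^3$ measure one. **Candidate poles.** The candidate poles of $Z_{f,\chi}^0$ are the numbers $-\frac{\sigma(v_\tau)}{m(v_\tau)}+\frac{2k\pi i}{m(v_\tau)\log p}$ with $k\in\mathbb{Z}$ and $\tau$ a facet of $\Gamma_f$ such that $m(v_\tau)\ne 0$. A facet $\tau$ contributes to $s_0$ if $p^{\sigma(v_\tau)+m(v_\tau)s_0}=1$. **$B_1$-facets.** A facet is a $B_1$-simplex for the variable $x_i$ if it is a triangle with two vertices in $\{x_i=0\}$ and one vertex in $\{x_i=1\}$. A facet is non-compact for $x_j$ if it is stable under $x_j\mapsto x_j+1$. It is a non-compact $B_1$-facet for $x_i$ if it is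 non-compact for precisely one variable $x_j$, if $j\neq i$, and if its image under the projection forgetting $x_j$ is a line segment with one endpoint in $\{x_i=0\}$ and the other in $\{x_i=1\}$. A facet is $B_1$ for $x_i$ if it is a $B_1$-simplex or a non-compact $B_1$-facet for $x_i$; it is a $B_1$-facet if it is $B_1$ for some variable. **Statement.** Let $s_0$ be a candidate pole of $Z_{f,\chi}^0$ such that every facet of $\Gamma_f$ contributing to $s_0$ is a $B_1$-facet, and such that any two facets contributing to $s_0$ are either $B_1$ for a same variable or have at most one point in common. Then $s_0$ is not a pole of $Z_{f,\chi}^0$. -/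

import Mathlib

noncomputable section

namespace Igusa

/-! ### Newton polyhedra -/

section Newton

variable {ι : Type*} [Fintype ι] {R : Type*} [CommRing R]

/-- The exponent `ω ∈ ℕⁿ` seen as a point of `ℝⁿ`. -/
def expPoint (ω : ι →₀ ℕ) : ι → ℝ := fun i => (ω i : ℝ)

/-- The Newton polyhedron `Γ_f`: the convex hull of the union of the sets `ω + ℝ₊ⁿ` over the
exponents `ω` in the support of `f`. -/
def newtonPolyhedron (f : MvPolynomial ι R) : Set (ι → ℝ) :=
  convexHull ℝ (⋃ ω ∈ f.support, {x | ∀ i, expPoint ω i ≤ x i})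

/-- The faces of a polyhedron `P`: `P` itself and its intersections with supporting hyperplanes. -/
def IsFace (P τ : Set (ι → ℝ)) : Prop := τ.Nonempty ∧ IsExposed ℝ P τ

/-- A facet is a face of dimension `n - 1`, where `n = card ι` is the dimension of the space. -/
def IsFacet (P τ : Set (ι → ℝ)) : Prop :=
  IsFace P τ ∧ Module.finrank ℝ (vectorSpan ℝ τ) + 1 = Fintype.card ι

open Classical in
/-- The part `f_τ` of `f` supported on `τ`. -/
def facePart (f : MvPolynomial ι R) (τ : Set (ι → ℝ)) : MvPolynomial ι R :=
  ∑ ω ∈ f.support with expPoint ω ∈ τ, MvPolynomial.monomial ω (f.coeff ω)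

/-- The scalar product `v · x` of an integral vector `v ∈ ℕⁿ` and a point `x ∈ ℝⁿ`. -/
def pairing (v : ι → ℕ) (x : ι → ℝ) : ℝ := ∑ i, (v i : ℝ) * x i

/-- `m(v)`, the infimum of `v · x` over the Newton polyhedron of `f`. -/
def mVal (f : MvPolynomial ι R) (v : ι → ℕ) : ℝ := sInf (pairing v '' newtonPolyhedron f)

/-- `σ(v)`, the sum of the coordinates of `v`. -/
def sigmaVal (v : ι → ℕ) : ℕ := ∑ i, v i

/-- `v ∈ ℕⁿ` is primitive (in particular nonzero) and perpendicular to `τ`. For a facet `τ` of a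
Newton polyhedron there is exactly one such `v`. -/
def IsPrimitiveNormal (τ : Set (ι → ℝ)) (v : ι → ℕ) : Prop :=
  Finset.univ.gcd v = 1 ∧ ∀ x ∈ τ, ∀ y ∈ τ, pairing v x = pairing v y

/-- `S` is a `B₁`-simplex for the variable `i`: a simplex of dimension `n - 1` in `ℝⁿ`, `n = card ι`,
with one vertex in `{x_i = 1}` and the other `n - 1` vertices in `{x_i = 0}`. Its `n` vertices are
labelled by `ι` in such a way that the one in `{x_i = 1}` has label `i`. -/
def IsB1Simplex (i : ι) (S : Set (ι → ℝ)) : Prop :=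
  ∃ V : ι → (ι → ℝ), AffineIndependent ℝ V ∧ S = convexHull ℝ (Set.range V) ∧
    V i i = 1 ∧ ∀ j, j ≠ i → V j i = 0

/-- `τ` is non-compact for the variable `j`: it is stable under `x_j ↦ x_j + 1`. -/
def IsNonCompactFor (j : ι) (τ : Set (ι → ℝ)) : Prop :=
  ∀ x ∈ τ, (fun k => open Classical in if k = j then x k + 1 else x k) ∈ τ

/-- The projection that forgets the coordinate `j`. -/
def forget (j : ι) (x : ι → ℝ) : {k : ι // k ≠ j} → ℝ := fun k => x k

open Classical in
/-- `τ` is a non-compact `B₁`-facet for the variable `i`: it is non-compact for precisely one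
variable `j`, `j ≠ i`, and forgetting `x_j` maps it onto a `B₁`-simplex for `i`. -/
def IsNonCompactB1 (i : ι) (τ : Set (ι → ℝ)) : Prop :=
  ∃ (j : ι) (hij : i ≠ j), (∀ k, IsNonCompactFor k τ ↔ k = j) ∧
    IsB1Simplex (⟨i, hij⟩ : {k : ι // k ≠ j}) (forget j '' τ)

/-- The facet `τ` is `B₁` for the variable `i`. -/
def IsB1For (i : ι) (τ : Set (ι → ℝ)) : Prop := IsB1Simplex i τ ∨ IsNonCompactB1 i τ

end Newton

section Padic

variable {p : ℕ} [Fact p.Prime] {ι : Type*} [Fintype ι]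

/-- `f` is non-degenerated over `𝔽_p` with respect to all the compact faces of its Newton
polyhedron: for each such face `τ`, the reduction of `f_τ` modulo `p` and its partial derivatives
have no common zero in `(𝔽_p^×)ⁿ`. -/
def IsNondegenerate (f : MvPolynomial ι ℤ_[p]) : Prop :=
  ∀ τ : Set (ι → ℝ), IsFace (newtonPolyhedron f) τ → IsCompact τ →
    ∀ x : ι → ZMod p, (∀ i, x i ≠ 0) →
      ¬ (MvPolynomial.eval x ((facePart f τ).map PadicInt.toZMod) = 0 ∧
        ∀ i, MvPolynomial.eval x
          (MvPolynomial.pderiv i ((facePart f τ).map PadicInt.toZMod)) = 0)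

/-- The facet `τ` of `Γ_f` contributes to `s₀`: its primitive normal `v` satisfies
`p ^ (σ(v) + m(v) s₀) = 1`. -/
def Contributes (f : MvPolynomial ι ℤ_[p]) (τ : Set (ι → ℝ)) (s₀ : ℂ) : Prop :=
  ∃ v : ι → ℕ, IsPrimitiveNormal τ v ∧
    (p : ℂ) ^ ((sigmaVal v : ℂ) + (mVal f v : ℂ) * s₀) = 1

/-- The candidate poles of `Z⁰_{f,χ}`: the numbers `-σ(v)/m(v) + 2kπi/(m(v) log p)`, with `k ∈ ℤ`
and `v` the primitive normal of a facet of `Γ_f` such that `m(v) ≠ 0`. -/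
def IsCandidatePole (f : MvPolynomial ι ℤ_[p]) (s₀ : ℂ) : Prop :=
  ∃ (τ : Set (ι → ℝ)) (v : ι → ℕ) (k : ℤ), IsFacet (newtonPolyhedron f) τ ∧
    IsPrimitiveNormal τ v ∧ mVal f v ≠ 0 ∧
    s₀ = -(sigmaVal v : ℂ) / (mVal f v : ℂ) +
      2 * k * Real.pi * Complex.I / ((mVal f v : ℂ) * (Real.log p : ℂ))

/-! ### The twisted local zeta function -/

instance instMeasurableSpacePadicInt : MeasurableSpace ℤ_[p] := borel ℤ_[p]

instance instBorelSpacePadicInt : BorelSpace ℤ_[p] := ⟨rfl⟩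

/-- The Haar measure on `ℤ_pⁿ` of total mass one, i.e. the restriction to `ℤ_pⁿ` of the Haar
measure on `ℚ_pⁿ` that gives `ℤ_pⁿ` measure one. -/
def haar (p : ℕ) [Fact p.Prime] (ι : Type*) [Fintype ι] :
    MeasureTheory.Measure (ι → ℤ_[p]) :=
  MeasureTheory.Measure.addHaarMeasure ⊤

open Classical in
/-- `χ(ac a)` for `a ∈ ℤ_p`, where the angular component `ac a = |a| a` of `a ≠ 0` is the unit
`a p^(-ord a)`, and `χ(ac 0) = χ(0) = 0`. -/
def chiAc (χ : ℤ_[p]ˣ →* ℂˣ) (a : ℤ_[p]) : ℂ :=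
  if h : a ≠ 0 then (χ (PadicInt.unitCoeff h) : ℂ) else 0

/-- The integral of `χ(ac f(x)) |f(x)|^s` over `(pℤ_p)ⁿ`. -/
def twistedZetaIntegral (f : MvPolynomial ι ℤ_[p]) (χ : ℤ_[p]ˣ →* ℂˣ) (s : ℂ) : ℂ :=
  ∫ x in {x : ι → ℤ_[p] | ∀ i, (p : ℤ_[p]) ∣ x i},
    chiAc χ (MvPolynomial.eval x f) * ((‖MvPolynomial.eval x f‖ : ℝ) : ℂ) ^ s ∂(haar p ι)

/-- `Z` is a meromorphic continuation to `ℂ` of the local twisted zeta function, which is given by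
the integral for `Re s > 0`. By the identity theorem it is unique up to its values at the points
of a discrete set, so that its poles do not depend on any choice. -/
def IsTwistedZeta (f : MvPolynomial ι ℤ_[p]) (χ : ℤ_[p]ˣ →* ℂˣ) (Z : ℂ → ℂ) : Prop :=
  Meromorphic Z ∧ ∀ s : ℂ, 0 < s.re → Z s = twistedZetaIntegral f χ s

/-- `s₀` is a pole of the function `Z`. -/
def IsPole (Z : ℂ → ℂ) (s₀ : ℂ) : Prop := meromorphicOrderAt Z s₀ < 0

end Padic

end Igusa

end

/-! Put z = p^(-s). For a vector k of positive integers let F(k) be the set of exponents of f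
minimising k·ω, let m(k) be the minimum, and let L(T) be the sum of ψ(f_T(a)) over the torus of 𝔽_p,
where ψ is the character of 𝔽_p^× induced by χ. Sorting the points of (pℤ_p)^3 by the orders k and
the angular residues of their coordinates gives Z = p^(-3) Σ_k L(F(k)) p^(-σ(k)) z^(m(k))
(`twistedZetaIntegral_eq`). No further factor in s occurs: over a residue class with a smooth zero
of the initial form the integral vanishes, because χ is non-trivial.

On each cone of the normal fan this is a lattice sum, whose denominators 1 - p^(-σ(w)) z^(m(w)) come
from the rays w, the primitive normals of facets. Let C be the set of contributing rays. The sum has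
to be rewritten so that no ray of C is needed as a generator.

The source of cancellation is a peeling rule: if T has exactly one exponent Q outside {x_i = 0}, and
Q_i = 1, then (p - 1) L(T) = -L(T ∩ {x_i = 0}) (`torusSum_insert`). Let F(k) lie in a facet of C
assigned to i and contain exponents with x_i = 0 and with x_i = 1. Along k + t e_i the face drops to
F(k) ∩ {x_i = 0} as soon as t > 0, m does not change, and Σ_{t ≥ 1} p^(-t) = 1/(p - 1), so the fiber
sums to zero (`tsum_fiber_eq_zero`). All these fibers are deleted.

Fibers in two directions i and j may meet, but only where L vanishes (`eq_zero_of_isRemoved`).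
Otherwise the face would be a vertex A on the third axis l with A_l ≥ 2 (`exists_corner`). Through A
passes at most one B₁-facet for i, and it minimises the slope k_j / k_l (`B1Data.slope_lt`); points
removed in direction i have a smaller slope than every other ray, and likewise with i and j
exchanged. The two conditions are incompatible.

The points left over in the cone of a face with L ≠ 0 fall into finitely many sets, each stable
under addition of certain rays outside C and contained in the cone they span (`exists_partition`).
Away from corners this is seen by descending from k along -e_i until the face grows: k is removed
exactly when the face reached lies in a facet of C. At a corner the leftover points are those in the
cone of all rays outside C (`Corner.mem_coneSpan`, `Corner.notRemoved_of_mem`). Such a set has a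
generating function with denominator ∏ (1 - x^w) over its rays (`exists_polynomial_tsum_mul_prod`),
which is non-zero at z₀ = p^(-s₀). Hence Z continues to a rational function of p^(-s) that is
regular at s₀, and the identity theorem transfers this to every continuation. -/

open MeasureTheory

namespace Igusa

/-! ### Haar measure on compact ultrametric groups -/

/-- An isometry of a compact metric space into itself is surjective. -/
theorem surjective_of_isometry_of_compactSpace {X : Type*} [MetricSpace X] [CompactSpace X]
    {T : X → X} (hT : Isometry T) : Function.Surjective T := by
  intro x
  by_contra hx
  have hx' : x ∉ Set.range T := fun ⟨y, hy⟩ => hx ⟨y, hy⟩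
  have hcl : IsClosed (Set.range T) := (isCompact_range hT.continuous).isClosed
  obtain ⟨ε, hε, hball⟩ := Metric.isOpen_iff.1 hcl.isOpen_compl x hx'
  have hiter : ∀ n, Isometry (T^[n]) := fun n => by
    induction n with
    | zero => exact isometry_id
    | succ n ih => rw [Function.iterate_succ']; exact hT.comp ih
  -- A point at distance ε from the range has an ε-separated orbit, which contradicts sequential
  -- compactness.
  have hsep : ∀ m n, m < n → ε ≤ dist (T^[m] x) (T^[n] x) := by
    intro m n hmn
    obtain ⟨k, rfl⟩ := Nat.exists_eq_add_of_lt hmn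
    have : T^[m + k + 1] x = T^[m] (T (T^[k] x)) := by
      rw [add_assoc, Function.iterate_add_apply, Function.iterate_succ_apply']
    rw [this, (hiter m).dist_eq]
    by_contra hlt
    push Not at hlt
    exact hball (by rwa [Metric.mem_ball, dist_comm]) ⟨_, rfl⟩
  obtain ⟨a, -, φ, hφ, hlim⟩ := isCompact_univ.tendsto_subseq
    (x := fun n => T^[n] x) (fun _ => Set.mem_univ _)
  have hc := hlim.cauchySeq
  rw [Metric.cauchySeq_iff] at hc
  obtain ⟨N, hN⟩ := hc ε hε
  have := hN N le_rfl (N + 1) (Nat.le_succ N)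
  exact absurd (hsep _ _ (hφ (Nat.lt_succ_self N))) (not_le.2 this)

/-- An isometry of a compact ultrametric group preserves Haar measure. -/
theorem measurePreserving_of_isometry {G : Type*} [NormedAddCommGroup G] [CompactSpace G]
    [IsUltrametricDist G] [MeasurableSpace G] [BorelSpace G] [SecondCountableTopology G]
    [MeasurableAdd G]
    (μ : Measure G) [IsFiniteMeasure μ] [μ.IsAddLeftInvariant] {T : G → G} (hT : Isometry T) :
    MeasurePreserving T μ μ := by
  have hTm : Measurable T := hT.continuous.measurable
  refine ⟨hTm, ?_⟩
  have hball : ∀ (x y : G) (r : ℝ), μ (Metric.closedBall x r) = μ (Metric.closedBall y r) := by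
    intro x y r
    have : (fun z => (x - y) + z) ⁻¹' Metric.closedBall x r = Metric.closedBall y r := by
      ext z
      simp only [Set.mem_preimage, Metric.mem_closedBall]
      have : dist (x - y + z) x = dist z y := by
        rw [dist_eq_norm, dist_eq_norm]; congr 1; abel
      rw [this]
    rw [← this, measure_preimage_add]
  -- In an ultrametric space two closed balls are nested or disjoint, so the balls together with ∅
  -- form a π-system generating the Borel sets. By surjectivity the centre of a ball is some T y,
  -- and its preimage is the ball of the same radius about y.
  let C : Set (Set G) := {s | s = ∅ ∨ ∃ x, ∃ r : ℝ, 0 < r ∧ s = Metric.closedBall x r}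
  have hbasis : TopologicalSpace.IsTopologicalBasis C := by
    refine TopologicalSpace.isTopologicalBasis_of_isOpen_of_nhds ?_ ?_
    · rintro s (rfl | ⟨x, r, hr, rfl⟩)
      · exact isOpen_empty
      · exact IsUltrametricDist.isOpen_closedBall x hr.ne'
    · intro a u ha hu
      obtain ⟨r, hr, h⟩ := Metric.nhds_basis_closedBall.mem_iff.1 (hu.mem_nhds ha)
      exact ⟨_, Or.inr ⟨a, r, hr, rfl⟩, Metric.mem_closedBall_self hr.le, h⟩
  have hgen := (BorelSpace.measurable_eq (α := G)).trans hbasis.borel_eq_generateFrom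
  refine MeasureTheory.ext_of_generate_finite C hgen ?_ ?_ ?_
  · rintro s (rfl | ⟨x, r, hr, rfl⟩) t (rfl | ⟨y, r', hr', rfl⟩) hne
    · exact Or.inl (by simp)
    · exact Or.inl (by simp)
    · exact Or.inl (by simp)
    · obtain ⟨z, hz, hz'⟩ := hne
      rw [IsUltrametricDist.closedBall_eq_of_mem hz, IsUltrametricDist.closedBall_eq_of_mem hz']
      refine Or.inr ⟨z, min r r', lt_min hr hr', ?_⟩
      ext w
      simp
  · rintro s (rfl | ⟨x, r, hr, rfl⟩)
    · simp
    · obtain ⟨y, rfl⟩ := surjective_of_isometry_of_compactSpace hT x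
      rw [Measure.map_apply hTm Metric.isClosed_closedBall.measurableSet]
      rw [hT.preimage_closedBall]
      exact hball _ _ _
  · rw [Measure.map_apply hTm MeasurableSet.univ, Set.preimage_univ]

section

variable {p : ℕ} [Fact p.Prime] {ι : Type*} [Fintype ι]

instance instIsAddHaarMeasureHaar : (haar p ι).IsAddHaarMeasure := by
  unfold haar; infer_instance

instance instIsProbabilityMeasureHaar : IsProbabilityMeasure (haar p ι) :=
  ⟨by simpa [haar] using
    Measure.addHaarMeasure_self (K₀ := (⊤ : TopologicalSpace.PositiveCompacts (ι → ℤ_[p])))⟩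

theorem padicInt_dvd_sub_iff_toZModPow_eq {n : ℕ} {x y : ℤ_[p]} :
    (p : ℤ_[p]) ^ n ∣ x - y ↔ PadicInt.toZModPow n x = PadicInt.toZModPow n y := by
  rw [← Ideal.mem_span_singleton, ← PadicInt.ker_toZModPow, RingHom.mem_ker, map_sub, sub_eq_zero]

/-- Multiplication of the coordinates of `ℤ_pⁿ` by powers of `p`. -/
noncomputable def scaleHom (p : ℕ) [Fact p.Prime] {ι : Type*} (n : ι → ℕ) : (ι → ℤ_[p]) →+ (ι → ℤ_[p]) where
  toFun x := fun i => (p : ℤ_[p]) ^ n i * x i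
  map_zero' := by ext; simp
  map_add' x y := by ext; simp [mul_add]

theorem scaleHom_apply {ι : Type*} (n : ι → ℕ) (x : ι → ℤ_[p]) (i : ι) :
    scaleHom p n x i = (p : ℤ_[p]) ^ n i * x i := rfl

theorem scaleHom_injective {ι : Type*} (n : ι → ℕ) : Function.Injective (scaleHom p (ι := ι) n) := by
  intro x y h
  ext1 i
  have := congrFun h i
  simp only [scaleHom_apply] at this
  exact mul_left_cancel₀ (pow_ne_zero _ (Nat.cast_ne_zero.2 (Fact.out : p.Prime).ne_zero)) this

theorem continuous_scaleHom {ι : Type*} (n : ι → ℕ) : Continuous (scaleHom p (ι := ι) n) := by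
  refine continuous_pi fun i => ?_
  simp only [scaleHom_apply]
  fun_prop

omit [Fintype ι] in
theorem isClosedEmbedding_scaleHom (n : ι → ℕ) :
    Topology.IsClosedEmbedding (scaleHom p (ι := ι) n) :=
  (continuous_scaleHom n).isClosedEmbedding (scaleHom_injective n)

theorem mem_range_scaleHom {ι : Type*} {n : ι → ℕ} {x : ι → ℤ_[p]} :
    x ∈ Set.range (scaleHom p n) ↔ ∀ i, (p : ℤ_[p]) ^ n i ∣ x i := by
  constructor
  · rintro ⟨y, rfl⟩ i
    exact ⟨y i, rfl⟩
  · intro h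
    choose y hy using h
    exact ⟨y, by ext1 i; rw [scaleHom_apply, ← hy]⟩

/-- The image is the kernel of the reduction onto ∏ ℤ/p^(n i), a subgroup whose index is the order
of that group. -/
theorem haar_range_scaleHom (n : ι → ℕ) :
    haar p ι (Set.range (scaleHom p n)) = ((p : ENNReal) ^ (∑ i, n i))⁻¹ := by
  have hp : p.Prime := Fact.out
  let g : (ι → ℤ_[p]) →+ (∀ i, ZMod (p ^ n i)) :=
    { toFun := fun x i => PadicInt.toZModPow (n i) (x i)
      map_zero' := by ext; simp
      map_add' := fun x y => by ext; simp }
  have hgs : Function.Surjective g := fun y => by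
    choose x hx using fun i => ZMod.ringHom_surjective (PadicInt.toZModPow (p := p) (n i)) (y i)
    exact ⟨x, funext hx⟩
  have hker : (g.ker : Set (ι → ℤ_[p])) = Set.range (scaleHom p n) := by
    ext x
    rw [mem_range_scaleHom, SetLike.mem_coe, AddMonoidHom.mem_ker, funext_iff]
    refine forall_congr' fun i => ?_
    have := padicInt_dvd_sub_iff_toZModPow_eq (p := p) (n := n i) (x := x i) (y := 0)
    rw [sub_zero, map_zero] at this
    exact this.symm
  have hindex : g.ker.index = p ^ ∑ i, n i := by
    rw [AddSubgroup.index_ker, AddMonoidHom.range_eq_top.2 hgs]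
    have : Nat.card (⊤ : AddSubgroup (∀ i, ZMod (p ^ n i))) = Nat.card (∀ i, ZMod (p ^ n i)) :=
      Nat.card_congr AddSubgroup.topEquiv.toEquiv
    rw [this, Nat.card_pi]
    simp [Finset.prod_pow_eq_pow_sum]
  have hpos : p ^ (∑ i, n i) ≠ 0 := pow_ne_zero _ hp.ne_zero
  have : g.ker.FiniteIndex := ⟨by rw [hindex]; exact hpos⟩
  have hmeas : MeasurableSet (g.ker : Set (ι → ℤ_[p])) := by
    rw [hker]; exact (isClosedEmbedding_scaleHom n).isClosed_range.measurableSet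
  have := AddSubgroup.index_mul_measure g.ker hmeas (haar p ι)
  rw [hindex, hker, measure_univ] at this
  rw [← Nat.cast_pow]
  exact ENNReal.eq_inv_of_mul_eq_one_left (by rwa [mul_comm])

/-- Change of variables `x = c + p^n y` in an integral over `ℤ_pⁿ`. -/
theorem setIntegral_range_add_scaleHom (n : ι → ℕ) (c : ι → ℤ_[p]) (F : (ι → ℤ_[p]) → ℂ) :
    ∫ x in Set.range (fun y => c + scaleHom p n y), F x ∂(haar p ι) =
      ((p : ℂ) ^ (∑ i, n i))⁻¹ * ∫ y, F (c + scaleHom p n y) ∂(haar p ι) := by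
  have hemb := (isClosedEmbedding_scaleHom (p := p) n).measurableEmbedding
  have hemb' : MeasurableEmbedding (fun y => c + scaleHom p n y) :=
    (measurableEmbedding_addLeft c).comp hemb
  -- The pullback is again translation invariant, hence a multiple of Haar measure, and the factor
  -- is read off from the total mass.
  set ν := Measure.comap (fun y => c + scaleHom p n y) (haar p ι) with hν
  have hνapp : ∀ s, ν s = haar p ι ((fun y => c + scaleHom p n y) '' s) :=
    fun s => hemb'.comap_apply _ _
  have hνuniv : ν Set.univ = ((p : ENNReal) ^ (∑ i, n i))⁻¹ := by
    rw [hνapp, Set.image_univ, ← haar_range_scaleHom n,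
      show Set.range (fun y => c + scaleHom p n y) = (fun y => c + y) '' Set.range (scaleHom p n) from
        Set.range_comp (fun y => c + y) (scaleHom p n), Set.image_add_left, measure_preimage_add]
  have : IsFiniteMeasure ν := ⟨by
    rw [hνuniv]
    exact ENNReal.inv_lt_top.2 (pos_iff_ne_zero.2 (pow_ne_zero _ (by exact_mod_cast (Fact.out : p.Prime).ne_zero)))⟩
  have : ν.IsAddLeftInvariant := ⟨fun z => by
    refine Measure.ext fun s hs => ?_
    rw [Measure.map_apply (measurable_const_add z) hs, hνapp, hνapp]
    have : (fun y => c + scaleHom p n y) '' ((fun y => z + y) ⁻¹' s) =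
        (fun y => scaleHom p n z + y) ⁻¹' ((fun y => c + scaleHom p n y) '' s) := by
      ext w
      simp only [Set.mem_image, Set.mem_preimage]
      constructor
      · rintro ⟨y, hy, rfl⟩
        exact ⟨z + y, hy, by rw [map_add]; abel⟩
      · rintro ⟨y, hy, hw⟩
        refine ⟨y - z, by simpa using hy, ?_⟩
        rw [map_sub, ← add_sub_assoc, hw]; abel
    rw [this, measure_preimage_add]⟩
  have hsmul := Measure.isAddLeftInvariant_eq_smul ν (haar p ι)
  have hc : (Measure.addHaarScalarFactor ν (haar p ι) : ENNReal) = ((p : ENNReal) ^ (∑ i, n i))⁻¹ := by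
    have h := congrArg (fun m : Measure (ι → ℤ_[p]) => m Set.univ) hsmul
    simp only [Measure.smul_apply, measure_univ, hνuniv] at h
    rw [h]
    simp [ENNReal.smul_def]
  rw [← hemb'.map_comap, ← hν, hemb'.integral_map, hsmul, integral_smul_nnreal_measure]
  have hc' : ((Measure.addHaarScalarFactor ν (haar p ι) : NNReal) : ℝ) = ((p : ℝ) ^ (∑ i, n i))⁻¹ := by
    have := congrArg ENNReal.toReal hc
    simpa using this
  rw [NNReal.smul_def, hc', Complex.real_smul]
  push_cast
  rfl

end

end Igusa

open MeasureTheory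

namespace Igusa

section

variable {p : ℕ} [Fact p.Prime] {ι : Type*}

/-! ### Taylor expansion of polynomials over `ℤ_p` -/

theorem padicInt_norm_add_le {x y : ℤ_[p]} {r : ℝ} (hx : ‖x‖ ≤ r) (hy : ‖y‖ ≤ r) : ‖x + y‖ ≤ r :=
  (PadicInt.nonarchimedean x y).trans (max_le hx hy)

theorem padicInt_norm_mul_le {x y : ℤ_[p]} {r : ℝ} (hy : ‖y‖ ≤ r) : ‖x * y‖ ≤ r := by
  rw [norm_mul]
  exact (mul_le_of_le_one_left (norm_nonneg _) (PadicInt.norm_le_one x)).trans hy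

theorem norm_eval_add_sub_le (g : MvPolynomial ι ℤ_[p]) (x δ : ι → ℤ_[p]) {r : ℝ} (hr : 0 ≤ r)
    (hδ : ∀ i, ‖δ i‖ ≤ r) :
    ‖MvPolynomial.eval (x + δ) g - MvPolynomial.eval x g‖ ≤ r := by
  induction g using MvPolynomial.induction_on with
  | C a => simpa using hr
  | add g h hg hh =>
    rw [map_add, map_add, add_sub_add_comm]
    exact padicInt_norm_add_le hg hh
  | mul_X g i hg =>
    have : MvPolynomial.eval (x + δ) (g * MvPolynomial.X i) -
        MvPolynomial.eval x (g * MvPolynomial.X i) =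
        x i * (MvPolynomial.eval (x + δ) g - MvPolynomial.eval x g) +
          MvPolynomial.eval (x + δ) g * δ i := by
      simp only [map_mul, MvPolynomial.eval_X, Pi.add_apply]; ring
    rw [this]
    exact padicInt_norm_add_le (padicInt_norm_mul_le hg) (padicInt_norm_mul_le (hδ i))

/-- By the product rule the remainder of `g * X i` is `x i` times that of `g` plus `δ i` times the
first-order difference of `g`, which is itself at most r. -/
theorem norm_eval_add_sub_linear_le [Fintype ι] (g : MvPolynomial ι ℤ_[p]) (x δ : ι → ℤ_[p]) {r : ℝ}
    (hr : 0 ≤ r) (hδ : ∀ i, ‖δ i‖ ≤ r) :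
    ‖MvPolynomial.eval (x + δ) g - MvPolynomial.eval x g -
      ∑ j, MvPolynomial.eval x (MvPolynomial.pderiv j g) * δ j‖ ≤ r ^ 2 := by
  classical
  induction g using MvPolynomial.induction_on with
  | C a => simpa using sq_nonneg r
  | add g h hg hh =>
    simp only [map_add, add_mul, Finset.sum_add_distrib]
    rw [add_sub_add_comm, add_sub_add_comm]
    exact padicInt_norm_add_le hg hh
  | mul_X g i hg =>
    have : MvPolynomial.eval (x + δ) (g * MvPolynomial.X i) -
        MvPolynomial.eval x (g * MvPolynomial.X i) -
        ∑ j, MvPolynomial.eval x (MvPolynomial.pderiv j (g * MvPolynomial.X i)) * δ j =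
        x i * (MvPolynomial.eval (x + δ) g - MvPolynomial.eval x g -
          ∑ j, MvPolynomial.eval x (MvPolynomial.pderiv j g) * δ j) +
          δ i * (MvPolynomial.eval (x + δ) g - MvPolynomial.eval x g) := by
      have hs : ∑ j, MvPolynomial.eval x (MvPolynomial.pderiv j (g * MvPolynomial.X i)) * δ j =
          x i * ∑ j, MvPolynomial.eval x (MvPolynomial.pderiv j g) * δ j +
            MvPolynomial.eval x g * δ i := by
        have : ∀ j, MvPolynomial.eval x (MvPolynomial.pderiv j (g * MvPolynomial.X i)) * δ j =
            x i * (MvPolynomial.eval x (MvPolynomial.pderiv j g) * δ j) +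
              (if j = i then MvPolynomial.eval x g * δ j else 0) := by
          intro j
          rw [Derivation.leibniz, MvPolynomial.pderiv_X]
          by_cases h : j = i
          · subst h; simp; ring
          · have h' : i ≠ j := fun e => h e.symm
            simp [h]; ring
        simp only [this, Finset.sum_add_distrib, ← Finset.mul_sum]
        simp
      rw [hs]
      simp only [map_mul, MvPolynomial.eval_X, Pi.add_apply]; ring
    rw [this]
    refine padicInt_norm_add_le (padicInt_norm_mul_le hg) ?_
    rw [norm_mul, sq]
    exact mul_le_mul (hδ i) (norm_eval_add_sub_le g x δ hr hδ) (norm_nonneg _) hr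

theorem toZMod_eq_zero_iff_dvd {x : ℤ_[p]} : PadicInt.toZMod x = 0 ↔ (p : ℤ_[p]) ∣ x := by
  rw [← RingHom.mem_ker, PadicInt.ker_toZMod, PadicInt.maximalIdeal_eq_span_p,
    Ideal.mem_span_singleton]

theorem norm_eq_one_iff_toZMod_ne_zero {x : ℤ_[p]} : ‖x‖ = 1 ↔ PadicInt.toZMod x ≠ 0 := by
  rw [Ne, toZMod_eq_zero_iff_dvd, ← PadicInt.norm_lt_one_iff_dvd, not_lt]
  exact ⟨fun h => h.ge, fun h => le_antisymm (PadicInt.norm_le_one x) h⟩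

theorem toZMod_eval (g : MvPolynomial ι ℤ_[p]) (x : ι → ℤ_[p]) :
    PadicInt.toZMod (MvPolynomial.eval x g) =
      MvPolynomial.eval (fun i => PadicInt.toZMod (x i)) (g.map PadicInt.toZMod) := by
  rw [MvPolynomial.eval_map]
  exact MvPolynomial.eval₂_comp_left PadicInt.toZMod (RingHom.id _) x g

/-! ### The angular component character -/

theorem chiAc_unit_mul_pow (χ : ℤ_[p]ˣ →* ℂˣ) (u : ℤ_[p]ˣ) (n : ℕ) :
    chiAc χ ((u : ℤ_[p]) * (p : ℤ_[p]) ^ n) = (χ u : ℂ) := by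
  have hp : (p : ℤ_[p]) ≠ 0 := Nat.cast_ne_zero.2 (Fact.out : p.Prime).ne_zero
  have h : (u : ℤ_[p]) * (p : ℤ_[p]) ^ n ≠ 0 := mul_ne_zero u.ne_zero (pow_ne_zero _ hp)
  have hval : ((u : ℤ_[p]) * (p : ℤ_[p]) ^ n).valuation = n := by
    rw [PadicInt.valuation_mul u.ne_zero (pow_ne_zero _ hp), PadicInt.valuation_pow,
      PadicInt.valuation_p]
    have : (u : ℤ_[p]).valuation = 0 := by
      have := PadicInt.norm_eq_zpow_neg_valuation u.ne_zero
      rw [PadicInt.norm_units] at this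
      have hp1 : (1 : ℝ) < p := by exact_mod_cast (Fact.out : p.Prime).one_lt
      have h2 := zpow_right_injective₀ (by positivity) hp1.ne' (this.symm.trans (zpow_zero _).symm)
      simpa using h2
    simp [this]
  have hspec := PadicInt.unitCoeff_spec h
  rw [hval] at hspec
  have : PadicInt.unitCoeff h = u := Units.ext (mul_right_cancel₀ (pow_ne_zero _ hp) hspec).symm
  rw [chiAc, dif_pos h, this]

theorem chiAc_unit_mul (χ : ℤ_[p]ˣ →* ℂˣ) (u : ℤ_[p]ˣ) (x : ℤ_[p]) :
    chiAc χ ((u : ℤ_[p]) * x) = (χ u : ℂ) * chiAc χ x := by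
  by_cases hx : x = 0
  · simp [hx, chiAc]
  · rw [PadicInt.unitCoeff_spec hx, ← mul_assoc, ← Units.val_mul, chiAc_unit_mul_pow,
      chiAc_unit_mul_pow, map_mul, Units.val_mul]

theorem chiAc_pow_mul (χ : ℤ_[p]ˣ →* ℂˣ) (n : ℕ) (x : ℤ_[p]) :
    chiAc χ ((p : ℤ_[p]) ^ n * x) = chiAc χ x := by
  by_cases hx : x = 0
  · simp [hx]
  · rw [PadicInt.unitCoeff_spec hx, mul_left_comm, ← pow_add, chiAc_unit_mul_pow,
      chiAc_unit_mul_pow]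

theorem norm_chiAc_unit (χ : ℤ_[p]ˣ →* ℂˣ) {ψ : MulChar (ZMod p) ℂ}
    (hψ : ∀ u : ℤ_[p]ˣ, (χ u : ℂ) = ψ (PadicInt.toZMod (u : ℤ_[p]))) (x : ℤ_[p]) :
    ‖chiAc χ x‖ ≤ 1 := by
  by_cases hx : x = 0
  · simp [hx, chiAc]
  · rw [chiAc, dif_pos hx, hψ]
    exact DirichletCharacter.norm_le_one ψ _

theorem chiAc_of_toZMod_ne_zero (χ : ℤ_[p]ˣ →* ℂˣ) {ψ : MulChar (ZMod p) ℂ}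
    (hψ : ∀ u : ℤ_[p]ˣ, (χ u : ℂ) = ψ (PadicInt.toZMod (u : ℤ_[p]))) {x : ℤ_[p]}
    (hx : PadicInt.toZMod x ≠ 0) : chiAc χ x = ψ (PadicInt.toZMod x) := by
  obtain ⟨u, rfl⟩ := PadicInt.isUnit_iff.2 (norm_eq_one_iff_toZMod_ne_zero.2 hx)
  have := chiAc_unit_mul_pow χ u 0
  rw [pow_zero, mul_one] at this
  rw [this, hψ]

/-- A character of `ℤ_pˣ` that is trivial on `1 + pℤ_p` comes from a character of `𝔽_pˣ`. -/
theorem exists_mulChar_of_trivial (χ : ℤ_[p]ˣ →* ℂˣ) (hχ : χ ≠ 1)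
    (hχ1 : ∀ u : ℤ_[p]ˣ, (p : ℤ_[p]) ∣ (u : ℤ_[p]) - 1 → χ u = 1) :
    ∃ ψ : MulChar (ZMod p) ℂ, ψ ≠ 1 ∧
      ∀ u : ℤ_[p]ˣ, (χ u : ℂ) = ψ (PadicInt.toZMod (u : ℤ_[p])) := by
  let g : ℤ_[p]ˣ →* (ZMod p)ˣ := Units.map (PadicInt.toZMod (p := p)).toMonoidHom
  have hg : Function.Surjective g := by
    intro v
    obtain ⟨x, hx⟩ := ZMod.ringHom_surjective (PadicInt.toZMod (p := p)) v
    obtain ⟨u, hu⟩ := PadicInt.isUnit_iff.2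
      (norm_eq_one_iff_toZMod_ne_zero.2 (show PadicInt.toZMod x ≠ 0 by rw [hx]; exact v.ne_zero))
    exact ⟨u, Units.ext (by rw [← hx, ← hu]; rfl)⟩
  have hker : g.ker ≤ χ.ker := by
    intro u hu
    rw [MonoidHom.mem_ker] at hu ⊢
    refine hχ1 u (toZMod_eq_zero_iff_dvd.1 ?_)
    have : PadicInt.toZMod (u : ℤ_[p]) = 1 := congrArg Units.val hu
    rw [map_sub, this, map_one, sub_self]
  let θ : (ZMod p)ˣ →* ℂˣ := MonoidHom.liftOfSurjective g hg ⟨χ, hker⟩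
  have hθ : ∀ u, θ (g u) = χ u := fun u =>
    MonoidHom.liftOfRightInverse_comp_apply g _ (Function.rightInverse_surjInv hg) ⟨χ, hker⟩ u
  have hval : ∀ u : ℤ_[p]ˣ, (χ u : ℂ) = MulChar.ofUnitHom θ (PadicInt.toZMod (u : ℤ_[p])) := by
    intro u
    have : PadicInt.toZMod (u : ℤ_[p]) = ((g u : (ZMod p)ˣ) : ZMod p) := rfl
    rw [this, MulChar.ofUnitHom_coe, hθ]
  refine ⟨MulChar.ofUnitHom θ, fun h => hχ ?_, hval⟩
  ext u
  rw [hval u, h]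
  have : PadicInt.toZMod (u : ℤ_[p]) = ((g u : (ZMod p)ˣ) : ZMod p) := rfl
  rw [this, MulChar.one_apply_coe]
  rfl

/-- Away from 0 the function is locally constant: if |b - a| < |a| then b = (1 + c) a with c
divisible by p. -/
theorem measurable_chiAc (χ : ℤ_[p]ˣ →* ℂˣ)
    (hχ1 : ∀ u : ℤ_[p]ˣ, (p : ℤ_[p]) ∣ (u : ℤ_[p]) - 1 → χ u = 1) : Measurable (chiAc χ) := by
  refine measurable_of_continuousOn_compl_singleton 0 ?_
  refine continuousOn_of_forall_continuousAt fun a ha => ?_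
  have ha : a ≠ 0 := ha
  refine (continuousAt_const (y := chiAc χ a)).congr ?_
  filter_upwards [Metric.ball_mem_nhds a (norm_pos_iff.2 ha)] with b hb
  rw [Metric.mem_ball, dist_eq_norm] at hb
  obtain ⟨c, hc⟩ : a ∣ b - a := by
    rw [PadicInt.unitCoeff_spec ha, (Units.isUnit _).mul_left_dvd, ← PadicInt.unitCoeff_spec ha,
      ← Ideal.mem_span_singleton, ← PadicInt.norm_le_pow_iff_mem_span_pow,
      ← PadicInt.norm_eq_zpow_neg_valuation ha]
    exact hb.le
  have hcn : ‖c‖ < 1 := by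
    rw [hc, norm_mul] at hb
    exact lt_of_mul_lt_mul_left (by simpa using hb) (norm_nonneg a)
  have hpc := (PadicInt.norm_lt_one_iff_dvd c).1 hcn
  have hunit : ‖1 + c‖ = 1 := by
    rw [norm_eq_one_iff_toZMod_ne_zero, map_add, toZMod_eq_zero_iff_dvd.2 hpc]; simp
  obtain ⟨u, hu⟩ := PadicInt.isUnit_iff.2 hunit
  have hb' : b = u * a := by rw [hu]; linear_combination hc
  rw [hb', chiAc_unit_mul, hχ1 u (by rw [hu]; simpa using hpc)]
  simp

end

end Igusa

open MeasureTheory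

namespace Igusa

section

variable {p : ℕ} [Fact p.Prime] {ι : Type*} [Fintype ι]

/-! ### Integrals over residue classes -/

/-- The integrand of the twisted zeta integral as a function of the value of `f`. -/
noncomputable def zetaKernel (χ : ℤ_[p]ˣ →* ℂˣ) (s : ℂ) (c : ℤ_[p]) : ℂ :=
  chiAc χ c * ((‖c‖ : ℝ) : ℂ) ^ s

theorem zetaKernel_unit_mul (χ : ℤ_[p]ˣ →* ℂˣ) (s : ℂ) (u : ℤ_[p]ˣ) (c : ℤ_[p]) :
    zetaKernel χ s (u * c) = (χ u : ℂ) * zetaKernel χ s c := by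
  rw [zetaKernel, zetaKernel, chiAc_unit_mul, norm_mul, PadicInt.norm_units, one_mul, mul_assoc]

theorem zetaKernel_pow_mul (χ : ℤ_[p]ˣ →* ℂˣ) (s : ℂ) (n : ℕ) (c : ℤ_[p]) :
    zetaKernel χ s ((p : ℤ_[p]) ^ n * c) = ((p : ℂ) ^ (-s)) ^ n * zetaKernel χ s c := by
  rw [zetaKernel, zetaKernel, chiAc_pow_mul, norm_mul, PadicInt.norm_p_pow,
    Complex.ofReal_mul, Complex.mul_cpow_ofReal_nonneg (by positivity) (norm_nonneg _)]
  have : (((p : ℝ) ^ (-(n : ℤ)) : ℝ) : ℂ) ^ s = ((p : ℂ) ^ (-s)) ^ n := by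
    rw [zpow_neg, zpow_natCast, Complex.ofReal_inv, Complex.ofReal_pow, Complex.ofReal_natCast,
      ← Nat.cast_pow, Complex.inv_cpow _ _ (by rw [Complex.natCast_arg]; exact Real.pi_pos.ne),
      Nat.cast_pow, ← Complex.natCast_cpow_natCast_mul, ← Complex.cpow_neg, ← mul_neg,
      Complex.cpow_nat_mul]
  rw [this]; ring

theorem norm_zetaKernel_le (χ : ℤ_[p]ˣ →* ℂˣ) {ψ : MulChar (ZMod p) ℂ}
    (hψ : ∀ u : ℤ_[p]ˣ, (χ u : ℂ) = ψ (PadicInt.toZMod (u : ℤ_[p]))) {s : ℂ} (hs : 0 < s.re)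
    (c : ℤ_[p]) : ‖zetaKernel χ s c‖ ≤ 1 := by
  rw [zetaKernel, norm_mul]
  refine mul_le_one₀ (norm_chiAc_unit χ hψ c) (norm_nonneg _) ?_
  rw [Complex.norm_cpow_eq_rpow_re_of_nonneg (norm_nonneg _) hs.ne']
  exact Real.rpow_le_one (norm_nonneg _) (PadicInt.norm_le_one c) hs.le

theorem measurable_zetaKernel (χ : ℤ_[p]ˣ →* ℂˣ)
    (hχ1 : ∀ u : ℤ_[p]ˣ, (p : ℤ_[p]) ∣ (u : ℤ_[p]) - 1 → χ u = 1) (s : ℂ) :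
    Measurable (zetaKernel χ s) := by
  unfold zetaKernel
  exact (measurable_chiAc χ hχ1).mul
    ((Complex.measurable_ofReal.comp measurable_norm).pow_const s)

/-- An ultrametric inverse function theorem. The increment of H is a unit times `ε i`, plus a
combination of the other `ε j`, plus an error smaller than |ε| by the factor |p|. If the image moved
by r' < r = |ε|, the other `ε j` would be at most r', and solving for `ε i` would bound it by
max(r', |p| r) < r. -/
theorem isometry_update [DecidableEq ι] (i : ι) (H : (ι → ℤ_[p]) → ℤ_[p])
    (D : (ι → ℤ_[p]) → ι → ℤ_[p]) (hD : ∀ y, ‖D y i‖ = 1)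
    (hH : ∀ (y ε : ι → ℤ_[p]) (r : ℝ), 0 ≤ r → (∀ j, ‖ε j‖ ≤ r) →
      ‖H (y + ε) - H y - ∑ j, D y j * ε j‖ ≤ ‖(p : ℤ_[p])‖ * r) :
    Isometry fun y => Function.update y i (H y) := by
  have hp1 : ‖(p : ℤ_[p])‖ < 1 := (PadicInt.norm_lt_one_iff_dvd _).2 dvd_rfl
  refine Isometry.of_dist_eq fun z y => ?_
  obtain ⟨ε, rfl⟩ : ∃ ε, z = y + ε := ⟨z - y, by abel⟩
  rw [dist_eq_norm, dist_eq_norm, add_sub_cancel_left]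
  set r := ‖ε‖ with hr
  have hεr : ∀ j, ‖ε j‖ ≤ r := fun j => norm_le_pi_norm ε j
  have key := hH y ε r (norm_nonneg _) hεr
  have hsum : ∀ r', (∀ j, j ≠ i → ‖ε j‖ ≤ r') → 0 ≤ r' →
      ‖∑ j ∈ Finset.univ.erase i, D y j * ε j‖ ≤ r' := by
    intro r' h h0
    refine Finset.sum_induction _ (fun z : ℤ_[p] => ‖z‖ ≤ r') (fun _ _ => padicInt_norm_add_le)
      (by simpa using h0) fun j hj => padicInt_norm_mul_le (h j (Finset.ne_of_mem_erase hj))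
  have hsplit : ∑ j, D y j * ε j = D y i * ε i + ∑ j ∈ Finset.univ.erase i, D y j * ε j :=
    (Finset.add_sum_erase _ _ (Finset.mem_univ i)).symm
  set E := H (y + ε) - H y - ∑ j, D y j * ε j with hE
  have hHd : H (y + ε) - H y = D y i * ε i + (E + ∑ j ∈ Finset.univ.erase i, D y j * ε j) := by
    rw [hE, hsplit]; ring
  have hEr : ‖E‖ ≤ r := key.trans (mul_le_of_le_one_left (norm_nonneg _) hp1.le)
  apply le_antisymm
  · refine (pi_norm_le_iff_of_nonneg (norm_nonneg _)).2 fun j => ?_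
    by_cases hj : j = i
    · subst hj
      simp only [Pi.sub_apply, Function.update_self]
      rw [hHd]
      exact padicInt_norm_add_le (padicInt_norm_mul_le (hεr _))
        (padicInt_norm_add_le hEr (hsum r (fun j _ => hεr j) (norm_nonneg _)))
    · simp only [Pi.sub_apply, Function.update_of_ne hj, Pi.add_apply, add_sub_cancel_left]
      exact hεr j
  · by_contra hlt
    push Not at hlt
    set r' := ‖Function.update (y + ε) i (H (y + ε)) - Function.update y i (H y)‖ with hr'
    have hr'0 : 0 ≤ r' := norm_nonneg _
    have hj : ∀ j, j ≠ i → ‖ε j‖ ≤ r' := by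
      intro j hj
      have := norm_le_pi_norm
        (Function.update (y + ε) i (H (y + ε)) - Function.update y i (H y)) j
      simpa only [Pi.sub_apply, Function.update_of_ne hj, Pi.add_apply, add_sub_cancel_left]
        using this
    have hi : ‖H (y + ε) - H y‖ ≤ r' := by
      have := norm_le_pi_norm
        (Function.update (y + ε) i (H (y + ε)) - Function.update y i (H y)) i
      simpa only [Pi.sub_apply, Function.update_self] using this
    have hrpos : 0 < r := hr'0.trans_lt hlt
    have hm : max r' (‖(p : ℤ_[p])‖ * r) < r :=
      max_lt hlt (mul_lt_of_lt_one_left hrpos hp1)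
    have hεi : ‖ε i‖ ≤ max r' (‖(p : ℤ_[p])‖ * r) := by
      have h1 : D y i * ε i =
          (H (y + ε) - H y) + (-E + -∑ j ∈ Finset.univ.erase i, D y j * ε j) := by
        rw [hHd]; ring
      have h2 : ‖ε i‖ = ‖D y i * ε i‖ := by rw [norm_mul, hD, one_mul]
      rw [h2, h1]
      refine padicInt_norm_add_le (hi.trans (le_max_left _ _)) (padicInt_norm_add_le ?_ ?_)
      · rw [norm_neg]; exact key.trans (le_max_right _ _)
      · rw [norm_neg]; exact (hsum r' hj hr'0).trans (le_max_left _ _)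
    refine absurd hr (ne_of_gt ?_)
    refine ((pi_norm_lt_iff hrpos).2 fun j => ?_)
    by_cases h : j = i
    · subst h; exact hεi.trans_lt hm
    · exact (hj j h).trans_lt hlt

theorem integral_comp_isometry {T : (ι → ℤ_[p]) → (ι → ℤ_[p])} (hT : Isometry T)
    (F : (ι → ℤ_[p]) → ℂ) : ∫ y, F (T y) ∂(haar p ι) = ∫ y, F y ∂(haar p ι) :=
  (measurePreserving_of_isometry (haar p ι) hT).integral_comp
    hT.isClosedEmbedding.measurableEmbedding F

/-- The integral over a residue class in which `g` has a smooth zero vanishes. -/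
theorem integral_zetaKernel_eq_zero (χ : ℤ_[p]ˣ →* ℂˣ) (hχ : χ ≠ 1) (s : ℂ)
    (g : MvPolynomial ι ℤ_[p]) (a : ι → ℤ_[p]) (ha : (p : ℤ_[p]) ∣ MvPolynomial.eval a g) (i : ι)
    (hi : ¬ (p : ℤ_[p]) ∣ MvPolynomial.eval a (MvPolynomial.pderiv i g)) :
    ∫ y, zetaKernel χ s (MvPolynomial.eval (a + (p : ℤ_[p]) • y) g) ∂(haar p ι) = 0 := by
  classical
  have hp0 : (p : ℤ_[p]) ≠ 0 := Nat.cast_ne_zero.2 (Fact.out : p.Prime).ne_zero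
  have hpn : 0 < ‖(p : ℤ_[p])‖ := norm_pos_iff.2 hp0
  have hdvd : ∀ (h : MvPolynomial ι ℤ_[p]) (y : ι → ℤ_[p]),
      (p : ℤ_[p]) ∣ MvPolynomial.eval (a + (p : ℤ_[p]) • y) h - MvPolynomial.eval a h := by
    intro h y
    rw [← PadicInt.norm_lt_one_iff_dvd]
    refine (norm_eval_add_sub_le h a _ hpn.le fun j => ?_).trans_lt
      ((PadicInt.norm_lt_one_iff_dvd _).2 dvd_rfl)
    rw [Pi.smul_apply, smul_eq_mul, norm_mul]
    exact mul_le_of_le_one_right hpn.le (PadicInt.norm_le_one _)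
  have hH : ∀ y : ι → ℤ_[p], ∃ q, MvPolynomial.eval (a + (p : ℤ_[p]) • y) g = (p : ℤ_[p]) * q := by
    intro y
    have := dvd_add (hdvd g y) ha
    rwa [sub_add_cancel] at this
  choose H hH using hH
  obtain ⟨u, hu⟩ : ∃ u, χ u ≠ 1 := by
    by_contra h
    push Not at h
    exact hχ (MonoidHom.ext h)
  have hu' : (χ u : ℂ) ≠ 1 := fun h => hu (Units.ext h)
  let D : (ι → ℤ_[p]) → ι → ℤ_[p] := fun y j =>
    MvPolynomial.eval (a + (p : ℤ_[p]) • y) (MvPolynomial.pderiv j g)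
  -- H = g(a + p y) / p can be taken as a new i-th coordinate, because the i-th derivative of g is a
  -- unit on the whole residue class.
  have hiso : Isometry fun y => Function.update y i (H y) := by
    refine isometry_update i H D (fun y => ?_) fun y ε r hr hε => ?_
    · refine le_antisymm (PadicInt.norm_le_one _) (not_lt.1 fun h => hi ?_)
      rw [PadicInt.norm_lt_one_iff_dvd] at h
      exact (dvd_sub_right h).1 (hdvd _ y)
    · have h := norm_eval_add_sub_linear_le g (a + (p : ℤ_[p]) • y) ((p : ℤ_[p]) • ε)
        (r := ‖(p : ℤ_[p])‖ * r) (by positivity) fun j => by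
          rw [Pi.smul_apply, smul_eq_mul, norm_mul]
          exact mul_le_mul_of_nonneg_left (hε j) hpn.le
      rw [add_assoc, ← smul_add, hH, hH] at h
      have h2 : (p : ℤ_[p]) * H (y + ε) - (p : ℤ_[p]) * H y -
          ∑ j, MvPolynomial.eval (a + (p : ℤ_[p]) • y) (MvPolynomial.pderiv j g) *
            ((p : ℤ_[p]) • ε) j = (p : ℤ_[p]) * (H (y + ε) - H y - ∑ j, D y j * ε j) := by
        rw [mul_sub, mul_sub, Finset.mul_sum]
        congr 1
        refine Finset.sum_congr rfl fun j _ => ?_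
        rw [Pi.smul_apply, smul_eq_mul]; ring
      rw [h2, norm_mul] at h
      -- The Taylor bound is quadratic in r, which helps only for r ≤ 1. For larger r it is applied
      -- with 1 in place of r, since every element of ℤ_p has norm at most 1.
      by_cases hr1 : r ≤ 1
      · refine (le_of_mul_le_mul_left (h.trans (le_of_eq ?_)) hpn).trans
          (mul_le_mul_of_nonneg_left (mul_le_of_le_one_left hr hr1) hpn.le)
        ring
      · have hε1 : ∀ j, ‖ε j‖ ≤ 1 := fun j => PadicInt.norm_le_one _
        have h := norm_eval_add_sub_linear_le g (a + (p : ℤ_[p]) • y) ((p : ℤ_[p]) • ε)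
          (r := ‖(p : ℤ_[p])‖) (by positivity) fun j => by
            rw [Pi.smul_apply, smul_eq_mul, norm_mul]
            exact mul_le_of_le_one_right hpn.le (hε1 j)
        rw [add_assoc, ← smul_add, hH, hH, h2, norm_mul, sq] at h
        exact (le_of_mul_le_mul_left h hpn).trans
          (le_mul_of_one_le_right hpn.le (not_le.1 hr1).le)
  have hiso' : Isometry fun y : ι → ℤ_[p] => Function.update y i ((u : ℤ_[p]) * y i) := by
    refine isometry_update i _ (fun _ => Pi.single i (u : ℤ_[p])) (fun y => ?_)
      fun y ε r hr hε => ?_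
    · simp
    · have : ∑ j, (Pi.single i (u : ℤ_[p]) : ι → ℤ_[p]) j * ε j = u * ε i := by
        rw [Finset.sum_eq_single i]
        · simp
        · intro j _ hj; simp [hj]
        · simp
      rw [this, Pi.add_apply, mul_add, add_sub_cancel_left, sub_self, norm_zero]
      positivity
  let K : ℤ_[p] → ℂ := fun c => zetaKernel χ s ((p : ℤ_[p]) * c)
  have e1 : ∫ y, zetaKernel χ s (MvPolynomial.eval (a + (p : ℤ_[p]) • y) g) ∂(haar p ι) =
      ∫ y, K (y i) ∂(haar p ι) := by
    rw [← integral_comp_isometry hiso fun y => K (y i)]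
    simp only [Function.update_self, hH, K]
  -- Multiplying the coordinate y_i by a unit u with χ u ≠ 1 preserves the measure and multiplies
  -- the integrand by χ u.
  have e2 : ∫ y, K (y i) ∂(haar p ι) = (χ u : ℂ) * ∫ y, K (y i) ∂(haar p ι) := by
    conv_lhs => rw [← integral_comp_isometry hiso' fun y => K (y i)]
    rw [← integral_const_mul]
    simp only [Function.update_self, K]
    congr 1
    ext y
    rw [mul_left_comm, zetaKernel_unit_mul]
  rw [e1]
  by_contra hne
  exact hu' (mul_right_cancel₀ hne (e2.symm.trans (one_mul _).symm))

/-- The integral over a residue class on which the reduction of `g` has no singular zero. -/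
theorem integral_zetaKernel_residue (χ : ℤ_[p]ˣ →* ℂˣ) (hχ : χ ≠ 1) {ψ : MulChar (ZMod p) ℂ}
    (hψ : ∀ u : ℤ_[p]ˣ, (χ u : ℂ) = ψ (PadicInt.toZMod (u : ℤ_[p]))) (s : ℂ)
    (g : MvPolynomial ι ℤ_[p]) (a : ι → ℤ_[p])
    (hg : ¬ (MvPolynomial.eval (fun i => PadicInt.toZMod (a i)) (g.map PadicInt.toZMod) = 0 ∧
      ∀ i, MvPolynomial.eval (fun i => PadicInt.toZMod (a i))
        (MvPolynomial.pderiv i (g.map PadicInt.toZMod)) = 0)) :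
    ∫ y, zetaKernel χ s (MvPolynomial.eval (a + (p : ℤ_[p]) • y) g) ∂(haar p ι) =
      ψ (MvPolynomial.eval (fun i => PadicInt.toZMod (a i)) (g.map PadicInt.toZMod)) := by
  by_cases h : MvPolynomial.eval (fun i => PadicInt.toZMod (a i)) (g.map PadicInt.toZMod) = 0
  · obtain ⟨i, hi⟩ : ∃ i, MvPolynomial.eval (fun i => PadicInt.toZMod (a i))
        (MvPolynomial.pderiv i (g.map PadicInt.toZMod)) ≠ 0 := by
      by_contra h'
      push Not at h'
      exact hg ⟨h, h'⟩
    -- Since ψ(0) = 0, the vanishing at smooth zeros fits the formula for the non-zero case. The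
    -- result does not depend on s.
    rw [h, MulChar.map_zero]
    refine integral_zetaKernel_eq_zero χ hχ s g a ?_ i ?_
    · rw [← toZMod_eq_zero_iff_dvd, toZMod_eval, h]
    · rwa [← toZMod_eq_zero_iff_dvd, toZMod_eval, ← MvPolynomial.pderiv_map]
  · have hval : ∀ y : ι → ℤ_[p],
        PadicInt.toZMod (MvPolynomial.eval (a + (p : ℤ_[p]) • y) g) =
          MvPolynomial.eval (fun i => PadicInt.toZMod (a i)) (g.map PadicInt.toZMod) := by
      intro y
      rw [toZMod_eval]
      congr 2
      ext i
      simp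
    have : ∀ y : ι → ℤ_[p], zetaKernel χ s (MvPolynomial.eval (a + (p : ℤ_[p]) • y) g) =
        ψ (MvPolynomial.eval (fun i => PadicInt.toZMod (a i)) (g.map PadicInt.toZMod)) := by
      intro y
      have hne : PadicInt.toZMod (MvPolynomial.eval (a + (p : ℤ_[p]) • y) g) ≠ 0 := by
        rwa [hval]
      rw [zetaKernel, chiAc_of_toZMod_ne_zero χ hψ hne, norm_eq_one_iff_toZMod_ne_zero.2 hne, hval]
      simp
    simp only [this, integral_const]
    simp

end

end Igusa

open MeasureTheory

namespace Igusa

section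

variable {p : ℕ} [Fact p.Prime] {ι : Type*} [Fintype ι]

/-! ### Decomposition of the zeta integral according to the orders of the coordinates -/

theorem haar_setOf_apply_eq_zero (i : ι) : haar p ι {x | x i = 0} = 0 := by
  classical
  have hp : 1 < p := (Fact.out : p.Prime).one_lt
  have h : ∀ n : ℕ, haar p ι {x | x i = 0} ≤ ((p : ENNReal)⁻¹) ^ n := by
    intro n
    have hsub : {x : ι → ℤ_[p] | x i = 0} ⊆ Set.range (scaleHom p (Pi.single i n : ι → ℕ)) := by
      intro x hx
      rw [mem_range_scaleHom]
      intro j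
      by_cases hj : j = i
      · subst hj
        rw [show x j = 0 from hx]
        exact dvd_zero _
      · simp [hj]
    refine (measure_mono hsub).trans ?_
    rw [haar_range_scaleHom, Finset.sum_pi_single']
    simp [ENNReal.inv_pow]
  refine le_antisymm (ge_of_tendsto' (ENNReal.tendsto_pow_atTop_nhds_zero_of_lt_one ?_) h) bot_le
  rw [ENNReal.inv_lt_one]
  exact_mod_cast hp

/-- A representative in `ℤ_pⁿ` of a point of the torus over `𝔽_p`. -/
noncomputable def torusLift (a : ι → (ZMod p)ˣ) : ι → ℤ_[p] := fun i =>
  (ZMod.ringHom_surjective (PadicInt.toZMod (p := p)) (a i : ZMod p)).choose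

omit [Fintype ι] in
theorem toZMod_torusLift (a : ι → (ZMod p)ˣ) (i : ι) :
    PadicInt.toZMod (torusLift a i) = (a i : ZMod p) :=
  (ZMod.ringHom_surjective (PadicInt.toZMod (p := p)) (a i : ZMod p)).choose_spec

/-- The set of the points `x ∈ ℤ_pⁿ` with `ord x_i = k_i` and with angular components congruent to
the point `a` of the torus. -/
noncomputable def residueBall (k : ι → ℕ) (a : ι → (ZMod p)ˣ) : Set (ι → ℤ_[p]) :=
  Set.range fun y => scaleHom p k (torusLift a) + scaleHom p (fun i => k i + 1) y

omit [Fintype ι] in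
theorem mem_residueBall {k : ι → ℕ} {a : ι → (ZMod p)ˣ} {x : ι → ℤ_[p]} :
    x ∈ residueBall k a ↔ ∀ i, ∃ u : ℤ_[p]ˣ, x i = (p : ℤ_[p]) ^ k i * u ∧
      PadicInt.toZMod (u : ℤ_[p]) = a i := by
  constructor
  · rintro ⟨y, rfl⟩ i
    have h : PadicInt.toZMod (torusLift a i + (p : ℤ_[p]) * y i) = (a i : ZMod p) := by
      rw [map_add, toZMod_torusLift]; simp
    obtain ⟨u, hu⟩ := PadicInt.isUnit_iff.2 (norm_eq_one_iff_toZMod_ne_zero.2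
      (show PadicInt.toZMod (torusLift a i + (p : ℤ_[p]) * y i) ≠ 0 by rw [h]; exact (a i).ne_zero))
    refine ⟨u, ?_, by rw [hu, h]⟩
    rw [hu]
    simp only [Pi.add_apply, scaleHom_apply]; ring
  · intro h
    choose u hu hua using h
    have : ∀ i, (p : ℤ_[p]) ∣ (u i : ℤ_[p]) - torusLift a i := fun i => by
      rw [← toZMod_eq_zero_iff_dvd, map_sub, toZMod_torusLift, hua, sub_self]
    choose y hy using this
    refine ⟨y, funext fun i => ?_⟩
    simp only [Pi.add_apply, scaleHom_apply]
    rw [hu i]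
    linear_combination - (p : ℤ_[p]) ^ k i * hy i

omit [Fintype ι] in
theorem eq_of_pow_mul_unit_eq {m n : ℕ} {u v : ℤ_[p]ˣ}
    (h : (p : ℤ_[p]) ^ m * u = (p : ℤ_[p]) ^ n * v) : m = n ∧ u = v := by
  have hp1 : (1 : ℝ) < p := by exact_mod_cast (Fact.out : p.Prime).one_lt
  have hmn : m = n := by
    have h1 := congrArg norm h
    rw [norm_mul, norm_mul, PadicInt.norm_units, PadicInt.norm_units, PadicInt.norm_p_pow,
      PadicInt.norm_p_pow, mul_one, mul_one] at h1
    have := zpow_right_injective₀ (by positivity) hp1.ne' h1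
    simpa using this
  subst hmn
  exact ⟨rfl, Units.ext (mul_left_cancel₀
    (pow_ne_zero _ (Nat.cast_ne_zero.2 (Fact.out : p.Prime).ne_zero)) h)⟩

/-- On the class of points with orders k and angular residues a, f equals p^(N k) times `g k`, and
the integral of the latter is known from `integral_zetaKernel_residue`. The classes are disjoint and
miss only points with a zero coordinate, a null set. -/
theorem hasSum_twistedZetaIntegral [DecidableEq ι] (f : MvPolynomial ι ℤ_[p]) (χ : ℤ_[p]ˣ →* ℂˣ) (hχ : χ ≠ 1)
    (hχ1 : ∀ u : ℤ_[p]ˣ, (p : ℤ_[p]) ∣ (u : ℤ_[p]) - 1 → χ u = 1) {ψ : MulChar (ZMod p) ℂ}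
    (hψ : ∀ u : ℤ_[p]ˣ, (χ u : ℂ) = ψ (PadicInt.toZMod (u : ℤ_[p]))) {s : ℂ} (hs : 0 < s.re)
    (g : (ι → ℕ) → MvPolynomial ι ℤ_[p]) (N : (ι → ℕ) → ℕ)
    (hfg : ∀ k : ι → ℕ, (∀ i, 1 ≤ k i) → ∀ x,
      MvPolynomial.eval (scaleHom p k x) f = (p : ℤ_[p]) ^ N k * MvPolynomial.eval x (g k))
    (hnd : ∀ k : ι → ℕ, (∀ i, 1 ≤ k i) → ∀ a : ι → (ZMod p)ˣ,
      ¬ (MvPolynomial.eval (fun i => (a i : ZMod p)) ((g k).map PadicInt.toZMod) = 0 ∧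
        ∀ i, MvPolynomial.eval (fun i => (a i : ZMod p))
          (MvPolynomial.pderiv i ((g k).map PadicInt.toZMod)) = 0)) :
    HasSum (fun k : {k : ι → ℕ // ∀ i, 1 ≤ k i} =>
      ∑ a : ι → (ZMod p)ˣ, ((p : ℂ) ^ (∑ i, (k.1 i + 1)))⁻¹ * (((p : ℂ) ^ (-s)) ^ N k.1 *
        ψ (MvPolynomial.eval (fun i => (a i : ZMod p)) ((g k.1).map PadicInt.toZMod))))
      (twistedZetaIntegral f χ s) := by
  let B : {k : ι → ℕ // ∀ i, 1 ≤ k i} × (ι → (ZMod p)ˣ) → Set (ι → ℤ_[p]) :=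
    fun q => residueBall q.1.1 q.2
  have hBm : ∀ q, MeasurableSet (B q) := by
    intro q
    have : B q = (fun y => scaleHom p q.1.1 (torusLift q.2) + y) ''
        Set.range (scaleHom p fun i => q.1.1 i + 1) := by
      rw [← Set.range_comp]; rfl
    rw [this, (measurableEmbedding_addLeft _).measurableSet_image]
    exact (isClosedEmbedding_scaleHom _).isClosed_range.measurableSet
  have hBd : Pairwise (Function.onFun Disjoint B) := by
    rintro ⟨k, a⟩ ⟨k', a'⟩ hne
    refine Set.disjoint_left.2 fun x hx hx' => hne ?_
    have h : ∀ i, k.1 i = k'.1 i ∧ a i = a' i := fun i => by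
      obtain ⟨u, hu, hua⟩ := mem_residueBall.1 hx i
      obtain ⟨v, hv, hva⟩ := mem_residueBall.1 hx' i
      obtain ⟨h1, rfl⟩ := eq_of_pow_mul_unit_eq (hu.symm.trans hv)
      exact ⟨h1, Units.ext (hua.symm.trans hva)⟩
    exact Prod.ext (Subtype.ext (funext fun i => (h i).1)) (funext fun i => (h i).2)
  have hunion : {x : ι → ℤ_[p] | ∀ i, (p : ℤ_[p]) ∣ x i} =ᵐ[haar p ι] ⋃ q, B q := by
    have hnull : haar p ι (⋃ i, {x | x i = 0}) = 0 :=
      measure_iUnion_null fun i => haar_setOf_apply_eq_zero i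
    have hae : ∀ᵐ x ∂(haar p ι), x ∉ ⋃ i, {x : ι → ℤ_[p] | x i = 0} :=
      measure_eq_zero_iff_ae_notMem.1 hnull
    filter_upwards [hae] with x hx
    have hx0 : ∀ i, x i ≠ 0 := fun i h => hx (Set.mem_iUnion.2 ⟨i, h⟩)
    refine propext ⟨fun h => ?_, fun h => ?_⟩
    · have h : ∀ i, (p : ℤ_[p]) ∣ x i := h
      have hk : ∀ i, 1 ≤ (x i).valuation := by
        intro i
        by_contra hlt
        have h0 : (x i).valuation = 0 := by omega
        have h2 := (PadicInt.norm_lt_one_iff_dvd _).2 (h i)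
        rw [PadicInt.norm_eq_zpow_neg_valuation (hx0 i), h0] at h2
        simp at h2
      have hu0 : ∀ i, IsUnit (PadicInt.toZMod (PadicInt.unitCoeff (hx0 i) : ℤ_[p])) := fun i =>
        (Units.isUnit _).map _
      refine Set.mem_iUnion.2 ⟨(⟨fun i => (x i).valuation, hk⟩, fun i => (hu0 i).unit), ?_⟩
      refine mem_residueBall.2 fun i => ⟨PadicInt.unitCoeff (hx0 i), ?_, rfl⟩
      rw [mul_comm]; exact PadicInt.unitCoeff_spec (hx0 i)
    · obtain ⟨q, hq⟩ := Set.mem_iUnion.1 h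
      intro i
      obtain ⟨u, hu, -⟩ := mem_residueBall.1 hq i
      rw [hu]
      exact Dvd.dvd.mul_right (dvd_pow_self _ (by have := q.1.2 i; omega)) _
  have hint : Integrable (fun x => zetaKernel χ s (MvPolynomial.eval x f)) (haar p ι) := by
    refine Integrable.of_bound ?_ 1 (Filter.Eventually.of_forall fun x => norm_zetaKernel_le χ hψ hs _)
    exact ((measurable_zetaKernel χ hχ1 s).comp
      (MvPolynomial.continuous_eval f).measurable).aestronglyMeasurable
  have hsum := hasSum_integral_iUnion hBm hBd hint.integrableOn
  rw [← setIntegral_congr_set hunion] at hsum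
  refine HasSum.prod_fiberwise hsum fun k => ?_
  have hterm : ∀ a : ι → (ZMod p)ˣ,
      ∫ x in B (k, a), zetaKernel χ s (MvPolynomial.eval x f) ∂(haar p ι) =
        ((p : ℂ) ^ (∑ i, (k.1 i + 1)))⁻¹ * (((p : ℂ) ^ (-s)) ^ N k.1 *
        ψ (MvPolynomial.eval (fun i => (a i : ZMod p)) ((g k.1).map PadicInt.toZMod))) := by
    intro a
    have hres : (fun i => PadicInt.toZMod (torusLift a i)) = fun i => (a i : ZMod p) :=
      funext fun i => toZMod_torusLift a i
    have := setIntegral_range_add_scaleHom (fun i => k.1 i + 1) (scaleHom p k.1 (torusLift a))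
      (fun x => zetaKernel χ s (MvPolynomial.eval x f))
    refine this.trans ?_
    congr 1
    have hshift : ∀ y : ι → ℤ_[p], scaleHom p k.1 (torusLift a) +
        scaleHom p (fun i => k.1 i + 1) y = scaleHom p k.1 (torusLift a + (p : ℤ_[p]) • y) := by
      intro y
      ext1 i
      simp only [Pi.add_apply, scaleHom_apply, Pi.smul_apply, smul_eq_mul]
      ring
    simp only [hshift, hfg k.1 k.2, zetaKernel_pow_mul, integral_const_mul]
    congr 1
    rw [integral_zetaKernel_residue χ hχ hψ s (g k.1) (torusLift a)
      (by rw [hres]; exact hnd k.1 k.2 a), hres]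
  have := hasSum_fintype fun a : ι → (ZMod p)ˣ =>
    ∫ x in B (k, a), zetaKernel χ s (MvPolynomial.eval x f) ∂(haar p ι)
  simpa only [hterm] using this

end

end Igusa

namespace Igusa

/-! ### Generating functions of finitely generated sets of lattice points -/

theorem summable_norm_prod_and_tsum_prod {r : ℕ} (f : Fin r → ℕ → ℂ)
    (hf : ∀ j, Summable fun m => ‖f j m‖) :
    (Summable fun n : Fin r → ℕ => ‖∏ j, f j (n j)‖) ∧
      ∑' n : Fin r → ℕ, ∏ j, f j (n j) = ∏ j, ∑' m, f j m := by
  induction r with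
  | zero => exact ⟨(hasSum_fintype _).summable, by simp⟩
  | succ r ih =>
    obtain ⟨h1, h2⟩ := ih (fun j => f j.succ) fun j => hf j.succ
    let e := Fin.consEquiv (n := r) fun _ => ℕ
    have he : ∀ q : ℕ × (Fin r → ℕ),
        ∏ j, f j (e q j) = f 0 q.1 * ∏ j : Fin r, f j.succ (q.2 j) := by
      intro q
      rw [Fin.prod_univ_succ]
      simp [e]
    constructor
    · rw [← e.summable_iff]
      exact ((hf 0).mul_norm h1).congr fun q => by rw [Function.comp_apply, he]
    · rw [← e.tsum_eq, tsum_congr he, ← tsum_mul_tsum_of_summable_norm (hf 0) h1, h2,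
        Fin.prod_univ_succ]

/-- A set of exponents that is determined by truncation at `N` has a rational generating
function. -/
theorem tsum_indicator_mul_prod_one_sub {r : ℕ} (E : Set (Fin r → ℕ)) (N : Fin r → ℕ)
    (hE : ∀ n, n ∈ E ↔ n ⊓ N ∈ E) (y : Fin r → ℂ) (hy : ∀ j, ‖y j‖ < 1) :
    (∑' n, E.indicator (fun n => ∏ j, y j ^ n j) n) * ∏ j, (1 - y j) =
      ∑ b ∈ Finset.Iic N, E.indicator
        (fun b => ∏ j, if b j < N j then y j ^ b j * (1 - y j) else y j ^ N j) b := by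
  classical
  -- The fiber of n ↦ n ⊓ N over b is a product of singletons (where b j < N j) and half-lines
  -- (where b j = N j), so its generating function is a product of monomials and geometric series.
  let f : (Fin r → ℕ) → Fin r → ℕ → ℂ := fun b j m => if m ⊓ N j = b j then y j ^ m else 0
  have hsy : ∀ j, Summable fun m : ℕ => ‖y j ^ m‖ := fun j => by
    simpa only [norm_pow] using summable_geometric_of_lt_one (norm_nonneg _) (hy j)
  have hf : ∀ b j, Summable fun m => ‖f b j m‖ := fun b j =>
    (hsy j).of_nonneg_of_le (fun _ => norm_nonneg _) fun m => by
      simp only [f]; split_ifs <;> simp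
  have hdec : ∀ n, E.indicator (fun n => ∏ j, y j ^ n j) n =
      ∑ b ∈ Finset.Iic N, E.indicator (fun _ => ∏ j, f b j (n j)) b := by
    intro n
    have hz : ∀ b, b ≠ n ⊓ N → ∏ j, f b j (n j) = 0 := by
      intro b hb
      obtain ⟨j, hj⟩ := Function.ne_iff.1 hb
      refine Finset.prod_eq_zero (Finset.mem_univ j) ?_
      simp only [f]
      rw [if_neg]
      exact fun h => hj h.symm
    rw [Finset.sum_eq_single (n ⊓ N)]
    · by_cases hn : n ∈ E
      · rw [Set.indicator_of_mem hn, Set.indicator_of_mem ((hE n).1 hn)]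
        simp [f]
      · rw [Set.indicator_of_notMem hn, Set.indicator_of_notMem (fun h => hn ((hE n).2 h))]
    · intro b _ hb
      by_cases hbE : b ∈ E
      · rw [Set.indicator_of_mem hbE, hz b hb]
      · rw [Set.indicator_of_notMem hbE]
    · intro h
      exact absurd (Finset.mem_Iic.2 inf_le_right) h
  have hone : ∀ b, b ≤ N → ∀ j, (∑' m, f b j m) * (1 - y j) =
      if b j < N j then y j ^ b j * (1 - y j) else y j ^ N j := by
    intro b hb j
    split_ifs with h
    · congr 1
      rw [tsum_eq_single (b j)]
      · simp [f, (hb j)]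
      · intro m hm
        simp only [f]
        rw [if_neg]
        intro h'
        rcases le_total m (N j) with hle | hle
        · rw [inf_eq_left.2 hle] at h'; exact hm h'
        · rw [inf_eq_right.2 hle] at h'; omega
    · have hbN : b j = N j := le_antisymm (hb j) (not_lt.1 h)
      have hz : ∀ m ∈ Finset.range (N j), f b j m = 0 := by
        intro m hm
        rw [Finset.mem_range] at hm
        simp only [f]
        rw [if_neg]
        rw [inf_eq_left.2 hm.le, hbN]; omega
      have hs := ((hf b j).of_norm).sum_add_tsum_nat_add (N j)
      rw [Finset.sum_eq_zero hz, zero_add] at hs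
      have : ∀ m, f b j (m + N j) = y j ^ N j * y j ^ m := by
        intro m
        simp only [f]
        rw [if_pos (by rw [hbN]; simp), pow_add, mul_comm]
      rw [← hs, tsum_congr this, tsum_mul_left, tsum_geometric_of_norm_lt_one (hy j), mul_assoc,
        inv_mul_cancel₀, mul_one]
      intro h0
      have := hy j
      rw [← sub_eq_zero.1 h0, norm_one] at this
      exact lt_irrefl _ this
  rw [tsum_congr hdec, Summable.tsum_finsetSum, Finset.sum_mul]
  · refine Finset.sum_congr rfl fun b hb => ?_
    by_cases hbE : b ∈ E
    · simp only [Set.indicator_of_mem hbE]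
      rw [(summable_norm_prod_and_tsum_prod (f b) (hf b)).2, ← Finset.prod_mul_distrib]
      exact Finset.prod_congr rfl fun j _ => hone b (Finset.mem_Iic.1 hb) j
    · simp only [Set.indicator_of_notMem hbE]; simp
  · intro b _
    by_cases hbE : b ∈ E
    · simp only [Set.indicator_of_mem hbE]
      exact (summable_norm_prod_and_tsum_prod (f b) (hf b)).1.of_norm
    · simp only [Set.indicator_of_notMem hbE]; exact summable_zero

/-- Dickson's lemma: an upper set of `ℕʳ` is determined by truncation. -/
theorem exists_truncation_of_isUpperSet {r : ℕ} {U : Set (Fin r → ℕ)} (hU : IsUpperSet U) :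
    ∃ N : Fin r → ℕ, ∀ N', N ≤ N' → ∀ n, n ∈ U ↔ n ⊓ N' ∈ U := by
  have hfin : {x | Minimal (· ∈ U) x}.Finite :=
    WellQuasiOrderedLE.finite_of_isAntichain (setOfPred_minimal_antichain (· ∈ U))
  -- The sum dominates every minimal element of U, so n ⊓ N' still lies above each minimal element
  -- below n. Allowing every larger N' lets two truncations be used at once.
  refine ⟨∑ x ∈ hfin.toFinset, x, fun N' hN' n => ⟨fun hn => ?_, fun hn => hU inf_le_left hn⟩⟩
  obtain ⟨b, hbn, hb⟩ := exists_minimal_le_of_wellFoundedLT (· ∈ U) n hn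
  refine hU (le_inf hbn (le_trans ?_ hN')) hb.1
  exact Finset.single_le_sum (f := fun x : Fin r → ℕ => x) (fun _ _ => zero_le)
    (hfin.mem_toFinset.2 hb)

/-- A set of lattice points that is stable under the addition of the `v_j` and contained in the
cone spanned by the `v_j` is parametrized by finitely many translates of truncated sets. -/
theorem exists_bijOn_of_subset_cone {d r : ℕ} (M : Set (Fin d → ℕ)) (v : Fin r → Fin d → ℕ)
    (hadd : ∀ k ∈ M, ∀ j, k + v j ∈ M)
    (hcone : ∀ k ∈ M, ∃ c : Fin r → ℝ, (∀ j, 0 ≤ c j) ∧ ∀ i, (k i : ℝ) = ∑ j, c j * v j i) :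
    ∃ (F : Finset (Fin d → ℕ)) (E : (Fin d → ℕ) → Set (Fin r → ℕ)) (N : (Fin d → ℕ) → Fin r → ℕ),
      (∀ a n, n ∈ E a ↔ n ⊓ N a ∈ E a) ∧
      Set.BijOn (fun q : (Fin d → ℕ) × (Fin r → ℕ) => q.1 + ∑ j, q.2 j • v j)
        {q | q.1 ∈ F ∧ q.2 ∈ E q.1} M := by
  -- Taking integer parts of cone coefficients leaves a remainder inside this box, so every point of
  -- M is some φ(a, n) with a in F.
  let F : Finset (Fin d → ℕ) := Finset.Iic (∑ j, v j)
  let φ : (Fin d → ℕ) × (Fin r → ℕ) → (Fin d → ℕ) := fun q => q.1 + ∑ j, q.2 j • v j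
  have hφadd : ∀ a n m, φ (a, n + m) = φ (a, n) + ∑ j, m j • v j := by
    intro a n m
    simp only [φ, Pi.add_apply, add_smul, Finset.sum_add_distrib, add_assoc]
  have hMadd : ∀ (m : Fin r → ℕ), ∀ k ∈ M, k + ∑ j, m j • v j ∈ M := by
    intro m k hk
    have hone : ∀ (t : ℕ) (j : Fin r), ∀ k ∈ M, k + t • v j ∈ M := by
      intro t j
      induction t with
      | zero => intro k hk; simpa using hk
      | succ t ih => intro k hk; rw [succ_nsmul, ← add_assoc]; exact hadd _ (ih k hk) j
    have : ∀ s : Finset (Fin r), k + ∑ j ∈ s, m j • v j ∈ M := by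
      intro s
      induction s using Finset.cons_induction with
      | empty => simpa using hk
      | cons j s hj ih =>
        rw [Finset.sum_cons, add_comm (m j • v j), ← add_assoc]
        exact hone _ _ _ ih
    exact this _
  -- Among the representations of a point the lexicographically least is kept, which makes it
  -- unique. The order is compatible with adding a vector to n.
  let key : (Fin d → ℕ) × (Fin r → ℕ) → Lex (Lex (Fin d → ℕ) × Lex (Fin r → ℕ)) :=
    fun q => toLex (toLex q.1, toLex q.2)
  have hkey_inj : ∀ q q', key q = key q' → q = q' := by
    intro q q' h
    have h1 := congrArg (fun z => (ofLex z).1) h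
    have h2 := congrArg (fun z => (ofLex z).2) h
    exact Prod.ext (toLex.injective h1) (toLex.injective h2)
  have hkey_add : ∀ q q' m, key q < key q' → key (q.1, q.2 + m) < key (q'.1, q'.2 + m) := by
    intro q q' m h
    rw [Prod.Lex.lt_iff] at h ⊢
    rcases h with h | ⟨h1, h2⟩
    · exact Or.inl h
    · refine Or.inr ⟨h1, ?_⟩
      have : toLex q.2 + toLex m < toLex q'.2 + toLex m := by
        have h2' : toLex q.2 < toLex q'.2 := h2
        exact add_lt_add_left h2' _
      exact this
  let U₁ : (Fin d → ℕ) → Set (Fin r → ℕ) := fun a => {n | φ (a, n) ∈ M}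
  -- The n for which (a, n) is not the least representation. Both `U₁ a` and `U₂ a` are upper sets,
  -- so their difference is determined by truncation.
  let U₂ : (Fin d → ℕ) → Set (Fin r → ℕ) := fun a =>
    {n | ∃ q : (Fin d → ℕ) × (Fin r → ℕ), q.1 ∈ F ∧ φ q = φ (a, n) ∧ key q < key (a, n)}
  have hU₁ : ∀ a, IsUpperSet (U₁ a) := by
    intro a n n' hnn' hn
    obtain ⟨m, rfl⟩ := exists_add_of_le hnn'
    change φ (a, n + m) ∈ M
    rw [hφadd]
    exact hMadd m _ hn
  have hU₂ : ∀ a, IsUpperSet (U₂ a) := by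
    rintro a n n' hnn' ⟨q, hqF, hq, hlt⟩
    obtain ⟨m, rfl⟩ := exists_add_of_le hnn'
    refine ⟨(q.1, q.2 + m), hqF, ?_, hkey_add q (a, n) m hlt⟩
    rw [hφadd, hφadd, ← hq]
  choose N₁ hN₁ using fun a => exists_truncation_of_isUpperSet (hU₁ a)
  choose N₂ hN₂ using fun a => exists_truncation_of_isUpperSet (hU₂ a)
  refine ⟨F, fun a => U₁ a \ U₂ a, fun a => N₁ a ⊔ N₂ a, fun a n => ?_, ?_, ?_, ?_⟩
  · rw [Set.mem_sdiff, Set.mem_sdiff, hN₁ a _ le_sup_left n, hN₂ a _ le_sup_right n]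
  · rintro q ⟨-, hq⟩
    exact hq.1
  · rintro q ⟨hqF, hq⟩ q' ⟨hqF', hq'⟩ h
    by_contra hne
    rcases lt_trichotomy (key q) (key q') with hlt | heq | hlt
    · exact hq'.2 ⟨q, hqF, h, hlt⟩
    · exact hne (hkey_inj _ _ heq)
    · exact hq.2 ⟨q', hqF', h.symm, hlt⟩
  · intro k hk
    have hne : {z | ∃ q : (Fin d → ℕ) × (Fin r → ℕ), q.1 ∈ F ∧ φ q = k ∧ key q = z}.Nonempty := by
      obtain ⟨c, hc, hkc⟩ := hcone k hk
      have hle : ∀ i, ∑ j, ⌊c j⌋₊ * v j i ≤ k i := by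
        intro i
        have : ((∑ j, ⌊c j⌋₊ * v j i : ℕ) : ℝ) ≤ k i := by
          rw [hkc i]
          push_cast
          exact Finset.sum_le_sum fun j _ =>
            mul_le_mul_of_nonneg_right (Nat.floor_le (hc j)) (Nat.cast_nonneg _)
        exact_mod_cast this
      refine ⟨_, (fun i => k i - ∑ j, ⌊c j⌋₊ * v j i, fun j => ⌊c j⌋₊), ?_, ?_, rfl⟩
      · refine Finset.mem_Iic.2 fun i => ?_
        have : ((k i - ∑ j, ⌊c j⌋₊ * v j i : ℕ) : ℝ) ≤ ((∑ j, v j i : ℕ) : ℝ) := by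
          rw [Nat.cast_sub (hle i), hkc i]
          push_cast
          rw [← Finset.sum_sub_distrib]
          refine Finset.sum_le_sum fun j _ => ?_
          have := (Nat.lt_floor_add_one (c j)).le
          nlinarith [Nat.cast_nonneg (α := ℝ) (v j i)]
        have h2 : k i - ∑ j, ⌊c j⌋₊ * v j i ≤ ∑ j, v j i := by exact_mod_cast this
        simpa using h2
      · ext i
        simp only [φ, Pi.add_apply, Finset.sum_apply, Pi.smul_apply, smul_eq_mul]
        exact Nat.sub_add_cancel (hle i)
    obtain ⟨_, ⟨q, hqF, hqk, rfl⟩, hmin⟩ :=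
      (wellFounded_lt (α := Lex (Lex (Fin d → ℕ) × Lex (Fin r → ℕ)))).has_min _ hne
    refine ⟨q, ⟨hqF, ?_, ?_⟩, hqk⟩
    · change φ (q.1, q.2) ∈ M
      rw [show φ (q.1, q.2) = k from hqk]; exact hk
    · rintro ⟨q', hq'F, hq', hlt⟩
      exact hmin _ ⟨q', hq'F, hq'.trans hqk, rfl⟩ hlt

/-- The generating function of a set of lattice points that is stable under the addition of the
`v_j` and contained in the cone spanned by them is rational with denominator `∏ (1 - X ^ v_j)`. -/
theorem exists_polynomial_tsum_mul_prod {d r : ℕ} (M : Set (Fin d → ℕ)) (v : Fin r → Fin d → ℕ)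
    (hv : ∀ j, v j ≠ 0) (hadd : ∀ k ∈ M, ∀ j, k + v j ∈ M)
    (hcone : ∀ k ∈ M, ∃ c : Fin r → ℝ, (∀ j, 0 ≤ c j) ∧ ∀ i, (k i : ℝ) = ∑ j, c j * v j i) :
    ∃ P : MvPolynomial (Fin d) ℂ, ∀ x : Fin d → ℂ, (∀ i, ‖x i‖ < 1) →
      (∑' k : M, ∏ i, x i ^ k.1 i) * ∏ j, (1 - ∏ i, x i ^ v j i) = MvPolynomial.eval x P := by
  classical
  obtain ⟨F, E, N, hE, hbij⟩ := exists_bijOn_of_subset_cone M v hadd hcone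
  let Y : Fin r → MvPolynomial (Fin d) ℂ := fun j => ∏ i, MvPolynomial.X i ^ v j i
  refine ⟨∑ a ∈ F, (∏ i, MvPolynomial.X i ^ a i) * ∑ b ∈ Finset.Iic (N a), (E a).indicator
    (fun b => ∏ j, if b j < N a j then Y j ^ b j * (1 - Y j) else Y j ^ N a j) b, ?_⟩
  intro x hx
  set y : Fin r → ℂ := fun j => ∏ i, x i ^ v j i with hy
  have hy1 : ∀ j, ‖y j‖ < 1 := by
    intro j
    obtain ⟨i, hi⟩ := Function.ne_iff.1 (hv j)
    rw [hy, norm_prod]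
    have hi' : ‖x i ^ v j i‖ < 1 := by
      rw [norm_pow]; exact pow_lt_one₀ (norm_nonneg _) (hx i) hi
    rw [← Finset.mul_prod_erase _ _ (Finset.mem_univ i)]
    refine mul_lt_one_of_nonneg_of_lt_one_left (norm_nonneg _) hi' ?_
    refine Finset.prod_le_one (fun _ _ => norm_nonneg _) fun i _ => ?_
    rw [norm_pow]; exact pow_le_one₀ (norm_nonneg _) (hx i).le
  have hφ : ∀ (a : Fin d → ℕ) (n : Fin r → ℕ), ∏ i, x i ^ (a + ∑ j, n j • v j) i =
      (∏ i, x i ^ a i) * ∏ j, y j ^ n j := by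
    intro a n
    have : ∀ j, y j ^ n j = ∏ i, x i ^ (n j * v j i) := fun j => by
      rw [hy, ← Finset.prod_pow]
      exact Finset.prod_congr rfl fun i _ => by rw [← pow_mul, mul_comm]
    simp only [this]
    rw [Finset.prod_comm, ← Finset.prod_mul_distrib]
    refine Finset.prod_congr rfl fun i _ => ?_
    rw [Finset.prod_pow_eq_pow_sum, ← pow_add]
    simp
  have hsumN : Summable fun n : Fin r → ℕ => ‖∏ j, y j ^ n j‖ :=
    (summable_norm_prod_and_tsum_prod (fun j m => y j ^ m) fun j => by
      simpa only [norm_pow] using summable_geometric_of_lt_one (norm_nonneg _) (hy1 j)).1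
  let S : Set ((Fin d → ℕ) × (Fin r → ℕ)) := {q | q.1 ∈ F ∧ q.2 ∈ E q.1}
  let G : (Fin d → ℕ) × (Fin r → ℕ) → ℂ := fun q => (∏ i, x i ^ q.1 i) * ∏ j, y j ^ q.2 j
  have h1 : ∑' k : M, ∏ i, x i ^ k.1 i = ∑' q : S, G q := by
    rw [← (hbij.equiv _).tsum_eq]
    exact tsum_congr fun q => hφ q.1.1 q.1.2
  have h2 : ∑' q : S, G q = ∑' q : F × (Fin r → ℕ),
      (∏ i, x i ^ q.1.1 i) * (E q.1.1).indicator (fun n => ∏ j, y j ^ n j) q.2 := by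
    rw [tsum_subtype S G]
    let g : F × (Fin r → ℕ) → (Fin d → ℕ) × (Fin r → ℕ) := fun q => (q.1.1, q.2)
    have hg : Function.Injective g := by
      rintro ⟨a, n⟩ ⟨a', n'⟩ h
      simp only [g, Prod.mk.injEq] at h
      exact Prod.ext (Subtype.ext h.1) h.2
    rw [← hg.tsum_eq]
    · refine tsum_congr fun q => ?_
      by_cases hq : q.2 ∈ E q.1.1
      · rw [Set.indicator_of_mem hq, Set.indicator_of_mem (show g q ∈ S from ⟨q.1.2, hq⟩)]
      · rw [Set.indicator_of_notMem hq,
          Set.indicator_of_notMem (show g q ∉ S from fun h => hq h.2), mul_zero]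
    · intro q hq
      have : q ∈ S := by
        by_contra h
        exact hq (Set.indicator_of_notMem h _)
      exact ⟨(⟨q.1, this.1⟩, q.2), rfl⟩
  have hsumE : ∀ a, Summable fun n => (E a).indicator (fun n => ∏ j, y j ^ n j) n := fun a =>
    hsumN.of_norm.indicator _
  have h3 : ∑' q : F × (Fin r → ℕ),
      (∏ i, x i ^ q.1.1 i) * (E q.1.1).indicator (fun n => ∏ j, y j ^ n j) q.2 =
      ∑ a ∈ F, (∏ i, x i ^ a i) * ∑' n, (E a).indicator (fun n => ∏ j, y j ^ n j) n := by
    have hsum : Summable fun q : F × (Fin r → ℕ) =>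
        (∏ i, x i ^ q.1.1 i) * (E q.1.1).indicator (fun n => ∏ j, y j ^ n j) q.2 := by
      refine Summable.of_norm ?_
      refine (Summable.mul_of_nonneg (f := fun a : F => ‖∏ i, x i ^ a.1 i‖) (hasSum_fintype _).summable hsumN
        (fun _ => norm_nonneg _) (fun _ => norm_nonneg _)).of_nonneg_of_le
          (fun _ => norm_nonneg _) fun q => ?_
      rw [norm_mul]
      refine mul_le_mul_of_nonneg_left ?_ (norm_nonneg _)
      exact norm_indicator_le_norm_self _ _
    have h4 := hsum.tsum_prod' fun a => (hsumE a.1).mul_left (∏ i, x i ^ a.1 i)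
    rw [h4, ← Finset.tsum_subtype F fun a => (∏ i, x i ^ a i) *
      ∑' n, (E a).indicator (fun n => ∏ j, y j ^ n j) n]
    exact tsum_congr fun a => (hsumE a.1).tsum_mul_left (∏ i, x i ^ a.1 i)
  rw [h1, h2, h3, Finset.sum_mul, map_sum]
  refine Finset.sum_congr rfl fun a _ => ?_
  rw [mul_assoc, tsum_indicator_mul_prod_one_sub (E a) (N a) (hE a) y hy1, map_mul, map_sum]
  have hYe : ∀ j, MvPolynomial.eval x (Y j) = y j := fun j => by simp [Y, hy]
  congr 1
  · simp
  · refine Finset.sum_congr rfl fun b _ => ?_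
    by_cases hb : b ∈ E a
    · rw [Set.indicator_of_mem hb, Set.indicator_of_mem hb, map_prod]
      refine Finset.prod_congr rfl fun j _ => ?_
      split_ifs <;> simp [hYe]
    · rw [Set.indicator_of_notMem hb, Set.indicator_of_notMem hb, map_zero]

end Igusa

namespace Igusa

/-! ### The normal fan of a finite set of exponents -/

section Fan

/-- The real scalar product of a vector with an exponent. -/
noncomputable def ip (k : Fin 3 → ℝ) (ω : Fin 3 →₀ ℕ) : ℝ := ∑ i, k i * (ω i : ℝ)

/-- A vector of natural numbers seen as a real vector. -/
def realVec (v : Fin 3 → ℕ) : Fin 3 → ℝ := fun i => (v i : ℝ)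

open Classical in
/-- The exponents of `S` on which `k` is minimal. -/
noncomputable def amin (S : Finset (Fin 3 →₀ ℕ)) (k : Fin 3 → ℝ) : Finset (Fin 3 →₀ ℕ) :=
  S.filter fun ω => ∀ ω' ∈ S, ip k ω ≤ ip k ω'

/-- The face in the direction `w` contains the face in the direction `k`. -/
def FaceLE (S : Finset (Fin 3 →₀ ℕ)) (k w : Fin 3 → ℝ) : Prop :=
  amin S k ⊆ amin S w ∧ ∀ i, k i = 0 → w i = 0

/-- `u` satisfies all the linear equations that hold on the cone of the normal fan containing
`k`. -/
def Tangent (S : Finset (Fin 3 →₀ ℕ)) (k u : Fin 3 → ℝ) : Prop :=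
  (∀ ω ∈ amin S k, ∀ ω' ∈ amin S k, ip u ω = ip u ω') ∧ ∀ i, k i = 0 → u i = 0

/-- `w` is the primitive generator of a ray of the normal fan of `S`. -/
def IsRay (S : Finset (Fin 3 →₀ ℕ)) (w : Fin 3 → ℕ) : Prop :=
  Finset.univ.gcd w = 1 ∧ ∀ u, Tangent S (realVec w) u → ∃ c : ℝ, u = c • realVec w

variable {S : Finset (Fin 3 →₀ ℕ)} {k l u : Fin 3 → ℝ} {ω ω' : Fin 3 →₀ ℕ}

theorem ip_add (k l : Fin 3 → ℝ) (ω : Fin 3 →₀ ℕ) : ip (k + l) ω = ip k ω + ip l ω := by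
  simp [ip, add_mul, Finset.sum_add_distrib]

theorem ip_smul (c : ℝ) (k : Fin 3 → ℝ) (ω : Fin 3 →₀ ℕ) : ip (c • k) ω = c * ip k ω := by
  simp [ip, mul_assoc, Finset.mul_sum]

theorem ip_sub (k l : Fin 3 → ℝ) (ω : Fin 3 →₀ ℕ) : ip (k - l) ω = ip k ω - ip l ω := by
  simp [ip, sub_mul, Finset.sum_sub_distrib]

theorem ip_neg (k : Fin 3 → ℝ) (ω : Fin 3 →₀ ℕ) : ip (-k) ω = -ip k ω := by
  simp [ip]

theorem ip_single (i : Fin 3) (c : ℝ) (ω : Fin 3 →₀ ℕ) : ip (Pi.single i c) ω = c * ω i := by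
  rw [ip, Finset.sum_eq_single i]
  · simp
  · intro j _ hj; simp [hj]
  · simp

theorem realVec_nonneg (v : Fin 3 → ℕ) (i : Fin 3) : 0 ≤ realVec v i := Nat.cast_nonneg _

theorem realVec_add (v w : Fin 3 → ℕ) : realVec (v + w) = realVec v + realVec w := by
  ext i; simp [realVec]

theorem realVec_single (i : Fin 3) (n : ℕ) :
    realVec (Pi.single i n) = Pi.single i (n : ℝ) := by
  ext j
  by_cases h : j = i
  · subst h; simp [realVec]
  · simp [realVec, h]

theorem mem_amin : ω ∈ amin S k ↔ ω ∈ S ∧ ∀ ω' ∈ S, ip k ω ≤ ip k ω' := by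
  simp [amin]

theorem amin_subset : amin S k ⊆ S := fun _ h => (mem_amin.1 h).1

theorem amin_nonempty (hS : S.Nonempty) (k : Fin 3 → ℝ) : (amin S k).Nonempty := by
  obtain ⟨ω, hω, h⟩ := S.exists_min_image (ip k) hS
  exact ⟨ω, mem_amin.2 ⟨hω, h⟩⟩

theorem ip_eq_of_mem_amin (h : ω ∈ amin S k) (h' : ω' ∈ amin S k) : ip k ω = ip k ω' :=
  le_antisymm ((mem_amin.1 h).2 _ (amin_subset h')) ((mem_amin.1 h').2 _ (amin_subset h))

theorem ip_lt_of_notMem_amin (h : ω ∈ amin S k) (hω' : ω' ∈ S) (h' : ω' ∉ amin S k) :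
    ip k ω < ip k ω' := by
  by_contra hle
  push Not at hle
  exact h' (mem_amin.2 ⟨hω', fun _ h'' => hle.trans ((mem_amin.1 h).2 _ h'')⟩)

theorem mem_amin_of_ip_eq (h : ω ∈ amin S k) (hω' : ω' ∈ S) (h' : ip k ω' = ip k ω) :
    ω' ∈ amin S k :=
  mem_amin.2 ⟨hω', fun _ h'' => h'.le.trans ((mem_amin.1 h).2 _ h'')⟩

theorem mem_amin_add (h : ω ∈ amin S k) (h' : ω ∈ amin S l) : ω ∈ amin S (k + l) := by
  refine mem_amin.2 ⟨amin_subset h, fun ω' hω' => ?_⟩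
  rw [ip_add, ip_add]
  exact add_le_add ((mem_amin.1 h).2 _ hω') ((mem_amin.1 h').2 _ hω')

theorem mem_amin_add_iff (h : ω ∈ amin S k) (h' : ω ∈ amin S l) :
    ω' ∈ amin S (k + l) ↔ ω' ∈ amin S k ∧ ω' ∈ amin S l := by
  refine ⟨fun hω' => ?_, fun hω' => mem_amin_add hω'.1 hω'.2⟩
  have h1 := (mem_amin.1 h).2 _ (amin_subset hω')
  have h2 := (mem_amin.1 h').2 _ (amin_subset hω')
  have h3 := ip_eq_of_mem_amin hω' (mem_amin_add h h')
  rw [ip_add, ip_add] at h3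
  exact ⟨mem_amin_of_ip_eq h (amin_subset hω') (by linarith),
    mem_amin_of_ip_eq h' (amin_subset hω') (by linarith)⟩

theorem amin_smul {c : ℝ} (hc : 0 < c) : amin S (c • k) = amin S k := by
  ext ω
  simp only [mem_amin, ip_smul, mul_le_mul_iff_right₀ hc]

theorem mem_amin_smul {c : ℝ} (hc : 0 ≤ c) (h : ω ∈ amin S k) : ω ∈ amin S (c • k) := by
  refine mem_amin.2 ⟨amin_subset h, fun ω' hω' => ?_⟩
  rw [ip_smul, ip_smul]
  exact mul_le_mul_of_nonneg_left ((mem_amin.1 h).2 _ hω') hc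

theorem FaceLE.trans {a b c : Fin 3 → ℝ} (h : FaceLE S a b) (h' : FaceLE S b c) : FaceLE S a c :=
  ⟨h.1.trans h'.1, fun i hi => h'.2 i (h.2 i hi)⟩

theorem faceLE_of_smul {c : ℝ} (hc : 0 < c) : FaceLE S (c • k) k :=
  ⟨(amin_smul hc).le, fun i hi => by simpa [hc.ne'] using hi⟩

/-- Moving along a tangent direction until the face becomes larger. -/
theorem exists_faceLE_of_tangent (hS : S.Nonempty) (hk : ∀ i, 0 ≤ k i) (hu : Tangent S k u)
    (hneg : ∃ i, u i < 0) :
    ∃ t : ℝ, 0 < t ∧ (∀ i, 0 ≤ (k + t • u) i) ∧ FaceLE S k (k + t • u) ∧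
      ¬ FaceLE S (k + t • u) k := by
  classical
  obtain ⟨ω₀, hω₀⟩ := amin_nonempty hS k
  -- The ratio test of linear programming: α is the slack of each inequality at k, β its rate of
  -- change along u, and t the least ratio α / (-β) over β < 0. A constraint attaining this minimum
  -- becomes tight.
  let J : Finset ((Fin 3 →₀ ℕ) ⊕ Fin 3) := S.disjSum Finset.univ
  let α : (Fin 3 →₀ ℕ) ⊕ Fin 3 → ℝ := Sum.elim (fun ω => ip k ω - ip k ω₀) k
  let β : (Fin 3 →₀ ℕ) ⊕ Fin 3 → ℝ := Sum.elim (fun ω => ip u ω - ip u ω₀) u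
  have hα : ∀ c ∈ J, 0 ≤ α c := by
    rintro (ω | i) hc
    · have : ω ∈ S := by simpa [J] using hc
      exact sub_nonneg.2 ((mem_amin.1 hω₀).2 _ this)
    · exact hk i
  have hαβ : ∀ c ∈ J, α c = 0 → β c = 0 := by
    rintro (ω | i) hc h
    · have : ω ∈ S := by simpa [J] using hc
      exact sub_eq_zero.2 (hu.1 _ (mem_amin_of_ip_eq hω₀ this (sub_eq_zero.1 h)) _ hω₀)
    · exact hu.2 i h
  let J' := J.filter fun c => β c < 0
  have hJ' : J'.Nonempty := by
    obtain ⟨i, hi⟩ := hneg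
    exact ⟨Sum.inr i, by simp [J', J, β, hi]⟩
  obtain ⟨c₀, hc₀, hmin⟩ := J'.exists_min_image (fun c => α c / (-β c)) hJ'
  have hc₀J : c₀ ∈ J := (Finset.mem_filter.1 hc₀).1
  have hβ₀ : β c₀ < 0 := (Finset.mem_filter.1 hc₀).2
  have hα₀ : 0 < α c₀ := lt_of_le_of_ne (hα _ hc₀J) fun h => hβ₀.ne (hαβ _ hc₀J h.symm)
  set t := α c₀ / (-β c₀) with ht
  have htpos : 0 < t := div_pos hα₀ (neg_pos.2 hβ₀)
  have hge : ∀ c ∈ J, 0 ≤ α c + t * β c := by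
    intro c hc
    by_cases h : β c < 0
    · have := hmin c (Finset.mem_filter.2 ⟨hc, h⟩)
      rw [le_div_iff₀ (neg_pos.2 h)] at this
      linarith
    · have := mul_nonneg htpos.le (not_lt.1 h)
      linarith [hα c hc]
  have hzero : α c₀ + t * β c₀ = 0 := by
    have := hβ₀.ne
    rw [ht]; field_simp; ring
  have hip : ∀ ω, ip (k + t • u) ω - ip (k + t • u) ω₀ = α (Sum.inl ω) + t * β (Sum.inl ω) := by
    intro ω
    simp only [ip_add, ip_smul, α, β, Sum.elim_inl]; ring
  have hω₀' : ω₀ ∈ amin S (k + t • u) := mem_amin.2 ⟨amin_subset hω₀, fun ω hω => by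
    have := hge (Sum.inl ω) (by simpa [J] using hω)
    rw [← hip] at this; linarith⟩
  have hle : FaceLE S k (k + t • u) := by
    refine ⟨fun ω hω => mem_amin_of_ip_eq hω₀' (amin_subset hω) (sub_eq_zero.1 ?_), fun i hi => ?_⟩
    · rw [hip]
      have h1 : α (Sum.inl ω) = 0 := sub_eq_zero.2 (ip_eq_of_mem_amin hω hω₀)
      have h2 := hαβ (Sum.inl ω) (by simpa [J] using amin_subset hω) h1
      rw [h1, h2]; simp
    · simp [hi, hu.2 i hi]
  refine ⟨t, htpos, fun i => ?_, hle, fun h => ?_⟩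
  · simpa [α, β] using hge (Sum.inr i) (by simp [J])
  · rcases c₀ with ω | i
    · have hω : ω ∈ S := by simpa [J] using hc₀J
      have := h.1 (mem_amin_of_ip_eq hω₀' hω (sub_eq_zero.1 ((hip ω).trans hzero)))
      exact hα₀.ne' (sub_eq_zero.2 (ip_eq_of_mem_amin this hω₀))
    · exact hα₀.ne' (h.2 i (by simpa [α, β] using hzero))

/-- The number of equations that are tight at `k`. -/
noncomputable def tightCard (S : Finset (Fin 3 →₀ ℕ)) (k : Fin 3 → ℝ) : ℕ :=
  (amin S k).card + (Finset.univ.filter fun i => k i = 0).card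

theorem tightCard_le (k : Fin 3 → ℝ) : tightCard S k ≤ S.card + 3 :=
  add_le_add (Finset.card_le_card amin_subset)
    ((Finset.card_le_card (Finset.filter_subset _ _)).trans (by simp))

theorem tightCard_lt (h : FaceLE S k l) (h' : ¬ FaceLE S l k) : tightCard S k < tightCard S l := by
  classical
  have hZ : (Finset.univ.filter fun i => k i = 0) ⊆ Finset.univ.filter fun i => l i = 0 := by
    intro i hi
    simp only [Finset.mem_filter, Finset.mem_univ, true_and] at hi ⊢
    exact h.2 i hi
  by_cases h1 : amin S l ⊆ amin S k
  · have h2 : ¬ ∀ i, l i = 0 → k i = 0 := fun h2 => h' ⟨h1, h2⟩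
    push Not at h2
    obtain ⟨i, hi, hki⟩ := h2
    refine add_lt_add_of_le_of_lt (Finset.card_le_card h.1) (Finset.card_lt_card ⟨hZ, fun hc => ?_⟩)
    have := hc (show i ∈ Finset.univ.filter fun i => l i = 0 by simp [hi])
    simp [hki] at this
  · exact add_lt_add_of_lt_of_le (Finset.card_lt_card ⟨h.1, h1⟩) (Finset.card_le_card hZ)

theorem exists_primitive_of_rat {q : Fin 3 → ℚ} (hq : ∀ i, 0 ≤ q i) (hq0 : q ≠ 0) :
    ∃ w : Fin 3 → ℕ, Finset.univ.gcd w = 1 ∧ ∃ β : ℝ, 0 < β ∧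
      realVec w = β • fun i => (q i : ℝ) := by
  let n : ℕ := ∏ i, (q i).den
  have hn : 0 < n := Finset.prod_pos fun i _ => (q i).pos
  have hint : ∀ i, ∃ m : ℕ, (m : ℚ) = n * q i := by
    intro i
    obtain ⟨d, hd⟩ : (q i).den ∣ n := Finset.dvd_prod_of_mem _ (Finset.mem_univ i)
    refine ⟨d * (q i).num.toNat, ?_⟩
    have h1 : (((q i).num.toNat : ℤ) : ℚ) = (q i).num := by
      rw [Int.toNat_of_nonneg (Rat.num_nonneg.2 (hq i))]
    have h2 : ((q i).den : ℚ) * q i = (q i).num := by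
      rw [mul_comm]; exact Rat.mul_den_eq_num _
    rw [hd]
    push_cast at h1 ⊢
    rw [h1, ← h2]; ring
  choose m hm using hint
  have hm0 : m ≠ 0 := by
    intro h
    apply hq0
    ext i
    have := hm i
    rw [h] at this
    simp only [Pi.zero_apply, Nat.cast_zero, zero_eq_mul, Nat.cast_eq_zero] at this
    exact this.resolve_left hn.ne'
  obtain ⟨w, hw, hw1⟩ := Finset.extract_gcd m (Finset.univ_nonempty (α := Fin 3))
  set g := Finset.univ.gcd m with hg
  have hg0 : 0 < g := by
    refine Nat.pos_of_ne_zero fun h => hm0 ?_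
    ext i
    rw [hw i (Finset.mem_univ i), h]; simp
  refine ⟨w, hw1, (n : ℝ) / g, by positivity, ?_⟩
  ext i
  have h1 : (m i : ℝ) = n * (q i : ℝ) := by exact_mod_cast hm i
  have h2 : (m i : ℝ) = g * w i := by exact_mod_cast hw i (Finset.mem_univ i)
  have hg' : (g : ℝ) ≠ 0 := by exact_mod_cast hg0.ne'
  simp only [realVec, Pi.smul_apply, smul_eq_mul]
  field_simp
  rw [← h1, h2]; ring

/-- The tangent equations have integral coefficients, so applying a ℚ-linear map φ : ℝ → ℚ to the
coordinates of k gives another solution. It is a multiple of k, non-zero when φ (k j) ≠ 0, and so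
the line of k contains a rational vector. -/
theorem exists_ray_of_determined (hk : ∀ i, 0 ≤ k i) (hk0 : k ≠ 0)
    (hdet : ∀ u, Tangent S k u → ∃ c : ℝ, u = c • k) :
    ∃ w : Fin 3 → ℕ, IsRay S w ∧ ∃ c : ℝ, 0 < c ∧ k = c • realVec w := by
  obtain ⟨j, hj⟩ := Function.ne_iff.1 hk0
  obtain ⟨φ, hφ⟩ : ∃ φ : Module.Dual ℚ ℝ, φ (k j) ≠ 0 := by
    by_contra h
    push Not at h
    exact hj ((Module.forall_dual_apply_eq_zero_iff ℚ (k j)).1 h)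
  have hipφ : ∀ (φ : Module.Dual ℚ ℝ) ω, ip (fun i => ((φ (k i) : ℚ) : ℝ)) ω = (φ (ip k ω) : ℚ) := by
    intro φ ω
    rw [ip, ip, map_sum]
    push_cast
    refine Finset.sum_congr rfl fun i _ => ?_
    have : k i * (ω i : ℝ) = (ω i : ℕ) • k i := by simp [mul_comm]
    rw [this, map_nsmul]
    simp [mul_comm]
  have htan : ∀ φ : Module.Dual ℚ ℝ, Tangent S k fun i => ((φ (k i) : ℚ) : ℝ) := by
    refine fun φ => ⟨fun ω hω ω' hω' => ?_, fun i hi => by simp [hi]⟩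
    rw [hipφ, hipφ, ip_eq_of_mem_amin hω hω']
  obtain ⟨c, hc⟩ := hdet _ (htan φ)
  have hcj := congrFun hc j
  simp only [Pi.smul_apply, smul_eq_mul] at hcj
  have hc0 : c ≠ 0 := by
    rintro rfl
    rw [zero_mul] at hcj
    exact hφ (by exact_mod_cast hcj)
  obtain ⟨q, c', hc', hq⟩ : ∃ (q : Fin 3 → ℚ) (c' : ℝ), 0 < c' ∧ (fun i => (q i : ℝ)) = c' • k := by
    rcases lt_or_gt_of_ne hc0 with h | h
    · refine ⟨fun i => - φ (k i), -c, by linarith, ?_⟩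
      ext i
      have := congrFun hc i
      simp only [Pi.smul_apply, smul_eq_mul] at this ⊢
      push_cast
      rw [this]; ring
    · exact ⟨fun i => φ (k i), c, h, hc⟩
  have hqi : ∀ i, (q i : ℝ) = c' * k i := fun i => congrFun hq i
  have hq0 : ∀ i, 0 ≤ q i := fun i => by
    have : (0 : ℝ) ≤ q i := by rw [hqi]; exact mul_nonneg hc'.le (hk i)
    exact_mod_cast this
  have hqne : q ≠ 0 := by
    intro h
    have := hqi j
    rw [h] at this
    simp only [Pi.zero_apply, Rat.cast_zero, zero_eq_mul] at this
    exact hj (this.resolve_left hc'.ne')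
  obtain ⟨w, hw, β, hβ, hwq⟩ := exists_primitive_of_rat hq0 hqne
  have hwk : realVec w = (β * c') • k := by rw [hwq, hq, smul_smul]
  have hpos : 0 < β * c' := mul_pos hβ hc'
  refine ⟨w, ⟨hw, fun u hu => ?_⟩, (β * c')⁻¹, inv_pos.2 hpos, ?_⟩
  · rw [hwk] at hu
    have : Tangent S k u := by
      refine ⟨fun ω hω ω' hω' => ?_, fun i hi => hu.2 i (by simp [hi])⟩
      exact hu.1 _ (by rwa [amin_smul hpos]) _ (by rwa [amin_smul hpos])
    obtain ⟨c, hc⟩ := hdet u this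
    exact ⟨c * (β * c')⁻¹, by rw [hwk, smul_smul, inv_mul_cancel_right₀ hpos.ne', hc]⟩
  · rw [hwk, smul_smul, inv_mul_cancel₀ hpos.ne', one_smul]

/-- The real cone spanned by a set of integral vectors. -/
noncomputable def coneSpan (V : Set (Fin 3 → ℕ)) : Submodule NNReal (Fin 3 → ℝ) :=
  Submodule.span NNReal (realVec '' V)

theorem realVec_mem_coneSpan {V : Set (Fin 3 → ℕ)} {v : Fin 3 → ℕ} (hv : v ∈ V) :
    realVec v ∈ coneSpan V := Submodule.subset_span ⟨v, hv, rfl⟩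

theorem smul_mem_coneSpan {V : Set (Fin 3 → ℕ)} {c : ℝ} (hc : 0 ≤ c) (h : k ∈ coneSpan V) :
    c • k ∈ coneSpan V := by
  have := (coneSpan V).smul_mem ⟨c, hc⟩ h
  exact this

theorem coneSpan_mono {V V' : Set (Fin 3 → ℕ)} (h : V ⊆ V') : coneSpan V ≤ coneSpan V' :=
  Submodule.span_mono (Set.image_mono h)

/-- Every point of the orthant is a positive combination of the generators of the rays of the
normal fan whose faces contain the face of the point. -/
theorem mem_coneSpan_rays (hS : S.Nonempty) (hk : ∀ i, 0 ≤ k i) :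
    k ∈ coneSpan {w | IsRay S w ∧ FaceLE S k (realVec w)} := by
  induction hn : S.card + 3 - tightCard S k using Nat.strong_induction_on generalizing k with
  | _ n ih =>
  subst hn
  by_cases hk0 : k = 0
  · rw [hk0]; exact zero_mem _
  by_cases hdet : ∀ u, Tangent S k u → ∃ c : ℝ, u = c • k
  · obtain ⟨w, hw, c, hc, hkw⟩ := exists_ray_of_determined hk hk0 hdet
    have hface : FaceLE S k (realVec w) := by
      rw [hkw]; exact faceLE_of_smul hc
    have := smul_mem_coneSpan hc.le (realVec_mem_coneSpan
      (V := {w | IsRay S w ∧ FaceLE S k (realVec w)}) ⟨hw, hface⟩)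
    rwa [← hkw] at this
  · push Not at hdet
    obtain ⟨u₀, hu₀, hne⟩ := hdet
    have hσk : 0 < ∑ i, k i := by
      obtain ⟨j, hj⟩ := Function.ne_iff.1 hk0
      exact Finset.sum_pos' (fun i _ => hk i) ⟨j, Finset.mem_univ j, lt_of_le_of_ne (hk j) (Ne.symm hj)⟩
    -- With coordinate sum zero, both u and -u have a negative coordinate, so the face grows in
    -- either direction. The point k lies between the two points reached, and both have more tight
    -- equations.
    set c := (∑ i, u₀ i) / ∑ i, k i with hc
    set u := u₀ - c • k with hu
    have hσu : ∑ i, u i = 0 := by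
      simp only [hu, Pi.sub_apply, Pi.smul_apply, smul_eq_mul, Finset.sum_sub_distrib,
        ← Finset.mul_sum]
      rw [hc]; field_simp; ring
    have hu0 : u ≠ 0 := fun h => hne c (sub_eq_zero.1 h)
    have htu : Tangent S k u := by
      refine ⟨fun ω hω ω' hω' => ?_, fun i hi => ?_⟩
      · rw [hu, ip_sub, ip_sub, ip_smul, ip_smul, hu₀.1 ω hω ω' hω', ip_eq_of_mem_amin hω hω']
      · simp [hu, hu₀.2 i hi, hi]
    have htu' : Tangent S k (-u) := by
      refine ⟨fun ω hω ω' hω' => ?_, fun i hi => ?_⟩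
      · rw [ip_neg, ip_neg, htu.1 ω hω ω' hω']
      · simp [htu.2 i hi]
    have hneg : ∀ x : Fin 3 → ℝ, ∑ i, x i = 0 → x ≠ 0 → ∃ i, x i < 0 := by
      intro x hx hx0
      by_contra h
      push Not at h
      exact hx0 (funext fun i =>
        (Finset.sum_eq_zero_iff_of_nonneg fun i _ => h i).1 hx i (Finset.mem_univ i))
    obtain ⟨t, ht, h1, h2, h3⟩ := exists_faceLE_of_tangent hS hk htu (hneg u hσu hu0)
    obtain ⟨t', ht', h1', h2', h3'⟩ := exists_faceLE_of_tangent hS hk htu'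
      (hneg (-u) (by simp [hσu]) (neg_ne_zero.2 hu0))
    have hrec : ∀ x : Fin 3 → ℝ, (∀ i, 0 ≤ x i) → FaceLE S k x → ¬ FaceLE S x k →
        x ∈ coneSpan {w | IsRay S w ∧ FaceLE S k (realVec w)} := by
      intro x hx hkx hxk
      have hlt := tightCard_lt hkx hxk
      have hle := tightCard_le (S := S) x
      refine coneSpan_mono (V := {w | IsRay S w ∧ FaceLE S x (realVec w)}) ?_
        (ih _ (by omega) hx rfl)
      exact fun w hw => ⟨hw.1, hkx.trans hw.2⟩
    have hcomb : k = (t' / (t + t')) • (k + t • u) + (t / (t + t')) • (k + t' • -u) := by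
      have : t + t' ≠ 0 := by positivity
      ext i
      simp only [Pi.add_apply, Pi.smul_apply, smul_eq_mul, Pi.neg_apply]
      field_simp
      ring
    have := add_mem (smul_mem_coneSpan (by positivity : 0 ≤ t' / (t + t')) (hrec _ h1 h2 h3))
      (smul_mem_coneSpan (by positivity : 0 ≤ t / (t + t')) (hrec _ h1' h2' h3'))
    rwa [← hcomb] at this

/-- Take the gcd over i on both sides of v_i w_j = v_j w_i. -/
theorem eq_of_smul_eq {v w : Fin 3 → ℕ} (hv : Finset.univ.gcd v = 1) (hw : Finset.univ.gcd w = 1)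
    {c : ℝ} (h : realVec v = c • realVec w) : v = w := by
  have hc : ∀ i j, v i * w j = v j * w i := by
    intro i j
    have hi := congrFun h i
    have hj := congrFun h j
    simp only [realVec, Pi.smul_apply, smul_eq_mul] at hi hj
    have : (v i : ℝ) * w j = v j * w i := by rw [hi, hj]; ring
    exact_mod_cast this
  ext j
  have h1 : Finset.univ.gcd (fun i => v i * w j) = w j := by
    rw [Finset.gcd_mul_right, hv]; simp
  have h2 : Finset.univ.gcd (fun i => v j * w i) = v j := by
    rw [Finset.gcd_mul_left, hw]; simp
  rw [← h2, ← h1]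
  congr 1
  ext i
  exact (hc i j).symm

theorem IsRay.eq_of_faceLE {v w : Fin 3 → ℕ} (hv : IsRay S v) (hw : IsRay S w)
    (h : FaceLE S (realVec w) (realVec v)) : v = w := by
  obtain ⟨c, hc⟩ := hw.2 (realVec v)
    ⟨fun ω hω ω' hω' => ip_eq_of_mem_amin (h.1 hω) (h.1 hω'), h.2⟩
  exact eq_of_smul_eq hv.1 hw.1 hc

/-- A ray is determined by its minimal exponents and its zero coordinates, and these range over a
finite set. -/
theorem finite_rays (S : Finset (Fin 3 →₀ ℕ)) : {w | IsRay S w}.Finite := by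
  classical
  let g : (Fin 3 → ℕ) → Finset (Fin 3 →₀ ℕ) × Finset (Fin 3) := fun w =>
    (amin S (realVec w), Finset.univ.filter fun i => w i = 0)
  refine Set.Finite.of_finite_image (f := g) ((Finset.finite_toSet (S.powerset ×ˢ Finset.univ)).subset ?_) ?_
  · rintro _ ⟨w, -, rfl⟩
    simpa [g] using amin_subset
  · intro v hv w hw h
    refine IsRay.eq_of_faceLE hv hw ⟨(congrArg Prod.fst h).ge, fun i hi => ?_⟩
    have h2 := congrArg Prod.snd h
    have h3 : i ∈ Finset.univ.filter fun i => w i = 0 := by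
      simpa [realVec] using hi
    have h4 : i ∈ Finset.univ.filter fun i => v i = 0 := by
      change i ∈ (g v).2
      rw [h2]; exact h3
    simpa [realVec] using h4

theorem isRay_single (S : Finset (Fin 3 →₀ ℕ)) (i : Fin 3) : IsRay S (Pi.single i 1) := by
  constructor
  · refine Nat.dvd_one.1 ?_
    have := Finset.gcd_dvd (f := (Pi.single i 1 : Fin 3 → ℕ)) (Finset.mem_univ i)
    simpa using this
  · intro u hu
    refine ⟨u i, ?_⟩
    ext j
    by_cases h : j = i
    · subst h; simp [realVec]
    · have : realVec (Pi.single i 1) j = 0 := by simp [realVec, h]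
      rw [hu.2 j this]; simp [this]

theorem IsRay.ne_zero {w : Fin 3 → ℕ} (hw : IsRay S w) : w ≠ 0 := by
  rintro rfl
  have := hw.1
  rw [show Finset.univ.gcd (0 : Fin 3 → ℕ) = 0 from Finset.gcd_eq_zero_iff.2 fun _ _ => rfl] at this
  exact zero_ne_one this

end Fan

end Igusa

namespace Igusa

/-! ### Faces of the Newton polyhedron and the normal fan -/

section Faces

variable {R : Type*} [CommRing R] {f : MvPolynomial (Fin 3) R} {v : Fin 3 → ℝ} {x : Fin 3 → ℝ}
  {ω : Fin 3 →₀ ℕ}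

/-- The face of the Newton polyhedron on which `v` is minimal. -/
def faceSet (f : MvPolynomial (Fin 3) R) (v : Fin 3 → ℝ) : Set (Fin 3 → ℝ) :=
  {x ∈ newtonPolyhedron f | ∀ y ∈ newtonPolyhedron f, ∑ i, v i * x i ≤ ∑ i, v i * y i}

/-- The points that dominate a convex combination of exponents form a convex set containing all the
orthants. Conversely, such a point is the same combination of the exponents, all translated by the
non-negative slack. -/
theorem mem_newtonPolyhedron_iff : x ∈ newtonPolyhedron f ↔
    ∃ c : (Fin 3 →₀ ℕ) → ℝ, (∀ ω ∈ f.support, 0 ≤ c ω) ∧ ∑ ω ∈ f.support, c ω = 1 ∧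
      ∀ i, ∑ ω ∈ f.support, c ω * ω i ≤ x i := by
  classical
  constructor
  · intro hx
    let P : Set (Fin 3 → ℝ) := {x | ∃ c : (Fin 3 →₀ ℕ) → ℝ, (∀ ω ∈ f.support, 0 ≤ c ω) ∧
      ∑ ω ∈ f.support, c ω = 1 ∧ ∀ i, ∑ ω ∈ f.support, c ω * ω i ≤ x i}
    have hP : Convex ℝ P := by
      rintro x ⟨c, hc, hc1, hcx⟩ y ⟨d, hd, hd1, hdy⟩ a b ha hb hab
      refine ⟨fun ω => a * c ω + b * d ω, fun ω hω => ?_, ?_, fun i => ?_⟩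
      · have := hc ω hω; have := hd ω hω; positivity
      · rw [Finset.sum_add_distrib, ← Finset.mul_sum, ← Finset.mul_sum, hc1, hd1]; simpa using hab
      · have : ∑ ω ∈ f.support, (a * c ω + b * d ω) * (ω i : ℝ) =
            a * ∑ ω ∈ f.support, c ω * ω i + b * ∑ ω ∈ f.support, d ω * ω i := by
          rw [Finset.mul_sum, Finset.mul_sum, ← Finset.sum_add_distrib]
          exact Finset.sum_congr rfl fun _ _ => by ring
        rw [this]
        exact add_le_add (mul_le_mul_of_nonneg_left (hcx i) ha)
          (mul_le_mul_of_nonneg_left (hdy i) hb)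
    refine convexHull_min ?_ hP hx
    refine Set.iUnion₂_subset fun ω hω y hy => ⟨Pi.single ω 1, fun ω' _ => ?_, ?_, fun i => ?_⟩
    · by_cases h : ω' = ω
      · subst h; simp
      · simp [h]
    · rw [Finset.sum_pi_single', if_pos hω]
    · rw [Finset.sum_eq_single ω]
      · simpa [expPoint] using hy i
      · intro ω' _ h; simp [h]
      · intro h; exact absurd hω h
  · rintro ⟨c, hc, hc1, hcx⟩
    have hmem : ∀ ω ∈ f.support, (fun i => (ω i : ℝ) + (x i - ∑ ω ∈ f.support, c ω * ω i)) ∈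
        newtonPolyhedron f := by
      intro ω hω
      refine subset_convexHull ℝ _ (Set.mem_iUnion₂.2 ⟨ω, hω, fun i => ?_⟩)
      have := hcx i
      simp only [expPoint]
      linarith
    have := (convex_convexHull ℝ _ : Convex ℝ (newtonPolyhedron f)).sum_mem hc hc1 hmem
    have hx : x = ∑ ω ∈ f.support,
        c ω • fun i => (ω i : ℝ) + (x i - ∑ ω ∈ f.support, c ω * ω i) := by
      ext i
      simp only [Finset.sum_apply, Pi.smul_apply, smul_eq_mul, mul_add, Finset.sum_add_distrib]
      rw [← Finset.sum_mul, hc1]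
      ring
    rw [hx]
    exact this

theorem expPoint_mem_newtonPolyhedron (hω : ω ∈ f.support) : expPoint ω ∈ newtonPolyhedron f :=
  subset_convexHull ℝ _ (Set.mem_iUnion₂.2 ⟨ω, hω, fun _ => le_rfl⟩)

theorem ip_eq_sum_expPoint (v : Fin 3 → ℝ) (ω : Fin 3 →₀ ℕ) : ip v ω = ∑ i, v i * expPoint ω i :=
  rfl

theorem sum_mul_sum_eq (v : Fin 3 → ℝ) (T : Finset (Fin 3 →₀ ℕ)) (c : (Fin 3 →₀ ℕ) → ℝ) :
    ∑ i, v i * ∑ ω ∈ T, c ω * ω i = ∑ ω ∈ T, c ω * ip v ω := by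
  simp only [ip, Finset.mul_sum]
  rw [Finset.sum_comm]
  exact Finset.sum_congr rfl fun _ _ => Finset.sum_congr rfl fun _ _ => by ring

theorem ip_le_of_mem_newtonPolyhedron (hv : ∀ i, 0 ≤ v i) (hω : ω ∈ amin f.support v)
    (hx : x ∈ newtonPolyhedron f) : ip v ω ≤ ∑ i, v i * x i := by
  obtain ⟨c, hc, hc1, hcx⟩ := mem_newtonPolyhedron_iff.1 hx
  calc ip v ω = ∑ ω' ∈ f.support, c ω' * ip v ω := by rw [← Finset.sum_mul, hc1, one_mul]
    _ ≤ ∑ ω' ∈ f.support, c ω' * ip v ω' := Finset.sum_le_sum fun ω' hω' =>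
        mul_le_mul_of_nonneg_left ((mem_amin.1 hω).2 _ hω') (hc _ hω')
    _ = ∑ i, v i * ∑ ω ∈ f.support, c ω * ω i := (sum_mul_sum_eq _ _ _).symm
    _ ≤ _ := Finset.sum_le_sum fun i _ => mul_le_mul_of_nonneg_left (hcx i) (hv i)

theorem mem_faceSet_iff (hv : ∀ i, 0 ≤ v i) (hω : ω ∈ amin f.support v) :
    x ∈ faceSet f v ↔ x ∈ newtonPolyhedron f ∧ ∑ i, v i * x i = ip v ω := by
  constructor
  · rintro ⟨hx, h⟩
    exact ⟨hx, le_antisymm (h _ (expPoint_mem_newtonPolyhedron (amin_subset hω)))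
      (ip_le_of_mem_newtonPolyhedron hv hω hx)⟩
  · rintro ⟨hx, h⟩
    exact ⟨hx, fun y hy => h.le.trans (ip_le_of_mem_newtonPolyhedron hv hω hy)⟩

theorem expPoint_mem_faceSet_iff (hv : ∀ i, 0 ≤ v i) (hω : ω ∈ f.support) :
    expPoint ω ∈ faceSet f v ↔ ω ∈ amin f.support v := by
  obtain ⟨ω₀, hω₀⟩ := amin_nonempty ⟨ω, hω⟩ v
  rw [mem_faceSet_iff hv hω₀, ← ip_eq_sum_expPoint]
  exact ⟨fun h => mem_amin_of_ip_eq hω₀ hω h.2,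
    fun h => ⟨expPoint_mem_newtonPolyhedron hω, ip_eq_of_mem_amin h hω₀⟩⟩

/-- Complementary slackness: the excess of v over its minimum is a sum of non-negative terms, one
for each exponent and one for each coordinate. On the face they all vanish, so the weights sit on
minimal exponents and there is no slack where v i ≠ 0. -/
theorem exists_weights_of_mem_faceSet (hv : ∀ i, 0 ≤ v i) (hx : x ∈ faceSet f v) :
    ∃ c : (Fin 3 →₀ ℕ) → ℝ, (∀ ω, 0 ≤ c ω) ∧ (∀ ω, c ω ≠ 0 → ω ∈ amin f.support v) ∧
      ∑ ω ∈ amin f.support v, c ω = 1 ∧ (∀ i, ∑ ω ∈ amin f.support v, c ω * ω i ≤ x i) ∧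
      ∀ i, v i ≠ 0 → ∑ ω ∈ amin f.support v, c ω * ω i = x i := by
  classical
  obtain ⟨c, hc, hc1, hcx⟩ := mem_newtonPolyhedron_iff.1 hx.1
  have hne : f.support.Nonempty := by
    by_contra h
    rw [Finset.not_nonempty_iff_eq_empty.1 h] at hc1
    simp at hc1
  obtain ⟨ω₀, hω₀⟩ := amin_nonempty hne v
  have hx2 := ((mem_faceSet_iff hv hω₀).1 hx).2
  have h1 : ∑ ω ∈ f.support, c ω * (ip v ω - ip v ω₀) + ∑ i, v i * (x i - ∑ ω ∈ f.support, c ω * ω i)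
      = 0 := by
    simp only [mul_sub, Finset.sum_sub_distrib]
    rw [sum_mul_sum_eq, hx2, ← Finset.sum_mul, hc1]
    ring
  have hn1 : ∀ ω ∈ f.support, 0 ≤ c ω * (ip v ω - ip v ω₀) := fun ω hω =>
    mul_nonneg (hc ω hω) (sub_nonneg.2 ((mem_amin.1 hω₀).2 _ hω))
  have hn2 : ∀ i ∈ (Finset.univ : Finset (Fin 3)), 0 ≤ v i * (x i - ∑ ω ∈ f.support, c ω * ω i) :=
    fun i _ => mul_nonneg (hv i) (sub_nonneg.2 (hcx i))
  have hz1 : ∑ ω ∈ f.support, c ω * (ip v ω - ip v ω₀) = 0 :=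
    le_antisymm (by linarith [Finset.sum_nonneg hn2]) (Finset.sum_nonneg hn1)
  have hz2 : ∑ i, v i * (x i - ∑ ω ∈ f.support, c ω * ω i) = 0 := by linarith
  have hsupp : ∀ ω ∈ f.support, c ω ≠ 0 → ω ∈ amin f.support v := by
    intro ω hω h
    have := (Finset.sum_eq_zero_iff_of_nonneg hn1).1 hz1 ω hω
    rcases mul_eq_zero.1 this with h' | h'
    · exact absurd h' h
    · exact mem_amin_of_ip_eq hω₀ hω (sub_eq_zero.1 h')
  let d : (Fin 3 →₀ ℕ) → ℝ := fun ω => if ω ∈ amin f.support v then c ω else 0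
  have hd : ∀ g : (Fin 3 →₀ ℕ) → ℝ,
      ∑ ω ∈ amin f.support v, d ω * g ω = ∑ ω ∈ f.support, c ω * g ω := by
    intro g
    rw [← Finset.sum_subset (amin_subset (S := f.support) (k := v)) (f := fun ω => c ω * g ω)]
    · exact Finset.sum_congr rfl fun ω hω => by simp [d, hω]
    · intro ω hω hω'
      have : c ω = 0 := by
        by_contra h
        exact hω' (hsupp ω hω h)
      rw [this, zero_mul]
  refine ⟨d, fun ω => ?_, fun ω hω => ?_, ?_, fun i => ?_, fun i hi => ?_⟩
  · by_cases h : ω ∈ amin f.support v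
    · simpa [d, h] using hc ω (amin_subset h)
    · simp [d, h]
  · by_contra h
    exact hω (by simp [d, h])
  · have := hd fun _ => 1
    simpa [hc1] using this
  · rw [hd]; exact hcx i
  · rw [hd]
    have := (Finset.sum_eq_zero_iff_of_nonneg hn2).1 hz2 i (Finset.mem_univ i)
    rcases mul_eq_zero.1 this with h' | h'
    · exact absurd h' hi
    · linarith

theorem isFace_faceSet (hf : f ≠ 0) (hv : ∀ i, 0 ≤ v i) : IsFace (newtonPolyhedron f) (faceSet f v) := by
  have hS : f.support.Nonempty := MvPolynomial.support_nonempty.2 hf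
  obtain ⟨ω, hω⟩ := amin_nonempty hS v
  refine ⟨⟨_, (expPoint_mem_faceSet_iff hv (amin_subset hω)).2 hω⟩, fun _ => ?_⟩
  -- Exposed faces are defined by maxima of functionals, hence the sign.
  let l : (Fin 3 → ℝ) →ₗ[ℝ] ℝ := -∑ i, v i • LinearMap.proj i
  refine ⟨LinearMap.toContinuousLinearMap l, ?_⟩
  have hl : ∀ x, LinearMap.toContinuousLinearMap l x = -∑ i, v i * x i := fun x => by simp [l]
  ext x
  simp only [faceSet, Set.mem_ofPred_eq, hl, neg_le_neg_iff]

theorem add_single_mem_faceSet {i : Fin 3} (hi : v i = 0) {t : ℝ} (ht : 0 ≤ t)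
    (hx : x ∈ faceSet f v) : x + Pi.single i t ∈ faceSet f v := by
  have hsum : ∑ j, v j * (x + Pi.single i t : Fin 3 → ℝ) j = ∑ j, v j * x j := by
    refine Finset.sum_congr rfl fun j _ => ?_
    by_cases hj : j = i
    · subst hj; simp [hi]
    · simp [hj]
  refine ⟨?_, fun y hy => hsum.le.trans (hx.2 y hy)⟩
  obtain ⟨c, hc, hc1, hcx⟩ := mem_newtonPolyhedron_iff.1 hx.1
  refine mem_newtonPolyhedron_iff.2 ⟨c, hc, hc1, fun j => (hcx j).trans ?_⟩
  by_cases hj : j = i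
  · subst hj; simp [ht]
  · simp [hj]

/-- With all v i positive there is no slack, and the face is the convex hull of its finitely many
minimal exponents. -/
theorem isCompact_faceSet (hv : ∀ i, 0 < v i) : IsCompact (faceSet f v) := by
  classical
  rcases eq_or_ne f 0 with rfl | hf
  · have : faceSet (0 : MvPolynomial (Fin 3) R) v = ∅ := by
      ext x
      simp [faceSet, newtonPolyhedron]
    rw [this]; exact isCompact_empty
  have hv0 : ∀ i, 0 ≤ v i := fun i => (hv i).le
  have : faceSet f v = convexHull ℝ (expPoint '' (amin f.support v : Set (Fin 3 →₀ ℕ))) := by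
    apply subset_antisymm
    · intro x hx
      obtain ⟨c, hc, -, hc1, -, hcx⟩ := exists_weights_of_mem_faceSet hv0 hx
      have := (convex_convexHull ℝ (expPoint '' (amin f.support v : Set (Fin 3 →₀ ℕ)))).sum_mem
        (fun ω _ => hc ω) hc1 (fun ω hω => subset_convexHull ℝ _ ⟨ω, hω, rfl⟩)
      convert this using 1
      ext i
      rw [← hcx i (hv i).ne']
      simp [expPoint]
    · refine convexHull_min ?_ (IsExposed.convex (𝕜 := ℝ) (isFace_faceSet hf hv0).2 (convex_convexHull ℝ _))
      rintro _ ⟨ω, hω, rfl⟩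
      exact (expPoint_mem_faceSet_iff hv0 (amin_subset hω)).2 hω
  rw [this]
  exact ((Finset.finite_toSet _).image _).isCompact_convexHull ℝ

theorem facePart_faceSet (hv : ∀ i, 0 ≤ v i) :
    facePart f (faceSet f v) =
      ∑ ω ∈ amin f.support v, MvPolynomial.monomial ω (f.coeff ω) := by
  classical
  refine Finset.sum_congr ?_ fun _ _ => rfl
  ext ω
  rw [Finset.mem_filter]
  exact ⟨fun h => (expPoint_mem_faceSet_iff hv h.1).1 h.2,
    fun h => ⟨amin_subset h, (expPoint_mem_faceSet_iff hv (amin_subset h)).2 h⟩⟩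

/-- A functional that annihilates the direction space of the face is tangent at w, because
differences of minimal exponents and the e_i with w i = 0 are directions of the face. For a ray the
annihilator is therefore a line and the face has dimension two. -/
theorem isFacet_faceSet (hf : f ≠ 0) {w : Fin 3 → ℕ} (hw : IsRay f.support w) :
    IsFacet (newtonPolyhedron f) (faceSet f (realVec w)) := by
  have hw0 := realVec_nonneg w
  have hface := isFace_faceSet hf hw0
  refine ⟨hface, ?_⟩
  set Vs := vectorSpan ℝ (faceSet f (realVec w)) with hVs
  let φ : Module.Dual ℝ (Fin 3 → ℝ) := ∑ i, realVec w i • LinearMap.proj i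
  have hφ : ∀ x, φ x = ∑ i, realVec w i * x i := fun x => by simp [φ]
  have hφ0 : φ ≠ 0 := by
    intro h
    obtain ⟨j, hj⟩ := Function.ne_iff.1 hw.ne_zero
    have := hφ (Pi.single j 1)
    rw [h, Finset.sum_eq_single j] at this
    · simp only [LinearMap.zero_apply, Pi.single_eq_same, mul_one, realVec] at this
      exact hj (by exact_mod_cast this.symm)
    · intro i _ hi; simp [hi]
    · simp
  have hann : Vs.dualAnnihilator = Submodule.span ℝ {φ} := by
    apply le_antisymm
    · intro θ hθ
      rw [Submodule.mem_dualAnnihilator] at hθ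
      have hθx : ∀ x, θ x = ∑ i, θ (Pi.single i 1) * x i := by
        intro x
        rw [LinearMap.pi_apply_eq_sum_univ θ x]
        refine Finset.sum_congr rfl fun i _ => ?_
        rw [smul_eq_mul, mul_comm]
        congr 2
        ext j
        by_cases h : j = i
        · subst h; simp
        · simp [h, Ne.symm h]
      have htan : Tangent f.support (realVec w) fun i => θ (Pi.single i 1) := by
        refine ⟨fun ω hω ω' hω' => ?_, fun i hi => ?_⟩
        · have h := hθ _ (vsub_mem_vectorSpan ℝ
            ((expPoint_mem_faceSet_iff hw0 (amin_subset hω)).2 hω)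
            ((expPoint_mem_faceSet_iff hw0 (amin_subset hω')).2 hω'))
          rw [vsub_eq_sub, map_sub, sub_eq_zero, hθx, hθx] at h
          exact h
        · obtain ⟨x, hx⟩ := hface.1
          have h := hθ _ (vsub_mem_vectorSpan ℝ (add_single_mem_faceSet hi zero_le_one hx) hx)
          rw [vsub_eq_sub, add_sub_cancel_left] at h
          exact h
      obtain ⟨c, hc⟩ := hw.2 _ htan
      refine Submodule.mem_span_singleton.2 ⟨c, LinearMap.ext fun x => ?_⟩
      rw [hθx, LinearMap.smul_apply, hφ, smul_eq_mul, Finset.mul_sum]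
      refine Finset.sum_congr rfl fun i _ => ?_
      rw [show θ (Pi.single i 1) = c * realVec w i from congrFun hc i, mul_assoc]
    · rw [Submodule.span_singleton_le_iff_mem, Submodule.mem_dualAnnihilator]
      intro y hy
      have : Vs ≤ LinearMap.ker φ := by
        rw [hVs, vectorSpan_def, Submodule.span_le]
        rintro _ ⟨a, ha, b, hb, rfl⟩
        change φ (a - b) = 0
        rw [map_sub, hφ, hφ]
        exact sub_eq_zero.2 (le_antisymm (ha.2 _ hb.1) (hb.2 _ ha.1))
      exact this hy
  have h1 := Subspace.finrank_add_finrank_dualAnnihilator_eq Vs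
  rw [hann, finrank_span_singleton hφ0] at h1
  simpa using h1

theorem isPrimitiveNormal_faceSet {w : Fin 3 → ℕ} (hw : IsRay f.support w) :
    IsPrimitiveNormal (faceSet f (realVec w)) w :=
  ⟨hw.1, fun _ hx _ hy => le_antisymm (hx.2 _ hy.1) (hy.2 _ hx.1)⟩

theorem mVal_eq_ip {w : Fin 3 → ℕ} (hω : ω ∈ amin f.support (realVec w)) :
    mVal f w = ip (realVec w) ω := by
  refine le_antisymm (csInf_le ⟨ip (realVec w) ω, ?_⟩ ?_) (le_csInf ?_ ?_)
  · rintro _ ⟨x, hx, rfl⟩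
    exact ip_le_of_mem_newtonPolyhedron (realVec_nonneg w) hω hx
  · exact ⟨_, expPoint_mem_newtonPolyhedron (amin_subset hω), rfl⟩
  · exact ⟨_, ⟨_, expPoint_mem_newtonPolyhedron (amin_subset hω), rfl⟩⟩
  · rintro _ ⟨x, hx, rfl⟩
    exact ip_le_of_mem_newtonPolyhedron (realVec_nonneg w) hω hx

end Faces

end Igusa

namespace Igusa

/-! ### Combinatorial data of `B₁`-facets -/

theorem exists_weights_of_mem_convexHull_range {κ : Type*} [Fintype κ] {V : κ → κ → ℝ} {x : κ → ℝ}
    (hx : x ∈ convexHull ℝ (Set.range V)) :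
    ∃ a : κ → ℝ, (∀ j, 0 ≤ a j) ∧ ∑ j, a j = 1 ∧ x = ∑ j, a j • V j := by
  classical
  let P : Set (κ → ℝ) := {x | ∃ a : κ → ℝ, (∀ j, 0 ≤ a j) ∧ ∑ j, a j = 1 ∧ x = ∑ j, a j • V j}
  have hP : Convex ℝ P := by
    rintro x ⟨c, hc, hc1, rfl⟩ y ⟨d, hd, hd1, rfl⟩ a b ha hb hab
    refine ⟨fun j => a * c j + b * d j, fun j => ?_, ?_, ?_⟩
    · have := hc j; have := hd j; positivity
    · rw [Finset.sum_add_distrib, ← Finset.mul_sum, ← Finset.mul_sum, hc1, hd1]; simpa using hab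
    · simp only [add_smul, Finset.sum_add_distrib, Finset.smul_sum, smul_smul]
  refine convexHull_min ?_ hP hx
  rintro _ ⟨j, rfl⟩
  refine ⟨Pi.single j 1, fun l => ?_, by simp, ?_⟩
  · by_cases h : l = j
    · subst h; simp
    · simp [h]
  · rw [Finset.sum_eq_single j]
    · simp
    · intro l _ h; simp [h]
    · simp

/-- The coordinate `x_i` on a `B₁`-simplex for `i` is the barycentric coordinate of the apex. -/
theorem IsB1Simplex.coord_apex {κ : Type*} [Fintype κ] {i : κ} {T : Set (κ → ℝ)}
    (hT : IsB1Simplex i T) :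
    (∀ x ∈ T, x i ≤ 1) ∧ (∃ x ∈ T, x i = 1) ∧
      (∀ x ∈ T, ∀ y ∈ T, x i = 1 → y i = 1 → x = y) ∧
      ∀ j l, j ≠ l → j ≠ i → l ≠ i → ∃ x ∈ T, ∃ y ∈ T, x ≠ y ∧ x i = 0 ∧ y i = 0 := by
  classical
  obtain ⟨V, hV, rfl, hi, hj⟩ := hT
  have hcoord : ∀ a : κ → ℝ, (∑ j, a j • V j) i = a i := by
    intro a
    rw [Finset.sum_apply, Finset.sum_eq_single i]
    · simp [hi]
    · intro l _ hl; simp [hj l hl]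
    · simp
  have hmem : ∀ j, V j ∈ convexHull ℝ (Set.range V) := fun j => subset_convexHull ℝ _ ⟨j, rfl⟩
  refine ⟨fun x hx => ?_, ⟨V i, hmem i, hi⟩, ?_, fun j l hjl hji hli =>
    ⟨V j, hmem j, V l, hmem l, fun h => hjl (hV.injective h), hj j hji, hj l hli⟩⟩
  · obtain ⟨a, ha, ha1, rfl⟩ := exists_weights_of_mem_convexHull_range hx
    rw [hcoord, ← ha1]
    exact Finset.single_le_sum (fun j _ => ha j) (Finset.mem_univ i)
  · have key : ∀ x ∈ convexHull ℝ (Set.range V), x i = 1 → x = V i := by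
      intro x hx hx1
      obtain ⟨a, ha, ha1, rfl⟩ := exists_weights_of_mem_convexHull_range hx
      rw [hcoord] at hx1
      have hrest : ∑ j ∈ Finset.univ.erase i, a j = 0 := by
        have := Finset.add_sum_erase Finset.univ a (Finset.mem_univ i)
        rw [ha1, hx1] at this
        linarith
      rw [Finset.sum_eq_single i]
      · rw [hx1, one_smul]
      · intro j _ hji
        have := (Finset.sum_eq_zero_iff_of_nonneg fun j _ => ha j).1 hrest j
          (Finset.mem_erase.2 ⟨hji, Finset.mem_univ j⟩)
        rw [this, zero_smul]
      · simp
    intro x hx y hy hx1 hy1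
    rw [key x hx hx1, key y hy hy1]

/-- The properties of a `B₁`-facet for the variable `i` with normal `w` in terms of the exponents
on the facet. -/
structure B1Data (S : Finset (Fin 3 →₀ ℕ)) (w : Fin 3 → ℕ) (i : Fin 3) : Prop where
  le_one : ∀ ω ∈ amin S (realVec w), ω i ≤ 1
  apex : ∃ ω ∈ amin S (realVec w), ω i = 1
  pos : w i ≠ 0
  unique : ∀ k : Fin 3 → ℝ, (∀ j, 0 < k j) → ∀ ω ∈ amin S (realVec w), ∀ ω' ∈ amin S (realVec w),
    ω i = 1 → ω' i = 1 → ip k ω = ip k ω' → ω = ω'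
  base : (∃ j, j ≠ i ∧ w j = 0) ∨ ∃ ω ∈ amin S (realVec w), ∃ ω' ∈ amin S (realVec w),
    ω ≠ ω' ∧ ω i = 0 ∧ ω' i = 0

theorem expPoint_injective {ι : Type*} : Function.Injective (expPoint (ι := ι)) := by
  intro ω ω' h
  ext i
  have := congrFun h i
  simpa [expPoint] using this

/-- On a non-compact B₁-facet several exponents can have x_i = 1, but they differ only in the stable
direction; a vector k with positive coordinates tells them apart, which is why `unique` refers to
such a k. The stable direction j gives w j = 0, the first alternative of `base`. -/
theorem b1Data_of_isB1For {R : Type*} [CommRing R] {f : MvPolynomial (Fin 3) R}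
    {w : Fin 3 → ℕ} {i : Fin 3} (h : IsB1For i (faceSet f (realVec w))) :
    B1Data f.support w i := by
  classical
  have hw0 := realVec_nonneg w
  set τ := faceSet f (realVec w) with hτ
  have hfacts : (∀ x ∈ τ, x i ≤ 1) ∧ (∃ x ∈ τ, x i = 1) ∧
      (∀ x ∈ τ, ∀ y ∈ τ, x i = 1 → y i = 1 → x = y ∨ ∃ j, ∀ l, l ≠ j → x l = y l) ∧
      ((∃ j, j ≠ i ∧ w j = 0) ∨ ∃ x ∈ τ, ∃ y ∈ τ, x ≠ y ∧ x i = 0 ∧ y i = 0) := by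
    rcases h with h | ⟨j, hij, hnc, h⟩
    · obtain ⟨h1, h2, h3, h4⟩ := h.coord_apex
      refine ⟨h1, h2, fun x hx y hy hx1 hy1 => Or.inl (h3 x hx y hy hx1 hy1), Or.inr ?_⟩
      have : ∀ i : Fin 3, ∃ j l : Fin 3, j ≠ l ∧ j ≠ i ∧ l ≠ i := by decide
      obtain ⟨j, l, hjl, hji, hli⟩ := this i
      exact h4 j l hjl hji hli
    · obtain ⟨h1, ⟨y, ⟨x, hx, rfl⟩, hy⟩, h3, -⟩ := h.coord_apex
      refine ⟨fun x hx => h1 _ ⟨x, hx, rfl⟩, ⟨x, hx, hy⟩, fun x hx y hy hx1 hy1 => Or.inr ⟨j, ?_⟩,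
        Or.inl ⟨j, hij.symm, ?_⟩⟩
      · intro l hl
        exact congrFun (h3 _ ⟨x, hx, rfl⟩ _ ⟨y, hy, rfl⟩ hx1 hy1) ⟨l, hl⟩
      · have hx' := (hnc j).2 rfl x hx
        have h1 := hx'.2 x hx.1
        have h2 := hx.2 _ hx'.1
        have h3 : ∑ k, realVec w k * (if k = j then x k + 1 else x k) =
            ∑ k, realVec w k * x k + realVec w j := by
          have : ∀ k, realVec w k * (if k = j then x k + 1 else x k) =
              realVec w k * x k + if k = j then realVec w k else 0 := by
            intro k; split_ifs <;> ring
          simp only [this, Finset.sum_add_distrib]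
          simp
        have h4 : ∑ k, realVec w k * (if k = j then x k + 1 else x k) ≤
            ∑ k, realVec w k * x k := by
          refine le_trans (le_of_eq (Finset.sum_congr rfl fun k _ => ?_)) h1
          by_cases hk : k = j <;> simp [hk]
        rw [h3] at h4
        have h5 : realVec w j ≤ 0 := by linarith
        have h6 : (w j : ℝ) = 0 := le_antisymm h5 (hw0 j)
        exact_mod_cast h6
  obtain ⟨h1, ⟨x₁, hx₁, hx₁i⟩, h3, h4⟩ := hfacts
  have hmem : ∀ ω ∈ amin f.support (realVec w), expPoint ω ∈ τ := fun ω hω =>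
    (expPoint_mem_faceSet_iff hw0 (amin_subset hω)).2 hω
  have hle : ∀ ω ∈ amin f.support (realVec w), ω i ≤ 1 := fun ω hω => by
    have := h1 _ (hmem ω hω)
    simp only [expPoint] at this
    exact_mod_cast this
  -- If w i were 0, the facet would be stable under translation along e_i, contrary to x_i ≤ 1 on
  -- it.
  have hpos : w i ≠ 0 := by
    intro h0
    have := h1 _ (add_single_mem_faceSet (i := i) (by simp [realVec, h0]) zero_le_one hx₁)
    simp [hx₁i] at this
    linarith
  refine ⟨hle, ?_, hpos, ?_, ?_⟩
  · obtain ⟨c, hc, hcs, hc1, -, hcx⟩ := exists_weights_of_mem_faceSet hw0 hx₁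
    by_contra hno
    push Not at hno
    have h0 : ∀ ω ∈ amin f.support (realVec w), c ω * (ω i : ℝ) = 0 := by
      intro ω hω
      have : ω i = 0 := by have := hle ω hω; have := hno ω hω; omega
      simp [this]
    have := hcx i (by simpa [realVec] using hpos)
    rw [Finset.sum_eq_zero h0, hx₁i] at this
    exact zero_ne_one this
  · intro k hk ω hω ω' hω' hωi hωi' hip
    rcases h3 _ (hmem ω hω) _ (hmem ω' hω') (by simp [expPoint, hωi]) (by simp [expPoint, hωi'])
      with h | ⟨j, hj⟩
    · exact expPoint_injective h
    · have hl : ∀ l, l ≠ j → ω l = ω' l := fun l hl => by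
        have := hj l hl
        simpa [expPoint] using this
      have hz : k j * ((ω j : ℝ) - ω' j) = 0 := by
        have : ip k ω - ip k ω' = k j * ((ω j : ℝ) - ω' j) := by
          rw [ip, ip, ← Finset.sum_sub_distrib, Finset.sum_eq_single j]
          · ring
          · intro l _ hlj; rw [hl l hlj]; ring
          · simp
        rw [← this, hip, sub_self]
      have hjj : ω j = ω' j := by
        have := (mul_eq_zero.1 hz).resolve_left (hk j).ne'
        exact_mod_cast sub_eq_zero.1 this
      ext l
      by_cases h : l = j
      · rw [h, hjj]
      · exact hl l h
  · rcases h4 with h4 | ⟨x, hx, y, hy, hxy, hxi, hyi⟩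
    · exact Or.inl h4
    · by_contra hno
      push Not at hno
      obtain ⟨hno1, hno2⟩ := hno
      have hall : ∀ j, realVec w j ≠ 0 := fun j => by
        by_cases hj : j = i
        · subst hj; simpa [realVec] using hpos
        · simpa [realVec] using hno1 j hj
      -- All coordinates of w are now non-zero, so points of the facet are combinations of its
      -- exponents without slack. If only one exponent has x_i = 0, it carries the whole weight of
      -- any point in {x_i = 0}, so there would be only one such point.
      have key : ∀ x ∈ τ, x i = 0 → ∃ ω ∈ amin f.support (realVec w), ω i = 0 ∧ x = expPoint ω := by
        intro x hx hxi
        obtain ⟨c, hc, hcs, hc1, -, hcx⟩ := exists_weights_of_mem_faceSet hw0 hx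
        have hsum := hcx i (hall i)
        rw [hxi] at hsum
        have hzero := (Finset.sum_eq_zero_iff_of_nonneg fun ω _ =>
          mul_nonneg (hc ω) (Nat.cast_nonneg (ω i))).1 hsum
        obtain ⟨ω₀, hω₀, hcω₀⟩ : ∃ ω ∈ amin f.support (realVec w), c ω ≠ 0 := by
          by_contra hn
          push Not at hn
          rw [Finset.sum_eq_zero hn] at hc1
          exact zero_ne_one hc1
        have hi0 : ∀ ω ∈ amin f.support (realVec w), c ω ≠ 0 → ω i = 0 := fun ω hω hcω => by
          exact_mod_cast (mul_eq_zero.1 (hzero ω hω)).resolve_left hcω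
        have heq : ∀ ω ∈ amin f.support (realVec w), c ω ≠ 0 → ω = ω₀ := by
          intro ω hω hcω
          by_contra hne
          exact hno2 ω hω ω₀ hω₀ hne (hi0 ω hω hcω) (hi0 ω₀ hω₀ hcω₀)
        have hsingle : ∀ g : (Fin 3 →₀ ℕ) → ℝ,
            ∑ ω ∈ amin f.support (realVec w), c ω * g ω = c ω₀ * g ω₀ := by
          intro g
          refine Finset.sum_eq_single ω₀ (fun ω hω hne => ?_) fun h => absurd hω₀ h
          have : c ω = 0 := by
            by_contra hcω
            exact hne (heq ω hω hcω)
          rw [this, zero_mul]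
        have hc0 : c ω₀ = 1 := by
          have := hsingle fun _ => 1
          simp only [mul_one] at this
          rw [← this, hc1]
        refine ⟨ω₀, hω₀, hi0 ω₀ hω₀ hcω₀, ?_⟩
        ext j
        rw [← hcx j (hall j), hsingle, hc0, one_mul]
        rfl
      obtain ⟨ω, hω, hωi, rfl⟩ := key x hx hxi
      obtain ⟨ω', hω', hωi', rfl⟩ := key y hy hyi
      exact hno2 ω hω ω' hω' (fun h => hxy (by rw [h])) hωi hωi'

end Igusa

namespace Igusa

/-! ### Rays through a vertex on a coordinate axis -/

section Vertex

variable {S : Finset (Fin 3 →₀ ℕ)} {i j l : Fin 3}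

theorem sum_eq_of_ne (hij : i ≠ j) (hil : i ≠ l) (hjl : j ≠ l) (g : Fin 3 → ℝ) :
    ∑ m, g m = g i + g j + g l := by
  have : ∀ i j l : Fin 3, i ≠ j → i ≠ l → j ≠ l → (Finset.univ : Finset (Fin 3)) = {i, j, l} := by
    decide
  rw [this i j l hij hil hjl, Finset.sum_insert (by simp [hij, hil]), Finset.sum_pair hjl, add_assoc]

theorem forall_of_ne (hij : i ≠ j) (hil : i ≠ l) (hjl : j ≠ l) {P : Fin 3 → Prop} (hi : P i)
    (hj : P j) (hl : P l) (m : Fin 3) : P m := by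
  have : ∀ i j l m : Fin 3, i ≠ j → i ≠ l → j ≠ l → m = i ∨ m = j ∨ m = l := by decide
  rcases this i j l m hij hil hjl with rfl | rfl | rfl <;> assumption

theorem faceLE_add_right {x y : Fin 3 → ℝ} {A : Fin 3 →₀ ℕ} (hx : ∀ m, 0 ≤ x m)
    (hy : ∀ m, 0 ≤ y m) (hxA : A ∈ amin S x) (hyA : A ∈ amin S y) : FaceLE S (x + y) y := by
  refine ⟨fun ω hω => ((mem_amin_add_iff hxA hyA).1 hω).2, fun m hm => ?_⟩
  have := hx m
  have := hy m
  simp only [Pi.add_apply] at hm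
  linarith

/-- A ray is extremal: a summand of its generator in the same cone is proportional to it. -/
theorem IsRay.exists_eq_smul {w : Fin 3 → ℕ} (hw : IsRay S w) {x y : Fin 3 → ℝ} {A : Fin 3 →₀ ℕ}
    (hx : ∀ m, 0 ≤ x m) (hy : ∀ m, 0 ≤ y m) (hxA : A ∈ amin S x) (hyA : A ∈ amin S y)
    (h : realVec w = x + y) : ∃ c : ℝ, y = c • realVec w := by
  have hf := faceLE_add_right hx hy hxA hyA
  rw [← h] at hf
  exact hw.2 y ⟨fun ω hω ω' hω' => ip_eq_of_mem_amin (hf.1 hω) (hf.1 hω'), hf.2⟩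

theorem mem_amin_single {A : Fin 3 →₀ ℕ} (hA : A ∈ S) (hAi : A i = 0) {c : ℝ} (hc : 0 ≤ c) :
    A ∈ amin S (Pi.single i c) := by
  refine mem_amin.2 ⟨hA, fun ω _ => ?_⟩
  rw [ip_single, ip_single, hAi]
  simp only [Nat.cast_zero, mul_zero]
  positivity

theorem single_nonneg' {c : ℝ} (hc : 0 ≤ c) (m : Fin 3) : 0 ≤ (Pi.single i c : Fin 3 → ℝ) m := by
  by_cases h : m = i
  · subst h; simpa using hc
  · simp [h]

/-- A ray that dominates another ray coordinatewise is equal to it. -/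
theorem IsRay.eq_of_le (hij : i ≠ j) (hil : i ≠ l) (hjl : j ≠ l) {A : Fin 3 →₀ ℕ} (hAi : A i = 0)
    (hAj : A j = 0) {v w : Fin 3 → ℕ} (hv : IsRay S v) (hw : IsRay S w)
    (hvA : A ∈ amin S (realVec v)) (hvl : 0 < v l) (hwl : 0 < w l)
    (hi : (v i : ℝ) * w l ≤ w i * v l) (hj : (v j : ℝ) * w l ≤ w j * v l) : v = w := by
  have hvl' : (0 : ℝ) < v l := by exact_mod_cast hvl
  have hwl' : (0 : ℝ) < w l := by exact_mod_cast hwl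
  set c : ℝ := w l / v l with hc
  have hcpos : 0 < c := div_pos hwl' hvl'
  have hAS := amin_subset hvA
  have hγi : 0 ≤ w i - c * v i := by
    have : c * v i = v i * w l / v l := by rw [hc]; ring
    rw [this, sub_nonneg, div_le_iff₀ hvl']; exact hi
  have hγj : 0 ≤ w j - c * v j := by
    have : c * v j = v j * w l / v l := by rw [hc]; ring
    rw [this, sub_nonneg, div_le_iff₀ hvl']; exact hj
  -- Scaled to the same l-coordinate, w exceeds v by a non-negative combination of e_i and e_j. The
  -- exponent A is minimal for every summand, so extremality makes v proportional to w.
  have hsum : realVec w = (Pi.single i (w i - c * v i) + Pi.single j (w j - c * v j)) +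
      c • realVec v := by
    ext m
    refine forall_of_ne hij hil hjl (P := fun m => realVec w m =
      ((Pi.single i ((w i : ℝ) - c * v i) + Pi.single j ((w j : ℝ) - c * v j)) +
      c • realVec v : Fin 3 → ℝ) m) ?_ ?_ ?_ m
    · simp [realVec, hij]
    · simp [realVec, hij.symm]
    · simp only [realVec, Pi.add_apply, Pi.single_eq_of_ne hil.symm, Pi.single_eq_of_ne hjl.symm,
        Pi.smul_apply, smul_eq_mul, hc]
      field_simp
      ring
  obtain ⟨d, hd⟩ := hw.exists_eq_smul
    (fun m => add_nonneg (single_nonneg' hγi m) (single_nonneg' hγj m))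
    (fun m => mul_nonneg hcpos.le (realVec_nonneg v m))
    (mem_amin_add (mem_amin_single hAS hAi hγi) (mem_amin_single hAS hAj hγj))
    (mem_amin_smul hcpos.le hvA) hsum
  have hd : c • realVec v = d • realVec w := hd
  refine eq_of_smul_eq hv.1 hw.1 (c := c⁻¹ * d) ?_
  rw [mul_smul, ← hd, smul_smul, inv_mul_cancel₀ hcpos.ne', one_smul]

/-- A ray that lies between two points of the lower boundary of the dual cone of a vertex on which
a common exponent is minimal is a combination of these points. -/
theorem IsRay.eq_add_of_between (hij : i ≠ j) (hil : i ≠ l) (hjl : j ≠ l) {A Q : Fin 3 →₀ ℕ}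
    (hAi : A i = 0) (hQi : 0 < Q i) {w : Fin 3 → ℕ} (hw : IsRay S w)
    (hwA : A ∈ amin S (realVec w)) {x y : Fin 3 → ℝ} (hx : ∀ m, 0 ≤ x m) (hy : ∀ m, 0 ≤ y m)
    (hxA : A ∈ amin S x) (hyA : A ∈ amin S y) (hxQ : Q ∈ amin S x) (hyQ : Q ∈ amin S y)
    (hwl : 0 < w l) (h1 : x j * w l < w j * x l) (h2 : w j * y l ≤ y j * w l)
    (hyl : 0 < y l) (hxl : 0 < x l) :
    ∃ α β : ℝ, 0 ≤ α ∧ 0 < β ∧ realVec w = α • x + β • y := by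
  have hwl' : (0 : ℝ) < w l := by exact_mod_cast hwl
  have hΔ : 0 < x l * y j - x j * y l := by
    have h3 : x j * w l * y l < y j * w l * x l := by nlinarith
    nlinarith
  set Δ := x l * y j - x j * y l with hΔd
  -- Cramer's rule: α x + β y matches w in the coordinates j and l.
  set α := (w l * y j - w j * y l) / Δ with hα
  set β := (x l * w j - x j * w l) / Δ with hβ
  have hα0 : 0 ≤ α := div_nonneg (by linarith) hΔ.le
  have hβ0 : 0 < β := div_pos (by linarith) hΔ
  set z := α • x + β • y with hz
  have hzm : ∀ m, z m = α * x m + β * y m := fun m => by simp [hz]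
  have hzj : z j = w j := by
    rw [hzm, hα, hβ]; field_simp; rw [hΔd]; ring
  have hzl : z l = w l := by
    rw [hzm, hα, hβ]; field_simp; rw [hΔd]; ring
  have hz0 : ∀ m, 0 ≤ z m := fun m => by
    rw [hzm]; exact add_nonneg (mul_nonneg hα0 (hx m)) (mul_nonneg hβ0.le (hy m))
  have hzA : A ∈ amin S z := mem_amin_add (mem_amin_smul hα0 hxA) (mem_amin_smul hβ0.le hyA)
  have hzQ : Q ∈ amin S z := mem_amin_add (mem_amin_smul hα0 hxQ) (mem_amin_smul hβ0.le hyQ)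
  -- A and Q have the same value at z, while Q is not below A at w; as Q i > 0 and A i = 0, this
  -- forces w i ≥ z i. Extremality of w, read in the l-coordinate, then rules out a strict
  -- inequality.
  have hγ : 0 ≤ (w i : ℝ) - z i := by
    have e1 := (mem_amin.1 hwA).2 _ (amin_subset hxQ)
    have e2 := ip_eq_of_mem_amin hzA hzQ
    simp only [ip, sum_eq_of_ne hij hil hjl] at e1 e2
    rw [hzj, hzl] at e2
    simp only [realVec, hAi, Nat.cast_zero, mul_zero, zero_add] at e1 e2
    have hQ : (0 : ℝ) < Q i := by exact_mod_cast hQi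
    have : 0 ≤ ((w i : ℝ) - z i) * Q i := by nlinarith
    exact nonneg_of_mul_nonneg_left this hQ
  have hsum : realVec w = z + Pi.single i ((w i : ℝ) - z i) := by
    ext m
    refine forall_of_ne hij hil hjl (P := fun m => realVec w m =
      (z + Pi.single i ((w i : ℝ) - z i) : Fin 3 → ℝ) m) ?_ ?_ ?_ m
    · simp [realVec]
    · simp [realVec, hij.symm, hzj]
    · simp [realVec, hil.symm, hzl]
  obtain ⟨c, hc⟩ := hw.exists_eq_smul hz0 (single_nonneg' hγ) hzA
    (mem_amin_single (amin_subset hxA) hAi hγ) hsum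
  have hcl := congrFun hc l
  simp only [Pi.single_eq_of_ne hil.symm, Pi.smul_apply, smul_eq_mul, realVec] at hcl
  have hc0 : c = 0 := (mul_eq_zero.1 hcl.symm).resolve_right hwl'.ne'
  rw [hc0, zero_smul] at hc
  exact ⟨α, β, hα0, hβ0, by rw [hsum, hc, add_zero]⟩

/-- A `B₁`-facet for `i` through a vertex on the `l`-axis minimizes the slope `k_j / k_l`. -/
theorem B1Data.slope_le (hij : i ≠ j) (hil : i ≠ l) (hjl : j ≠ l) {A : Fin 3 →₀ ℕ}
    (hAi : A i = 0) (hAj : A j = 0) {v : Fin 3 → ℕ} (hB : B1Data S v i)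
    (hvA : A ∈ amin S (realVec v)) (hvl : 0 < v l) {k : Fin 3 → ℝ} (hk : ∀ m, 0 ≤ k m)
    (hkA : A ∈ amin S k) : (v j : ℝ) * k l ≤ k j * v l := by
  have hvl' : (0 : ℝ) < v l := by exact_mod_cast hvl
  -- A second exponent B in {x_i = 0} gives v_j B_j = v_l (A_l - B_l), whereas minimality of A at k
  -- gives k_j B_j ≥ k_l (A_l - B_l). Here B_j > 0, since otherwise B = A.
  have key : ∀ B ∈ amin S (realVec v), B ≠ A → B i = 0 → (v j : ℝ) * k l ≤ k j * v l := by
    intro B hB hBA hBi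
    have e1 := ip_eq_of_mem_amin hB hvA
    have e2 := (mem_amin.1 hkA).2 B (amin_subset hB)
    simp only [ip, sum_eq_of_ne hij hil hjl, hAi, hAj, hBi, Nat.cast_zero, mul_zero, zero_add,
      add_zero, realVec] at e1 e2
    have hBj : 0 < B j := by
      rcases Nat.eq_zero_or_pos (B j) with h | h
      · exfalso
        apply hBA
        rw [h] at e1
        simp only [Nat.cast_zero, mul_zero, zero_add] at e1
        have hl : B l = A l := by exact_mod_cast mul_left_cancel₀ hvl'.ne' e1
        ext m
        exact forall_of_ne hij hil hjl (P := fun m => B m = A m) (by rw [hBi, hAi])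
          (by rw [h, hAj]) hl m
      · exact h
    have hBj' : (0 : ℝ) < B j := by exact_mod_cast hBj
    have : (v j : ℝ) * k l * B j ≤ k j * v l * B j := by nlinarith [hk l]
    exact le_of_mul_le_mul_right this hBj'
  rcases hB.base with ⟨m, hmi, hm⟩ | ⟨ω, hω, ω', hω', hne, hωi, hωi'⟩
  · have hmj : m = j := by
      have h : ∀ i j l m : Fin 3, i ≠ j → i ≠ l → j ≠ l → m = i ∨ m = j ∨ m = l := by decide
      rcases h i j l m hij hil hjl with rfl | rfl | rfl
      · exact absurd rfl hmi
      · rfl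
      · exact absurd hm hvl.ne'
    rw [← hmj, hm]
    simp only [Nat.cast_zero, zero_mul]
    exact mul_nonneg (hk _) hvl'.le
  · by_cases h : ω = A
    · exact key ω' hω' (fun h' => hne (h.trans h'.symm)) hωi'
    · exact key ω hω h hωi

/-- The slope is strictly larger on all other rays. -/
theorem B1Data.slope_lt (hij : i ≠ j) (hil : i ≠ l) (hjl : j ≠ l) {A : Fin 3 →₀ ℕ}
    (hAi : A i = 0) (hAj : A j = 0) {v : Fin 3 → ℕ} (hv : IsRay S v) (hB : B1Data S v i)
    (hvA : A ∈ amin S (realVec v)) (hvl : 0 < v l) {w : Fin 3 → ℕ} (hw : IsRay S w)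
    (hwA : A ∈ amin S (realVec w)) (hwl : 0 < w l) (hne : v ≠ w) :
    (v j : ℝ) * w l < w j * v l := by
  refine lt_of_le_of_ne (hB.slope_le hij hil hjl hAi hAj hvA hvl (realVec_nonneg w) hwA) fun h => ?_
  have h : (v j : ℝ) * w l = w j * v l := h
  -- If the slopes agree, the apex, at height one in direction i, shows that v_i / v_l is at most
  -- w_i / w_l as well. Then w dominates v and equals it.
  refine hne (hv.eq_of_le hij hil hjl hAi hAj hw hvA hvl hwl ?_ h.le)
  obtain ⟨Q, hQ, hQi⟩ := hB.apex
  have e1 := ip_eq_of_mem_amin hQ hvA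
  have e2 := (mem_amin.1 hwA).2 Q (amin_subset hQ)
  have hvl' : (0 : ℝ) < v l := by exact_mod_cast hvl
  have hwl' : (0 : ℝ) < w l := by exact_mod_cast hwl
  simp only [ip, sum_eq_of_ne hij hil hjl, hAi, hAj, hQi, Nat.cast_zero, mul_zero, zero_add,
    realVec, Nat.cast_one, mul_one] at e1 e2
  have e3 := mul_le_mul_of_nonneg_right e2 hvl'.le
  have e4 : ((v i : ℝ) + v j * Q j + v l * Q l) * w l = v l * A l * w l := by rw [e1]
  have e5 : (v j : ℝ) * w l * Q j = w j * v l * Q j := by rw [h]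
  nlinarith

/-- There is at most one `B₁`-facet for `i` through a vertex on another axis. -/
theorem B1Data.eq_of_mem (hij : i ≠ j) (hil : i ≠ l) (hjl : j ≠ l) {A : Fin 3 →₀ ℕ}
    (hAi : A i = 0) (hAj : A j = 0) {v w : Fin 3 → ℕ} (hv : IsRay S v) (hw : IsRay S w)
    (hBv : B1Data S v i) (hBw : B1Data S w i) (hvA : A ∈ amin S (realVec v))
    (hwA : A ∈ amin S (realVec w)) (hvl : 0 < v l) (hwl : 0 < w l) : v = w := by
  by_contra hne
  have h1 := hBv.slope_lt hij hil hjl hAi hAj hv hvA hvl hw hwA hwl hne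
  have h2 := hBw.slope_lt hij hil hjl hAi hAj hw hwA hwl hv hvA hvl (Ne.symm hne)
  linarith

/-- Below the face of a `B₁`-facet for `i` the slope is smaller than on all other rays. -/
theorem B1Data.slope_lt_of_amin_subset (hij : i ≠ j) (hil : i ≠ l) (hjl : j ≠ l)
    {A Q : Fin 3 →₀ ℕ} (hAi : A i = 0) (hAj : A j = 0) (hQi : 0 < Q i) {v : Fin 3 → ℕ}
    (hv : IsRay S v) (hB : B1Data S v i) (hvl : 0 < v l) {k : Fin 3 → ℝ} (hk : ∀ m, 0 < k m)
    (hkA : A ∈ amin S k) (hkQ : Q ∈ amin S k) (hkv : amin S k ⊆ amin S (realVec v))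
    {w : Fin 3 → ℕ} (hw : IsRay S w) (hwA : A ∈ amin S (realVec w)) (hwl : 0 < w l) (hne : v ≠ w) :
    k j * w l < w j * k l := by
  by_contra hle
  push Not at hle
  have h1 := hB.slope_lt hij hil hjl hAi hAj hv (hkv hkA) hvl hw hwA hwl hne
  have hk0 : ∀ m, 0 ≤ k m := fun m => (hk m).le
  -- Otherwise w lies in slope between v and k, both of which have A and Q as minimal exponents. By
  -- extremality w is then proportional to k, and its face lies in that of v.
  obtain ⟨α, β, hα, hβ, hw'⟩ := hw.eq_add_of_between hij hil hjl hAi hQi hwA (realVec_nonneg v)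
    hk0 (hkv hkA) hkA (hkv hkQ) hkQ hwl h1 hle (hk l) (by simpa [realVec] using hvl)
  obtain ⟨c, hc⟩ := hw.exists_eq_smul (fun m => mul_nonneg hα (realVec_nonneg v m))
    (fun m => mul_nonneg hβ.le (hk0 m)) (mem_amin_smul hα (hkv hkA)) (mem_amin_smul hβ.le hkA) hw'
  have hc : β • k = c • realVec w := hc
  have hcm : ∀ m, β * k m = c * w m := fun m => congrFun hc m
  have hcpos : 0 < c := by
    have h2 : 0 < c * w l := by rw [← hcm]; exact mul_pos hβ (hk l)
    exact pos_of_mul_pos_left h2 (Nat.cast_nonneg _)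
  refine hne (hv.eq_of_faceLE hw ⟨?_, fun m hm => ?_⟩)
  · rw [← amin_smul hcpos, ← hc, amin_smul hβ]; exact hkv
  · have h3 := hcm m
    have hm : (w m : ℝ) = 0 := hm
    rw [hm, mul_zero] at h3
    exact absurd h3 (mul_pos hβ (hk m)).ne'

end Vertex

end Igusa

namespace Igusa

/-! ### Cancelling fibers in coordinate directions, and descent along them. -/

section Removal

variable {S : Finset (Fin 3 →₀ ℕ)} {C : Set (Fin 3 → ℕ)} {iv : (Fin 3 → ℕ) → Fin 3}
  {i j l : Fin 3}

/-- `C` is a set of rays of the normal fan of `S` that are `B₁` for an assigned variable, such that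
two of them are `B₁` for a same variable or have at most one exponent in common. -/
structure B1Config (S : Finset (Fin 3 →₀ ℕ)) (C : Set (Fin 3 → ℕ))
    (iv : (Fin 3 → ℕ) → Fin 3) : Prop where
  ray : ∀ v ∈ C, IsRay S v
  b1 : ∀ v ∈ C, B1Data S v (iv v)
  pos : ∀ v ∈ C, ∀ ω ∈ amin S (realVec v), ip (realVec v) ω ≠ 0
  pair : ∀ v ∈ C, ∀ v' ∈ C, (∃ i, B1Data S v i ∧ B1Data S v' i) ∨
    ∀ ω ∈ amin S (realVec v), ω ∈ amin S (realVec v') →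
      ∀ ω' ∈ amin S (realVec v), ω' ∈ amin S (realVec v') → ω = ω'

/-- `k` is the starting point of a fiber in the direction `e_i` on which the zeta sum cancels. -/
def IsBase (S : Finset (Fin 3 →₀ ℕ)) (C : Set (Fin 3 → ℕ)) (iv : (Fin 3 → ℕ) → Fin 3) (i : Fin 3)
    (k : Fin 3 → ℕ) : Prop :=
  (∀ m, 1 ≤ k m) ∧ ∃ v ∈ C, iv v = i ∧ amin S (realVec k) ⊆ amin S (realVec v) ∧
    (∃ ω ∈ amin S (realVec k), ω i = 0) ∧ ∃ ω ∈ amin S (realVec k), ω i = 1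

/-- `k` lies on a fiber in the direction `e_i` on which the zeta sum cancels. -/
def IsRemoved (S : Finset (Fin 3 →₀ ℕ)) (C : Set (Fin 3 → ℕ)) (iv : (Fin 3 → ℕ) → Fin 3)
    (i : Fin 3) (k : Fin 3 → ℕ) : Prop :=
  ∃ k' t, IsBase S C iv i k' ∧ k = k' + Pi.single i t

/-- `k'` is the last point of the orthant in the direction `-e_i` from `k` whose face contains that
of `k`. -/
def IsDescent (S : Finset (Fin 3 →₀ ℕ)) (i : Fin 3) (k k' : Fin 3 → ℝ) : Prop :=
  (∀ m, 0 ≤ k' m) ∧ (∃ t, 0 < t ∧ k = k' + Pi.single i t) ∧ (∃ ω ∈ amin S k', ω i = 0) ∧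
    ((∃ ω ∈ amin S k', 0 < ω i) ∨ k' i = 0)

/-- Adding t e_i raises the value of ω by t ω_i, so exactly the minimal exponents in {x_i = 0}
survive when there is one. -/
theorem mem_amin_add_single {k : Fin 3 → ℝ} {t : ℝ} (ht : 0 < t) (h : ∃ ω ∈ amin S k, ω i = 0)
    {ω : Fin 3 →₀ ℕ} : ω ∈ amin S (k + Pi.single i t) ↔ ω ∈ amin S k ∧ ω i = 0 := by
  obtain ⟨A, hA, hAi⟩ := h
  have hA' := mem_amin_single (amin_subset hA) hAi ht.le
  rw [mem_amin_add_iff hA hA']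
  refine and_congr_right fun hω => ⟨fun h => ?_, fun h => mem_amin_single (amin_subset hω) h ht.le⟩
  have := ip_eq_of_mem_amin h hA'
  rw [ip_single, ip_single, hAi] at this
  simpa [ht.ne'] using this

theorem amin_add_single_nat {k : Fin 3 → ℕ} {t : ℕ} (ht : 0 < t)
    (h : ∃ ω ∈ amin S (realVec k), ω i = 0) {ω : Fin 3 →₀ ℕ} :
    ω ∈ amin S (realVec (k + Pi.single i t)) ↔ ω ∈ amin S (realVec k) ∧ ω i = 0 := by
  rw [realVec_add, realVec_single]
  exact mem_amin_add_single (by exact_mod_cast ht) h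

/-- All minimal exponents have x_i = 0, so -e_i is a tangent direction. Moving along it stops when
an exponent with x_i > 0 becomes minimal or the i-th coordinate reaches 0. -/
theorem exists_isDescent (hS : S.Nonempty) {k : Fin 3 → ℝ} (hk : ∀ m, 0 < k m)
    (h : ∀ ω ∈ amin S k, ω i = 0) : ∃ k', IsDescent S i k k' := by
  obtain ⟨t, ht, h0, h1, h2⟩ := exists_faceLE_of_tangent (S := S) (k := k)
    (u := -Pi.single i 1) hS (fun m => (hk m).le)
    ⟨fun ω hω ω' hω' => by rw [ip_neg, ip_neg, ip_single, ip_single, h ω hω, h ω' hω'],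
      fun m hm => absurd hm (hk m).ne'⟩ ⟨i, by simp⟩
  have hadd : k = (k + t • -Pi.single i 1) + Pi.single i t := by
    ext m
    by_cases hm : m = i
    · subst hm; simp
    · simp [hm]
  obtain ⟨A, hA⟩ := amin_nonempty hS k
  refine ⟨_, h0, ⟨t, ht, hadd⟩, ⟨A, h1.1 hA, h A hA⟩, ?_⟩
  by_contra hne
  push Not at hne
  refine h2 ⟨fun ω hω => ?_, fun m hm => ?_⟩
  · rw [hadd, mem_amin_add_single ht ⟨A, h1.1 hA, h A hA⟩]
    exact ⟨hω, Nat.le_zero.1 (hne.1 ω hω)⟩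
  · by_cases hmi : m = i
    · subst hmi; exact absurd hm hne.2
    · simpa [hmi] using hm

theorem IsDescent.mem_amin {k k' : Fin 3 → ℝ} (h : IsDescent S i k k') {ω : Fin 3 →₀ ℕ} :
    ω ∈ amin S k ↔ ω ∈ amin S k' ∧ ω i = 0 := by
  obtain ⟨_, ⟨t, ht, rfl⟩, h1, _⟩ := h
  exact mem_amin_add_single ht h1

theorem IsDescent.apply_of_ne {k k' : Fin 3 → ℝ} (h : IsDescent S i k k') {m : Fin 3} (hm : m ≠ i) :
    k' m = k m := by
  obtain ⟨_, ⟨t, ht, rfl⟩, _⟩ := h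
  simp [hm]

/-- Strictly above a descent point all minimal exponents have x_i = 0 and the i-th coordinate is
positive, so a second one cannot occur there. -/
theorem IsDescent.unique {k k₁ k₂ : Fin 3 → ℝ} (h₁ : IsDescent S i k k₁)
    (h₂ : IsDescent S i k k₂) : k₁ = k₂ := by
  have key : ∀ {k₁ k₂ : Fin 3 → ℝ}, IsDescent S i k k₁ → IsDescent S i k k₂ → k₁ i ≤ k₂ i := by
    rintro k₁ k₂ h₁ ⟨h0, ⟨t, ht, h1⟩, h2, h3⟩
    by_contra! hlt
    obtain ⟨-, -, -, h6⟩ := id h₁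
    have hadd : k₁ = k₂ + Pi.single i (k₁ i - k₂ i) := by
      ext m
      by_cases hm : m = i
      · subst hm; simp
      · rw [h₁.apply_of_ne hm, h1]; simp [hm]
    rcases h6 with ⟨ω, hω, hωi⟩ | h6
    · rw [hadd, mem_amin_add_single (sub_pos.2 hlt) h2] at hω
      exact hωi.ne' hω.2
    · have := h0 i
      linarith
  ext m
  by_cases hm : m = i
  · subst hm; exact le_antisymm (key h₁ h₂) (key h₂ h₁)
  · rw [h₁.apply_of_ne hm, h₂.apply_of_ne hm]

/-- Descent commutes with the addition of vectors whose face contains that of the descent point, and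
the type of that point does not change. This gives stability of the classes in
`exists_isConical_partition`. -/
theorem IsDescent.add {k k' w : Fin 3 → ℝ} (h : IsDescent S i k k') (hw : ∀ m, 0 ≤ w m)
    (hkw : FaceLE S k' w) : IsDescent S i (k + w) (k' + w) ∧ amin S (k' + w) = amin S k' ∧
      ∀ m, (k' + w) m = 0 ↔ k' m = 0 := by
  obtain ⟨h0, ⟨t, ht, rfl⟩, ⟨A, hA, hAi⟩, h2⟩ := h
  have h3 : amin S (k' + w) = amin S k' := by
    ext ω
    rw [mem_amin_add_iff hA (hkw.1 hA)]
    exact ⟨fun h => h.1, fun h => ⟨h, hkw.1 h⟩⟩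
  have h4 : ∀ m, (k' + w) m = 0 ↔ k' m = 0 := fun m => by
    refine ⟨fun h => ?_, fun h => ?_⟩
    · have h5 : k' m + w m = 0 := h
      linarith [h0 m, hw m]
    · have h5 := hkw.2 m h
      simp [h, h5]
  refine ⟨⟨fun m => add_nonneg (h0 m) (hw m), ⟨t, ht, by abel⟩, ?_, ?_⟩, h3, h4⟩
  · rw [h3]; exact ⟨A, hA, hAi⟩
  · rw [h3, h4]; exact h2

/-- Since v i ≠ 0, the descent stops because some Q with Q i = 1 becomes minimal, next to an A with
A i = 0. The length of the descent is k·Q - k·A, an integer because the apex has height one, so the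
descent point is integral and starts a cancelling fiber. -/
theorem IsDescent.isRemoved (hC : B1Config S C iv) {k : Fin 3 → ℕ} {k' : Fin 3 → ℝ} (hk : ∀ m, 1 ≤ k m)
    (h : IsDescent S i (realVec k) k') {v : Fin 3 → ℕ} (hv : v ∈ C) (hvi : iv v = i)
    (hkv : FaceLE S k' (realVec v)) : IsRemoved S C iv i k := by
  obtain ⟨h0, ⟨t, ht, hadd⟩, ⟨A, hA, hAi⟩, h2⟩ := h
  have hB := hvi ▸ hC.b1 v hv
  have hk'i : k' i ≠ 0 := fun h3 => hB.pos (by simpa [realVec] using hkv.2 i h3)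
  obtain ⟨Q, hQ, hQi⟩ := h2.resolve_right hk'i
  have hQ1 : Q i = 1 := le_antisymm (hB.le_one Q (hkv.1 hQ)) hQi
  have e1 := ip_eq_of_mem_amin hQ hA
  have e2 : ip (realVec k) Q = ip (realVec k) A + t := by
    rw [hadd, ip_add, ip_add, ip_single, ip_single, e1, hAi, hQ1]; simp
  have hip : ∀ ω, ip (realVec k) ω = ((∑ m, k m * ω m : ℕ) : ℝ) := fun ω => by
    simp [ip, realVec]
  rw [hip, hip] at e2
  obtain ⟨n, hn⟩ : ∃ n : ℕ, t = n := by
    refine ⟨(∑ m, k m * Q m) - ∑ m, k m * A m, ?_⟩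
    rw [Nat.cast_sub]
    · linarith
    · have : ((∑ m, k m * A m : ℕ) : ℝ) ≤ ((∑ m, k m * Q m : ℕ) : ℝ) := by linarith
      exact_mod_cast this
  subst hn
  have hki : (k i : ℝ) = k' i + n := by
    have := congrFun hadd i
    simpa [realVec] using this
  have hlt : n < k i := by
    have h3 : (n : ℝ) < k i := by
      rw [hki]; linarith [lt_of_le_of_ne (h0 i) hk'i.symm]
    exact_mod_cast h3
  have hk' : k' = realVec (fun m => if m = i then k i - n else k m) := by
    ext m
    by_cases hm : m = i
    · subst hm
      simp only [realVec, if_true]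
      rw [Nat.cast_sub hlt.le]; linarith
    · have := congrFun hadd m
      simp only [realVec, hm, if_false] at this ⊢
      simpa [hm] using this.symm
  refine ⟨fun m => if m = i then k i - n else k m, n, ⟨fun m => ?_, v, hv, hvi, ?_, ?_, ?_⟩, ?_⟩
  · by_cases hm : m = i
    · simp only [hm, if_true]; omega
    · simpa only [hm, if_false] using hk m
  · rw [← hk']; exact hkv.1
  · rw [← hk']; exact ⟨A, hA, hAi⟩
  · rw [← hk']; exact ⟨Q, hQ, hQ1⟩
  · ext m
    by_cases hm : m = i
    · subst hm; simp; omega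
    · simp [hm]

theorem IsBase.isRemoved {k : Fin 3 → ℕ} (h : IsBase S C iv i k) : IsRemoved S C iv i k :=
  ⟨k, 0, h, by simp⟩

theorem IsBase.amin_add {k : Fin 3 → ℕ} (h : IsBase S C iv i k) {t : ℕ} (ht : 0 < t)
    {ω : Fin 3 →₀ ℕ} : ω ∈ amin S (realVec (k + Pi.single i t)) ↔
      ω ∈ amin S (realVec k) ∧ ω i = 0 := by
  obtain ⟨_, v, _, _, _, h1, _⟩ := h
  exact amin_add_single_nat ht h1

theorem IsBase.amin_add_subset {k : Fin 3 → ℕ} (h : IsBase S C iv i k) (t : ℕ) :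
    amin S (realVec (k + Pi.single i t)) ⊆ amin S (realVec k) := by
  rcases Nat.eq_zero_or_pos t with rfl | ht
  · simp
  · exact fun ω hω => ((h.amin_add ht).1 hω).1

/-- Beyond the start of a fiber no exponent with x_i = 1 is minimal any more, so two fibers in the
same direction are equal or disjoint. -/
theorem IsBase.unique {k k' : Fin 3 → ℕ} (h : IsBase S C iv i k) (h' : IsBase S C iv i k')
    {t t' : ℕ} (e : k + Pi.single i t = k' + Pi.single i t') : k = k' ∧ t = t' := by
  have key : ∀ {k k' : Fin 3 → ℕ} {t t' : ℕ}, IsBase S C iv i k → IsBase S C iv i k' →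
      k + Pi.single i t = k' + Pi.single i t' → t ≤ t' := by
    intro k k' t t' h h' e
    by_contra! hlt
    have hk' : k' = k + Pi.single i (t - t') := by
      ext m
      have := congrFun e m
      by_cases hm : m = i
      · subst hm
        simp only [Pi.add_apply, Pi.single_eq_same] at this ⊢
        omega
      · simpa [hm] using this.symm
    obtain ⟨_, v, _, _, _, _, ω, hω, hωi⟩ := h'
    rw [hk', h.amin_add (Nat.sub_pos_of_lt hlt)] at hω
    omega
  have ht := le_antisymm (key h h' e) (key h' h e.symm)
  subst ht
  exact ⟨add_right_cancel e, rfl⟩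

end Removal

end Igusa

/-! ### Peeling, corners, and the overlap of removed sets. -/

namespace Igusa

/-- A function of the faces that is multiplied by a constant when the apex of a face is removed. -/
def IsPeeling (S : Finset (Fin 3 →₀ ℕ)) (c : ℂ) (L : Finset (Fin 3 →₀ ℕ) → ℂ) : Prop :=
  L ∅ = 0 ∧ ∀ k : Fin 3 → ℕ, (∀ m, 1 ≤ k m) → ∀ i, ∀ Q ∈ amin S (realVec k), Q i = 1 →
    (∀ ω ∈ amin S (realVec k), ω ≠ Q → ω i = 0) →
      L (amin S (realVec k)) = c * L ((amin S (realVec k)).filter fun ω => ω i = 0)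

section Overlap

variable {S : Finset (Fin 3 →₀ ℕ)} {C : Set (Fin 3 → ℕ)} {iv : (Fin 3 → ℕ) → Fin 3}
  {i j l : Fin 3} {c : ℂ} {L : Finset (Fin 3 →₀ ℕ) → ℂ}

/-- Carries slope inequalities, written as linear inequalities, from the rays over to the points
they span. -/
theorem coneSpan_nonneg {V : Set (Fin 3 → ℕ)} (a : Fin 3 → ℝ)
    (h : ∀ w ∈ V, 0 ≤ ∑ m, a m * (w m : ℝ)) {x : Fin 3 → ℝ} (hx : x ∈ coneSpan V) :
    0 ≤ ∑ m, a m * x m := by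
  induction hx using Submodule.span_induction with
  | mem x hx =>
    obtain ⟨w, hw, rfl⟩ := hx
    exact h w hw
  | zero => simp
  | add x y _ _ hx hy =>
    simp only [Pi.add_apply, mul_add, Finset.sum_add_distrib]
    exact add_nonneg hx hy
  | smul r x _ hx =>
    have : ∑ m, a m * (r • x) m = r * ∑ m, a m * x m := by
      rw [Finset.mul_sum]
      exact Finset.sum_congr rfl fun m _ => by
        show a m * ((r : ℝ) * x m) = _
        ring
    rw [this]
    exact mul_nonneg r.2 hx

/-- If `L` does not vanish on a face of a `B₁`-facet for `i`, then neither does it on the part of the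
face in `{x_i = 0}`. -/
theorem IsPeeling.filter_ne_zero (hC : B1Config S C iv) (hL : IsPeeling S c L) {k : Fin 3 → ℕ}
    (hk : ∀ m, 1 ≤ k m) (hLk : L (amin S (realVec k)) ≠ 0) {v : Fin 3 → ℕ} (hv : v ∈ C)
    (hkv : amin S (realVec k) ⊆ amin S (realVec v)) :
    (∃ ω ∈ amin S (realVec k), ω (iv v) = 0) ∧
      L (amin S (realVec (k + Pi.single (iv v) 1))) ≠ 0 := by
  have hB := hC.b1 v hv
  have hF : L ((amin S (realVec k)).filter fun ω => ω (iv v) = 0) ≠ 0 := by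
    by_cases h : ∃ Q ∈ amin S (realVec k), Q (iv v) = 1
    · obtain ⟨Q, hQ, hQi⟩ := h
      have := hL.2 k hk (iv v) Q hQ hQi fun ω hω hne => by
        by_contra h0
        have h1 := hB.le_one ω (hkv hω)
        refine hne (hB.unique (realVec k) (fun m => Nat.cast_pos.2 (hk m)) ω (hkv hω) Q (hkv hQ)
          (by omega) hQi (ip_eq_of_mem_amin hω hQ))
      rw [this] at hLk
      exact right_ne_zero_of_mul hLk
    · push Not at h
      rwa [Finset.filter_true_of_mem fun ω hω => ?_]
      have h1 := hB.le_one ω (hkv hω)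
      have h2 := h ω hω
      omega
  have hne : ∃ ω ∈ amin S (realVec k), ω (iv v) = 0 := by
    by_contra h
    push Not at h
    rw [Finset.filter_false_of_mem fun ω hω => h ω hω] at hF
    exact hF hL.1
  refine ⟨hne, ?_⟩
  convert hF using 2
  ext ω
  rw [amin_add_single_nat one_pos hne, Finset.mem_filter]

theorem one_le_add {k w : Fin 3 → ℕ} (hk : ∀ m, 1 ≤ k m) (m : Fin 3) : 1 ≤ (k + w) m :=
  (hk m).trans (Nat.le_add_right _ _)

/-- A common vertex of two facets of `C` that are assigned to different variables `i` and `j`. -/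
structure Corner (S : Finset (Fin 3 →₀ ℕ)) (C : Set (Fin 3 → ℕ)) (iv : (Fin 3 → ℕ) → Fin 3)
    (i j l : Fin 3) (A : Fin 3 →₀ ℕ) (v v' : Fin 3 → ℕ) : Prop where
  hij : i ≠ j
  hil : i ≠ l
  hjl : j ≠ l
  config : B1Config S C iv
  hAi : A i = 0
  hAj : A j = 0
  hAl : 2 ≤ A l
  hv : v ∈ C
  hv' : v' ∈ C
  hvi : iv v = i
  hvj : iv v' = j
  hvA : A ∈ amin S (realVec v)
  hvA' : A ∈ amin S (realVec v')

variable {A : Fin 3 →₀ ℕ} {v v' : Fin 3 → ℕ}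

theorem Corner.symm (h : Corner S C iv i j l A v v') : Corner S C iv j i l A v' v :=
  ⟨h.hij.symm, h.hjl, h.hil, h.config, h.hAj, h.hAi, h.hAl, h.hv', h.hv, h.hvj, h.hvi, h.hvA',
    h.hvA⟩

/-- The non-zero number m(v) = v·A equals v_l A_l. -/
theorem pos_of_axis (hC : B1Config S C iv) (hij : i ≠ j) (hil : i ≠ l) (hjl : j ≠ l)
    (hAi : A i = 0) (hAj : A j = 0) (hv : v ∈ C) (hvA : A ∈ amin S (realVec v)) :
    0 < v l ∧ 0 < A l := by
  have := hC.pos v hv A hvA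
  rw [ip, sum_eq_of_ne hij hil hjl, hAi, hAj] at this
  simp only [Nat.cast_zero, mul_zero, zero_add, realVec] at this
  constructor
  · rcases Nat.eq_zero_or_pos (v l) with h | h
    · simp [h] at this
    · exact h
  · rcases Nat.eq_zero_or_pos (A l) with h | h
    · simp [h] at this
    · exact h

theorem Corner.pos (h : Corner S C iv i j l A v v') : 0 < v l :=
  (pos_of_axis h.config h.hij h.hil h.hjl h.hAi h.hAj h.hv h.hvA).1

/-- A_l ≥ 2 excludes facets that are B₁ for l, and for each of i and j there is at most one through
A by `B1Data.eq_of_mem`. -/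
theorem Corner.eq_or_eq (h : Corner S C iv i j l A v v') {w : Fin 3 → ℕ} (hw : w ∈ C)
    (hwA : A ∈ amin S (realVec w)) : w = v ∨ w = v' := by
  have hC := h.config
  have hwl := (pos_of_axis hC h.hij h.hil h.hjl h.hAi h.hAj hw hwA).1
  have hB := hC.b1 w hw
  have hBv := hC.b1 v h.hv
  have hBv' := hC.b1 v' h.hv'
  rw [h.hvi] at hBv
  rw [h.hvj] at hBv'
  have : ∀ m, m = i ∨ m = j ∨ m = l :=
    forall_of_ne h.hij h.hil h.hjl (by simp) (by simp) (by simp)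
  rcases this (iv w) with e | e | e
  · rw [e] at hB
    exact .inl (hB.eq_of_mem h.hij h.hil h.hjl h.hAi h.hAj (hC.ray w hw) (hC.ray v h.hv) hBv hwA
      h.hvA hwl h.pos)
  · rw [e] at hB
    exact .inr (hB.eq_of_mem h.hij.symm h.hjl h.hil h.hAj h.hAi (hC.ray w hw) (hC.ray v' h.hv')
      hBv' hwA h.hvA' hwl h.symm.pos)
  · rw [e] at hB
    have h1 := hB.le_one A hwA
    have h2 := h.hAl
    omega

theorem Corner.ne (h : Corner S C iv i j l A v v') : v ≠ v' := fun e =>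
  h.hij (by rw [← h.hvi, ← h.hvj, e])

theorem Corner.b1 (h : Corner S C iv i j l A v v') : B1Data S v i := h.hvi ▸ h.config.b1 v h.hv

theorem Corner.ray (h : Corner S C iv i j l A v v') : IsRay S v := h.config.ray v h.hv

/-- The two facets cannot be B₁ for a common variable: for i or j they would coincide, and l is
excluded by A_l ≥ 2. So the hypothesis that facets share at most one point applies. -/
theorem Corner.eq_of_mem (h : Corner S C iv i j l A v v') {ω : Fin 3 →₀ ℕ}
    (hω : ω ∈ amin S (realVec v)) (hω' : ω ∈ amin S (realVec v')) : ω = A := by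
  rcases h.config.pair v h.hv v' h.hv' with ⟨m, hm, hm'⟩ | hs
  · exfalso
    refine forall_of_ne h.hij h.hil h.hjl (P := fun m => B1Data S v m → B1Data S v' m → False)
      ?_ ?_ ?_ m hm hm'
    · exact fun h1 h2 => h.ne (h1.eq_of_mem h.hij h.hil h.hjl h.hAi h.hAj h.ray h.symm.ray h2
        h.hvA h.hvA' h.pos h.symm.pos)
    · exact fun h1 h2 => h.ne (h1.eq_of_mem h.hij.symm h.hjl h.hil h.hAj h.hAi h.ray h.symm.ray h2
        h.hvA h.hvA' h.pos h.symm.pos)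
    · intro h1 _
      have h1 := h1.le_one A h.hvA
      have h2 := h.hAl
      omega
  · exact hs ω hω hω' A h.hvA h.hvA'

/-- A face on which `L` does not vanish and that is contained in two facets of `C` assigned to
different variables is a vertex on the remaining axis. -/
theorem exists_corner (hC : B1Config S C iv) (hL : IsPeeling S c L) {k : Fin 3 → ℕ}
    (hk : ∀ m, 1 ≤ k m) (hLk : L (amin S (realVec k)) ≠ 0) (hv : v ∈ C) (hv' : v' ∈ C)
    (hkv : amin S (realVec k) ⊆ amin S (realVec v))
    (hkv' : amin S (realVec k) ⊆ amin S (realVec v')) (hne : iv v ≠ iv v') :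
    ∃ l A, Corner S C iv (iv v) (iv v') l A v v' ∧ amin S (realVec k) = {A} := by
  obtain ⟨l, hil, hjl⟩ : ∃ l, iv v ≠ l ∧ iv v' ≠ l := by
    have : ∀ i j : Fin 3, ∃ l, i ≠ l ∧ j ≠ l := by decide
    exact this _ _
  obtain ⟨h1, hL1⟩ := hL.filter_ne_zero hC hk hLk hv hkv
  -- Adding e_i and then e_j cuts the face down to its part on the l-axis while L stays non-zero, so
  -- that part is not empty.
  set k₁ := k + Pi.single (iv v) 1 with hk₁
  have hs1 : amin S (realVec k₁) ⊆ amin S (realVec k) := fun ω hω =>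
    ((amin_add_single_nat one_pos h1).1 hω).1
  obtain ⟨h2, hL2⟩ := hL.filter_ne_zero hC (one_le_add hk) hL1 hv' (hs1.trans hkv')
  set k₂ := k₁ + Pi.single (iv v') 1 with hk₂
  have hmem : ∀ ω ∈ amin S (realVec k₂), ω ∈ amin S (realVec k) ∧ ω (iv v) = 0 ∧ ω (iv v') = 0 := by
    intro ω hω
    have h3 := (amin_add_single_nat one_pos h2).1 hω
    have h4 := (amin_add_single_nat one_pos h1).1 h3.1
    exact ⟨h4.1, h4.2, h3.2⟩
  obtain ⟨A, hA⟩ : (amin S (realVec k₂)).Nonempty := by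
    rw [Finset.nonempty_iff_ne_empty]
    intro h
    rw [h] at hL2
    exact hL2 hL.1
  obtain ⟨hAk, hAi, hAj⟩ := hmem A hA
  have hpos := pos_of_axis hC hne hil hjl hAi hAj hv (hkv hAk)
  have heq : ∀ ω ∈ amin S (realVec k₂), ω = A := by
    intro ω hω
    obtain ⟨h3, h4, h5⟩ := hmem ω hω
    have e := ip_eq_of_mem_amin (hkv h3) (hkv hAk)
    rw [ip, ip, sum_eq_of_ne hne hil hjl, sum_eq_of_ne hne hil hjl, hAi, hAj, h4, h5] at e
    simp only [Nat.cast_zero, mul_zero, zero_add, realVec] at e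
    have hvl : (v l : ℝ) ≠ 0 := by exact_mod_cast hpos.1.ne'
    have hl : ω l = A l := by exact_mod_cast mul_left_cancel₀ hvl e
    ext m
    exact forall_of_ne hne hil hjl (P := fun m => ω m = A m) (by rw [h4, hAi]) (by rw [h5, hAj])
      hl m
  -- If A l = 1, peeling A off in direction l would leave L ∅ = 0.
  have hA2 : 2 ≤ A l := by
    by_contra h
    have hA1 : A l = 1 := by omega
    refine hL2 ?_
    rw [hL.2 k₂ (one_le_add (one_le_add hk)) l A hA hA1 fun ω hω h => absurd (heq ω hω) h,
      Finset.filter_false_of_mem, hL.1, mul_zero]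
    intro ω hω
    rw [heq ω hω, hA1]
    exact one_ne_zero
  have hcor : Corner S C iv (iv v) (iv v') l A v v' := ⟨hne, hil, hjl, hC, hAi, hAj, hA2, hv, hv',
    rfl, rfl, hkv hAk, hkv' hAk⟩
  refine ⟨l, A, hcor, ?_⟩
  ext ω
  rw [Finset.mem_singleton]
  exact ⟨fun hω => hcor.eq_of_mem (hkv hω) (hkv' hω), fun h => h ▸ hAk⟩

/-- The slope `k_j / k_l` of a removed point is smaller than that of all rays other than `v`. -/
theorem Corner.slope_lt (h : Corner S C iv i j l A v v') {k : Fin 3 → ℕ}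
    (hA : amin S (realVec k) = {A}) (hk : IsRemoved S C iv i k) {w : Fin 3 → ℕ} (hw : IsRay S w)
    (hwA : A ∈ amin S (realVec w)) (hwl : 0 < w l) (hne : v ≠ w) :
    (k j : ℝ) * w l < w j * k l := by
  obtain ⟨k', t, hk', rfl⟩ := hk
  obtain ⟨h1, u, hu, hui, hku, h2, Q, hQ, hQi⟩ := id hk'
  have hAk : A ∈ amin S (realVec k') := hk'.amin_add_subset t (by rw [hA]; simp)
  have huA := hku hAk
  have huv : u = v := by
    rcases h.eq_or_eq hu huA with e | e
    · exact e
    · subst e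
      exact absurd (hui.symm.trans h.hvj) h.hij
  subst huv
  have := h.b1.slope_lt_of_amin_subset h.hij h.hil h.hjl h.hAi h.hAj (hQi ▸ one_pos) h.ray h.pos
    (k := realVec k') (fun m => Nat.cast_pos.2 (h1 m)) hAk hQ hku hw hwA hwl hne
  simpa [realVec, h.hij.symm, h.hil.symm] using this

/-- `L` vanishes where the removed sets for two variables overlap. -/
theorem eq_zero_of_isRemoved (hS : S.Nonempty) (hC : B1Config S C iv) (hL : IsPeeling S c L)
    {k : Fin 3 → ℕ} (hij : i ≠ j) (hi : IsRemoved S C iv i k) (hj : IsRemoved S C iv j k) :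
    L (amin S (realVec k)) = 0 := by
  by_contra hLk
  obtain ⟨k', t, hk', hadd⟩ := id hi
  obtain ⟨k'', t', hk'', hadd'⟩ := id hj
  obtain ⟨h1, v, hv, hvi, hkv, h2, Q, hQ, hQi⟩ := id hk'
  obtain ⟨-, v', hv', hvj, hkv', -⟩ := id hk''
  have hk : ∀ m, 1 ≤ k m := by rw [hadd]; exact one_le_add h1
  have hs : amin S (realVec k) ⊆ amin S (realVec k') := hadd ▸ hk'.amin_add_subset t
  have hs' : amin S (realVec k) ⊆ amin S (realVec k'') := hadd' ▸ hk''.amin_add_subset t'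
  obtain ⟨l, A, hcor, hA⟩ := exists_corner hC hL hk hLk hv hv' (hs.trans hkv) (hs'.trans hkv')
    (by rwa [hvi, hvj])
  rw [hvi, hvj] at hcor
  have hAk : A ∈ amin S (realVec k) := by rw [hA]; simp
  have ht : 0 < t := by
    rcases Nat.eq_zero_or_pos t with rfl | ht
    · rw [hadd] at hA
      simp only [Pi.single_zero, add_zero] at hA
      rw [hA, Finset.mem_singleton] at hQ
      rw [hQ, hcor.hAi] at hQi
      omega
    · exact ht
  have hkl : k' l = k l := by rw [hadd]; simp [hcor.hil.symm]
  have hki : k' i + t = k i := by rw [hadd]; simp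
  -- If v' is a ray of the face of k', its facet contains Q, which is then the corner A; but Q i =
  -- 1.
  by_cases hF : FaceLE S (realVec k') (realVec v')
  · have := hcor.eq_of_mem (hkv hQ) (hF.1 hQ)
    rw [this, hcor.hAi] at hQi
    omega
  -- Since k is removed in direction j, its slope k_i / k_l lies below those of all rays other than
  -- v', hence below that of k'. But k' has the same l-coordinate as k and a smaller i-coordinate.
  · have := coneSpan_nonneg (fun m => if m = i then (k l : ℝ) else if m = l then -(k i : ℝ) else 0)
      (fun w hw => ?_) (mem_coneSpan_rays hS (realVec_nonneg k'))
    · simp only [sum_eq_of_ne hcor.hij hcor.hil hcor.hjl, if_true, hcor.hil.symm, hcor.hij.symm,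
        hcor.hjl, if_false, zero_mul, add_zero, realVec, hkl] at this
      have h3 : (k l : ℝ) * (k' i - k i) ≥ 0 := by linarith
      have h4 : (k' i : ℝ) - k i < 0 := by
        have : (k i : ℝ) = k' i + t := by exact_mod_cast hki.symm
        have : (0 : ℝ) < t := by exact_mod_cast ht
        linarith
      have h5 : (0 : ℝ) < k l := by exact_mod_cast hk l
      nlinarith
    · have hwv : v' ≠ w := fun e => hF (e ▸ hw.2)
      have hwA : A ∈ amin S (realVec w) := hw.2.1 (hs hAk)
      simp only [sum_eq_of_ne hcor.hij hcor.hil hcor.hjl, if_true, hcor.hil.symm, hcor.hij.symm,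
        hcor.hjl, if_false, zero_mul, add_zero]
      rcases Nat.eq_zero_or_pos (w l) with hwl | hwl
      · rw [hwl]; simp; positivity
      · have := hcor.symm.slope_lt hA hj hw.1 hwA hwl hwv
        linarith

end Overlap

end Igusa

namespace Igusa

/-! ### The points at a corner that are not removed. -/

section CornerCone

variable {S : Finset (Fin 3 →₀ ℕ)} {C : Set (Fin 3 → ℕ)} {iv : (Fin 3 → ℕ) → Fin 3}
  {i j l : Fin 3} {A : Fin 3 →₀ ℕ} {v v' : Fin 3 → ℕ}

/-- The rays of the dual cone of the vertex `A` that do not belong to `C`. -/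
def freeRays (S : Finset (Fin 3 →₀ ℕ)) (C : Set (Fin 3 → ℕ)) (A : Fin 3 →₀ ℕ) :
    Set (Fin 3 → ℕ) := {w | IsRay S w ∧ A ∈ amin S (realVec w) ∧ w ∉ C}

theorem Corner.mem_freeRays (h : Corner S C iv i j l A v v') {w : Fin 3 → ℕ} (hw : IsRay S w)
    (hwA : A ∈ amin S (realVec w)) (h1 : w ≠ v) (h2 : w ≠ v') : w ∈ freeRays S C A :=
  ⟨hw, hwA, fun hwC => (h.eq_or_eq hwC hwA).elim h1 h2⟩

theorem Corner.single_mem (h : Corner S C iv i j l A v v') : Pi.single i 1 ∈ freeRays S C A := by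
  have hA : A ∈ amin S (realVec (Pi.single i 1)) := by
    rw [realVec_single]
    exact mem_amin_single (amin_subset h.hvA) h.hAi (by simp)
  refine ⟨isRay_single S i, hA, fun hw => h.config.pos _ hw A hA ?_⟩
  rw [realVec_single, ip_single, h.hAi]
  simp

theorem Corner.v_slope_lt (h : Corner S C iv i j l A v v') {w : Fin 3 → ℕ} (hw : IsRay S w)
    (hwA : A ∈ amin S (realVec w)) (hwl : 0 < w l) (hne : v ≠ w) :
    (v j : ℝ) * w l < w j * v l :=
  h.b1.slope_lt h.hij h.hil h.hjl h.hAi h.hAj h.ray h.hvA h.pos hw hwA hwl hne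

/-- For a removed k the functional x_j k_l - k_j x_l is non-negative on the free rays and vanishes
only on those with x_l = 0. It vanishes at k, where k_l > 0. -/
theorem Corner.notRemoved_of_mem (h : Corner S C iv i j l A v v') {k : Fin 3 → ℕ}
    (hk : ∀ m, 1 ≤ k m) (hA : amin S (realVec k) = {A})
    (hmem : realVec k ∈ coneSpan (freeRays S C A)) : ¬ IsRemoved S C iv i k := by
  intro hr
  have hkl : (0 : ℝ) < k l := by exact_mod_cast hk l
  have key : ∀ x ∈ coneSpan (freeRays S C A), 0 ≤ x l ∧ 0 ≤ x j * k l - k j * x l ∧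
      (x j * k l - k j * x l = 0 → x l = 0) := by
    intro x hx
    induction hx using Submodule.span_induction with
    | mem x hx =>
      obtain ⟨w, hw, rfl⟩ := hx
      rcases Nat.eq_zero_or_pos (w l) with hwl | hwl
      · have h0 : realVec w l = 0 := by simp [realVec, hwl]
        rw [h0]
        refine ⟨le_rfl, ?_, fun _ => rfl⟩
        simp only [mul_zero, sub_zero]
        exact mul_nonneg (realVec_nonneg w j) hkl.le
      · have := h.slope_lt hA hr hw.1 hw.2.1 hwl fun e => hw.2.2 (e ▸ h.hv)
        simp only [realVec]
        exact ⟨Nat.cast_nonneg _, by linarith, fun h0 => by linarith⟩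
    | zero => simp
    | add x y _ _ hx hy =>
      simp only [Pi.add_apply]
      refine ⟨add_nonneg hx.1 hy.1, by linarith [hx.2.1, hy.2.1], fun h0 => ?_⟩
      rw [hx.2.2 (by linarith [hx.2.1, hy.2.1]), hy.2.2 (by linarith [hx.2.1, hy.2.1]), add_zero]
    | smul r x _ hx =>
      have hm : ∀ m, (r • x) m = (r : ℝ) * x m := fun m => rfl
      simp only [hm]
      have hr0 : (0 : ℝ) ≤ r := r.2
      have e : (r : ℝ) * x j * k l - k j * (r * x l) = r * (x j * k l - k j * x l) := by ring
      rw [e]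
      refine ⟨mul_nonneg hr0 hx.1, mul_nonneg hr0 hx.2.1, fun h0 => ?_⟩
      rcases mul_eq_zero.1 h0 with h1 | h1
      · rw [h1, zero_mul]
      · rw [hx.2.2 h1, mul_zero]
  have := (key _ hmem).2.2 (by simp only [realVec]; ring)
  simp only [realVec] at this
  exact hkl.ne' this

/-- Let a be the functional vanishing on v and v' whose coefficients at i and j are positive.
Without a third ray it would be non-negative on the whole dual cone of A. But v + v' can be moved a
little along -(e_i + e_j) within that cone, where a becomes negative. -/
theorem Corner.exists_third_ray (hS : S.Nonempty) (h : Corner S C iv i j l A v v') :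
    ∃ w, IsRay S w ∧ A ∈ amin S (realVec w) ∧ 0 < w l ∧ w ≠ v ∧ w ≠ v' := by
  by_contra hno
  push Not at hno
  have hvi : 0 < v i := Nat.pos_of_ne_zero h.b1.pos
  have hvj : 0 < v' j := Nat.pos_of_ne_zero h.symm.b1.pos
  have hypos : ∀ m, 0 < (realVec v + realVec v') m := by
    refine forall_of_ne h.hij h.hil h.hjl ?_ ?_ ?_
    · exact add_pos_of_pos_of_nonneg (Nat.cast_pos.2 hvi) (Nat.cast_nonneg _)
    · exact add_pos_of_nonneg_of_pos (Nat.cast_nonneg _) (Nat.cast_pos.2 hvj)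
    · exact add_pos_of_pos_of_nonneg (Nat.cast_pos.2 h.pos) (Nat.cast_nonneg _)
  have hmin : ∀ ω ∈ amin S (realVec v + realVec v'), ω = A := fun ω hω => by
    have := (mem_amin_add_iff h.hvA h.hvA').1 hω
    exact h.eq_of_mem this.1 this.2
  obtain ⟨t, ht, h0, hF, -⟩ := exists_faceLE_of_tangent (S := S) (k := realVec v + realVec v')
    (u := -(Pi.single i 1 + Pi.single j 1)) hS (fun m => (hypos m).le)
    ⟨fun ω hω ω' hω' => by rw [hmin ω hω, hmin ω' hω'], fun m hm => absurd hm (hypos m).ne'⟩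
    ⟨i, by simp [h.hij]⟩
  have h1 := h.v_slope_lt h.symm.ray h.hvA' h.symm.pos h.ne
  have h2 := h.symm.v_slope_lt h.ray h.hvA h.pos h.ne.symm
  have := coneSpan_nonneg (fun m => if m = i then (v' j : ℝ) * v l - v j * v' l else
      if m = j then (v i : ℝ) * v' l - v' i * v l else -((v i : ℝ) * v' j - v' i * v j))
      (fun w hw => ?_) (mem_coneSpan_rays hS h0)
  · simp only [sum_eq_of_ne h.hij h.hil h.hjl, if_true, h.hij.symm, h.hil.symm, h.hjl.symm,
      if_false, realVec, Pi.add_apply, Pi.smul_apply, Pi.neg_apply, Pi.single_eq_same, ne_eq,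
      not_false_eq_true, Pi.single_eq_of_ne, smul_eq_mul, h.hij] at this
    nlinarith
  · simp only [sum_eq_of_ne h.hij h.hil h.hjl, if_true, h.hij.symm, h.hil.symm, h.hjl.symm,
      if_false]
    have hwA : A ∈ amin S (realVec w) :=
      hw.2.1 (hF.1 (mem_amin_add h.hvA h.hvA'))
    rcases Nat.eq_zero_or_pos (w l) with hwl | hwl
    · rw [hwl]
      have h3 := mul_nonneg (sub_pos.2 h1).le (Nat.cast_nonneg (α := ℝ) (w i))
      have h4 := mul_nonneg (sub_pos.2 h2).le (Nat.cast_nonneg (α := ℝ) (w j))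
      simp only [Nat.cast_zero, mul_zero, add_zero]
      exact add_nonneg h3 h4
    · by_cases hwv : w = v
      · subst hwv; apply le_of_eq; ring
      · have := hno w hw.1 hwA hwl hwv
        subst this; apply le_of_eq; ring

/-- The ray that is next to `v`. -/
theorem Corner.exists_next (h : Corner S C iv i j l A v v') (hS : S.Nonempty) :
    ∃ u ∈ freeRays S C A, 0 < u l ∧ ∀ w, IsRay S w → A ∈ amin S (realVec w) → w ≠ v →
      (u j : ℝ) * w l ≤ w j * u l := by
  have hfin : {w | IsRay S w ∧ A ∈ amin S (realVec w) ∧ w ≠ v ∧ 0 < w l}.Finite :=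
    (finite_rays S).subset fun w hw => hw.1
  obtain ⟨u, ⟨hu, huA, huv, hul⟩, hmin⟩ := hfin.exists_minimalFor (fun w => (w j : ℝ) / w l) _
    ⟨v', h.symm.ray, h.hvA', h.ne.symm, h.symm.pos⟩
  have hul' : (0 : ℝ) < u l := by exact_mod_cast hul
  have hle : ∀ w, IsRay S w → A ∈ amin S (realVec w) → w ≠ v → (u j : ℝ) * w l ≤ w j * u l := by
    intro w hw hwA hwv
    rcases Nat.eq_zero_or_pos (w l) with hwl | hwl
    · rw [hwl, Nat.cast_zero, mul_zero]; positivity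
    · have hwl' : (0 : ℝ) < w l := by exact_mod_cast hwl
      have := not_lt_iff_le_imp_ge.2 (hmin ⟨hw, hwA, hwv, hwl⟩)
      rw [not_lt, div_le_div_iff₀ hul' hwl'] at this
      exact this
  refine ⟨u, h.mem_freeRays hu huA huv fun e => ?_, hul, hle⟩
  subst e
  -- If the minimum were attained at v', which also has the least slope in direction i, a third ray
  -- would dominate v' and equal it.
  obtain ⟨w, hw, hwA, hwl, hwv, hwu⟩ := h.exists_third_ray hS
  refine hwu (h.symm.ray.eq_of_le h.hij h.hil h.hjl h.hAi h.hAj hw h.hvA' h.symm.pos hwl ?_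
    (hle w hw hwA hwv)).symm
  exact (h.symm.v_slope_lt hw hwA hwl hwu.symm).le

/-- A point that dominates a free ray coordinatewise is in the cone of the free rays. -/
theorem Corner.mem_coneSpan_of_le (h : Corner S C iv i j l A v v') {u : Fin 3 → ℕ}
    (hu : u ∈ freeRays S C A) (hul : 0 < u l) {k : Fin 3 → ℝ} (hkl : 0 ≤ k l)
    (hi : (u i : ℝ) * k l ≤ k i * u l) (hj : (u j : ℝ) * k l ≤ k j * u l) :
    k ∈ coneSpan (freeRays S C A) := by
  have hul' : (0 : ℝ) < u l := by exact_mod_cast hul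
  have hγ : ∀ m, (u m : ℝ) * k l ≤ k m * u l → 0 ≤ k m - k l / u l * u m := fun m hm => by
    have : k l / u l * u m = u m * k l / u l := by ring
    rw [this, sub_nonneg, div_le_iff₀ hul']; exact hm
  have hsum : k = (k l / u l) • realVec u + ((k i - k l / u l * u i) • realVec (Pi.single i 1) +
      (k j - k l / u l * u j) • realVec (Pi.single j 1)) := by
    ext m
    refine forall_of_ne h.hij h.hil h.hjl (P := fun m => k m = ((k l / u l) • realVec u +
      ((k i - k l / u l * u i) • realVec (Pi.single i 1) +
      (k j - k l / u l * u j) • realVec (Pi.single j 1))) m) ?_ ?_ ?_ m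
    · simp [realVec, h.hij]
    · simp [realVec, h.hij.symm]
    · simp only [realVec, Pi.add_apply, Pi.smul_apply, smul_eq_mul, ne_eq, h.hil.symm, h.hjl.symm,
        not_false_eq_true, Pi.single_eq_of_ne, Nat.cast_zero, mul_zero, add_zero]
      field_simp
  rw [hsum]
  exact add_mem (smul_mem_coneSpan (div_nonneg hkl hul'.le) (realVec_mem_coneSpan hu))
    (add_mem (smul_mem_coneSpan (hγ i hi) (realVec_mem_coneSpan h.single_mem))
      (smul_mem_coneSpan (hγ j hj) (realVec_mem_coneSpan h.symm.single_mem)))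

/-- Descent along e_i keeps the slope k_j / k_l. If k is not removed, v is not a ray of the face of
the descent point, and u has the least slope among the other rays. -/
theorem Corner.slope_ge_of_notRemoved (h : Corner S C iv i j l A v v') (hS : S.Nonempty)
    {u : Fin 3 → ℕ} (hmin : ∀ w, IsRay S w → A ∈ amin S (realVec w) → w ≠ v →
      (u j : ℝ) * w l ≤ w j * u l) {k : Fin 3 → ℕ} (hk : ∀ m, 1 ≤ k m)
    (hA : amin S (realVec k) = {A}) (hr : ¬ IsRemoved S C iv i k) :
    (u j : ℝ) * k l ≤ k j * u l := by
  obtain ⟨k', hk'⟩ := exists_isDescent (i := i) hS (k := realVec k)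
    (fun m => Nat.cast_pos.2 (hk m)) (by simp [hA, h.hAi])
  have hAk' : A ∈ amin S k' := (hk'.mem_amin.1 (by simp [hA])).1
  have hv : ¬ FaceLE S k' (realVec v) := fun hF =>
    hr (hk'.isRemoved h.config hk h.hv h.hvi hF)
  have := coneSpan_nonneg (fun m => if m = j then (u l : ℝ) else if m = l then -(u j : ℝ) else 0)
      (fun w hw => ?_) (mem_coneSpan_rays hS hk'.1)
  · simp only [sum_eq_of_ne h.hij h.hil h.hjl, if_true, h.hij, h.hil, h.hjl.symm, if_false,
      zero_mul, zero_add, hk'.apply_of_ne h.hij.symm, hk'.apply_of_ne h.hil.symm, realVec] at this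
    linarith
  · simp only [sum_eq_of_ne h.hij h.hil h.hjl, if_true, h.hij, h.hil, h.hjl.symm, if_false,
      zero_mul, zero_add]
    have := hmin w hw.1 (hw.2.1 hAk') fun e => hv (e ▸ hw.2)
    linarith

/-- The points of the dual cone of a corner that are not removed span the cone of the free rays. -/
theorem Corner.mem_coneSpan (h : Corner S C iv i j l A v v') (hS : S.Nonempty) {k : Fin 3 → ℕ}
    (hk : ∀ m, 1 ≤ k m) (hA : amin S (realVec k) = {A}) (hi : ¬ IsRemoved S C iv i k)
    (hj : ¬ IsRemoved S C iv j k) : realVec k ∈ coneSpan (freeRays S C A) := by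
  obtain ⟨u', hu', hul', hmin'⟩ := h.exists_next hS
  obtain ⟨u, hu, hul, hmin⟩ := h.symm.exists_next hS
  have hl' := h.slope_ge_of_notRemoved hS hmin' hk hA hi
  have hl := h.symm.slope_ge_of_notRemoved hS hmin hk hA hj
  have hkl : (0 : ℝ) < k l := Nat.cast_pos.2 (hk l)
  -- Either k dominates the free ray u and lies in the cone of u, e_i, e_j, or its slope in
  -- direction j is smaller than that of u and one descends along e_i.
  by_cases h1 : (u j : ℝ) * k l ≤ k j * u l
  · exact h.mem_coneSpan_of_le hu hul hkl.le hl h1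
  push Not at h1
  obtain ⟨k', hk'⟩ := exists_isDescent (i := i) hS (k := realVec k)
    (fun m => Nat.cast_pos.2 (hk m)) (by simp [hA, h.hAi])
  have hAk' : A ∈ amin S k' := (hk'.mem_amin.1 (by simp [hA])).1
  have hv : ¬ FaceLE S k' (realVec v) := fun hF =>
    hi (hk'.isRemoved h.config hk h.hv h.hvi hF)
  have hk'j : k' j = k j := hk'.apply_of_ne h.hij.symm
  have hk'l : k' l = k l := hk'.apply_of_ne h.hil.symm
  have huv' : u ≠ v' := fun e => hu.2.2 (e ▸ h.hv')
  have h2 : (u j : ℝ) * v' l ≤ v' j * u l := by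
    by_contra! hlt
    refine huv' (h.symm.ray.eq_of_le h.hij h.hil h.hjl h.hAi h.hAj hu.1 h.hvA' h.symm.pos hul ?_
      hlt.le).symm
    exact (h.symm.v_slope_lt hu.1 hu.2.1 hul huv'.symm).le
  have hv'l : (0 : ℝ) < v' l := Nat.cast_pos.2 h.symm.pos
  have hulr : (0 : ℝ) < u l := Nat.cast_pos.2 hul
  -- In slope u lies between k' and v'. If v' were a ray of the face of k', then u would be a
  -- combination of k' and v' when an exponent with x_i > 0 is minimal at k', and extremality would
  -- give u = v'. When k' i = 0, v' would be a multiple of k' plus a positive multiple of e_j,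
  -- contrary to its own extremality.
  have hv' : ¬ FaceLE S k' (realVec v') := by
    intro hF
    rcases hk'.2.2.2 with ⟨Q, hQ, hQi⟩ | h0
    · obtain ⟨α, β, hα, hβ, e⟩ := hu.1.eq_add_of_between h.hij h.hil h.hjl h.hAi hQi hu.2.1 hk'.1
        (realVec_nonneg v') hAk' h.hvA' hQ (hF.1 hQ) hul (by rw [hk'j, hk'l]; exact h1) h2 hv'l
        (by rw [hk'l]; exact hkl)
      obtain ⟨d, hd⟩ := hu.1.exists_eq_smul (fun m => mul_nonneg hα (hk'.1 m))
        (fun m => mul_nonneg hβ.le (realVec_nonneg v' m)) (mem_amin_smul hα hAk')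
        (mem_amin_smul hβ.le h.hvA') e
      have hd : β • realVec v' = d • realVec u := hd
      refine huv' (eq_of_smul_eq h.symm.ray.1 hu.1.1 (c := β⁻¹ * d) ?_).symm
      rw [mul_smul, ← hd, smul_smul, inv_mul_cancel₀ hβ.ne', one_smul]
    · have h0' : (v' i : ℝ) = 0 := hF.2 i h0
      set γ : ℝ := v' j - v' l / k l * k j with hγ
      have hγ0 : 0 < γ := by
        have h3 : (k j : ℝ) * v' l < v' j * k l := by
          have h4 : (k j : ℝ) * u l * v' l < u j * k l * v' l := by
            exact mul_lt_mul_of_pos_right h1 hv'l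
          have h5 : (u j : ℝ) * v' l * k l ≤ v' j * u l * k l :=
            mul_le_mul_of_nonneg_right h2 hkl.le
          have h6 : (k j * v' l) * (u l : ℝ) < (v' j * k l) * u l := by nlinarith
          exact lt_of_mul_lt_mul_right h6 hulr.le
        have : (v' l : ℝ) / k l * k j = k j * v' l / k l := by ring
        rw [hγ, this, sub_pos, div_lt_iff₀ hkl]
        exact h3
      have hsum : realVec v' = ((v' l : ℝ) / k l) • k' + Pi.single j γ := by
        ext m
        refine forall_of_ne h.hij h.hil h.hjl
          (P := fun m => realVec v' m = (((v' l : ℝ) / k l) • k' + Pi.single j γ : Fin 3 → ℝ) m) ?_ ?_ ?_ m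
        · simp [realVec, h0, h0', h.hij]
        · simp [realVec, hk'j, hγ]
        · simp only [realVec, Pi.add_apply, Pi.smul_apply, hk'l, smul_eq_mul, ne_eq, h.hjl.symm,
            not_false_eq_true, Pi.single_eq_of_ne, add_zero]
          field_simp
      have hc : 0 ≤ (v' l : ℝ) / k l := div_nonneg hv'l.le hkl.le
      obtain ⟨d, hd⟩ := h.symm.ray.exists_eq_smul (fun m => mul_nonneg hc (hk'.1 m))
        (single_nonneg' hγ0.le) (mem_amin_smul hc hAk')
        (mem_amin_single (amin_subset hAk') h.hAj hγ0.le) hsum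
      have hdl := congrFun hd l
      simp only [ne_eq, h.hjl.symm, not_false_eq_true, Pi.single_eq_of_ne, Pi.smul_apply,
        smul_eq_mul, realVec] at hdl
      have hd0 : d = 0 := (mul_eq_zero.1 hdl.symm).resolve_right hv'l.ne'
      have hdj := congrFun hd j
      rw [hd0] at hdj
      simp at hdj
      exact hγ0.ne' hdj
  have hmem : k' ∈ coneSpan (freeRays S C A) := by
    refine coneSpan_mono (fun w hw => ?_) (mem_coneSpan_rays hS hk'.1)
    exact h.mem_freeRays hw.1 (hw.2.1 hAk') (fun e => hv (e ▸ hw.2)) fun e => hv' (e ▸ hw.2)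
  obtain ⟨-, ⟨t, ht, hadd⟩, -⟩ := hk'
  have hsingle : Pi.single i t = t • realVec (Pi.single i 1) := by
    rw [realVec_single]
    ext m
    by_cases hm : m = i
    · subst hm; simp
    · simp [hm]
  rw [hadd, hsingle]
  exact add_mem hmem (smul_mem_coneSpan ht.le (realVec_mem_coneSpan h.single_mem))

end CornerCone

end Igusa

/-! ### Decomposition of the remaining points into sets generated by rays outside C. -/

namespace Igusa

section Partition

variable {S : Finset (Fin 3 →₀ ℕ)} {C : Set (Fin 3 → ℕ)} {iv : (Fin 3 → ℕ) → Fin 3}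
  {i j l : Fin 3} {c : ℂ} {L : Finset (Fin 3 →₀ ℕ) → ℂ} {S₁ : Finset (Fin 3 →₀ ℕ)}

/-- The points of the open cone of the face `S₁` that are not removed. -/
def remaining (S : Finset (Fin 3 →₀ ℕ)) (C : Set (Fin 3 → ℕ)) (iv : (Fin 3 → ℕ) → Fin 3)
    (S₁ : Finset (Fin 3 →₀ ℕ)) : Set (Fin 3 → ℕ) :=
  {k | (∀ m, 1 ≤ k m) ∧ amin S (realVec k) = S₁ ∧ ∀ i, ¬ IsRemoved S C iv i k}

/-- `M` is closed under addition of the rays in `V`, and contained in the cone over `V`. -/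
def IsConical (S : Finset (Fin 3 →₀ ℕ)) (C : Set (Fin 3 → ℕ)) (S₁ : Finset (Fin 3 →₀ ℕ))
    (M : Set (Fin 3 → ℕ)) : Prop :=
  ∃ V : Set (Fin 3 → ℕ), V.Finite ∧ (∀ w ∈ V, IsRay S w ∧ S₁ ⊆ amin S (realVec w) ∧ w ∉ C) ∧
    (∀ k ∈ M, ∀ w ∈ V, k + w ∈ M) ∧ ∀ k ∈ M, realVec k ∈ coneSpan V

theorem isConical_empty : IsConical S C S₁ ∅ :=
  ⟨∅, Set.finite_empty, by simp, by simp, by simp⟩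

theorem IsRemoved.exists_mem {k : Fin 3 → ℕ} (h : IsRemoved S C iv i k) :
    ∃ v ∈ C, iv v = i ∧ amin S (realVec k) ⊆ amin S (realVec v) := by
  obtain ⟨k', t, hk', rfl⟩ := h
  obtain ⟨_, v, hv, hvi, hkv, _⟩ := id hk'
  exact ⟨v, hv, hvi, (hk'.amin_add_subset t).trans hkv⟩

theorem amin_add_eq {k w : Fin 3 → ℕ} (hS : S.Nonempty)
    (h : amin S (realVec k) ⊆ amin S (realVec w)) :
    amin S (realVec (k + w)) = amin S (realVec k) := by
  obtain ⟨A, hA⟩ := amin_nonempty hS (realVec k)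
  ext ω
  rw [realVec_add, mem_amin_add_iff hA (h hA)]
  exact ⟨fun h => h.1, fun h' => ⟨h', h h'⟩⟩

/-- No facet of `C` contains the face. -/
theorem isConical_remaining_of_forall_not (hS : S.Nonempty)
    (h : ∀ v ∈ C, ¬ S₁ ⊆ amin S (realVec v)) : IsConical S C S₁ (remaining S C iv S₁) := by
  refine ⟨{w | IsRay S w ∧ S₁ ⊆ amin S (realVec w)}, (finite_rays S).subset fun w hw => hw.1,
    fun w hw => ⟨hw.1, hw.2, fun hwC => h w hwC hw.2⟩, ?_, ?_⟩
  · rintro k ⟨hk, rfl, -⟩ w hw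
    have e := amin_add_eq hS hw.2
    refine ⟨one_le_add hk, e, fun i hi => ?_⟩
    obtain ⟨v, hv, -, hkv⟩ := hi.exists_mem
    exact h v hv (e ▸ hkv)
  · rintro k ⟨hk, rfl, -⟩
    have hsub : {w | IsRay S w ∧ FaceLE S (realVec k) (realVec w)} ⊆
        {w | IsRay S w ∧ amin S (realVec k) ⊆ amin S (realVec w)} := fun w hw => ⟨hw.1, hw.2.1⟩
    exact coneSpan_mono hsub (mem_coneSpan_rays hS (realVec_nonneg k))

/-- The facets of `C` that contain the face are assigned to two different variables. -/
theorem isConical_remaining_of_ne (hS : S.Nonempty) (hC : B1Config S C iv) (hL : IsPeeling S c L)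
    (hL₁ : L S₁ ≠ 0) {v v' : Fin 3 → ℕ} (hv : v ∈ C) (hv' : v' ∈ C)
    (hSv : S₁ ⊆ amin S (realVec v)) (hSv' : S₁ ⊆ amin S (realVec v')) (hne : iv v ≠ iv v') :
    IsConical S C S₁ (remaining S C iv S₁) := by
  rcases (remaining S C iv S₁).eq_empty_or_nonempty with h | ⟨k₀, hk₀, rfl, -⟩
  · rw [h]; exact isConical_empty
  obtain ⟨l, A, hcor, hA⟩ := exists_corner hC hL hk₀ hL₁ hv hv' hSv hSv' hne
  rw [hA]
  refine ⟨freeRays S C A, (finite_rays S).subset fun w hw => hw.1, fun w hw => ⟨hw.1,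
    Finset.singleton_subset_iff.2 hw.2.1, hw.2.2⟩, ?_, ?_⟩
  · rintro k ⟨hk, hkA, hr⟩ w hw
    have e : amin S (realVec (k + w)) = {A} := by
      rw [amin_add_eq hS (by rw [hkA]; exact Finset.singleton_subset_iff.2 hw.2.1), hkA]
    have hmem : realVec (k + w) ∈ coneSpan (freeRays S C A) := by
      rw [realVec_add]
      exact add_mem (hcor.mem_coneSpan hS hk hkA (hr _) (hr _)) (realVec_mem_coneSpan hw)
    refine ⟨one_le_add hk, e, forall_of_ne hcor.hij hcor.hil hcor.hjl ?_ ?_ fun hrl => ?_⟩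
    · exact hcor.notRemoved_of_mem (one_le_add hk) e hmem
    · exact hcor.symm.notRemoved_of_mem (one_le_add hk) e hmem
    · obtain ⟨u, hu, hul, hku⟩ := hrl.exists_mem
      rcases hcor.eq_or_eq hu (hku (by rw [e]; simp)) with rfl | rfl
      · exact hcor.hil hul
      · exact hcor.hjl hul
  · rintro k ⟨hk, hkA, hr⟩
    exact hcor.mem_coneSpan hS hk hkA (hr _) (hr _)

/-- All the facets of `C` that contain the face are assigned to the same variable. -/
theorem exists_isConical_partition (hS : S.Nonempty) (hC : B1Config S C iv) (hL : IsPeeling S c L)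
    (hL₁ : L S₁ ≠ 0) {v : Fin 3 → ℕ} (hv : v ∈ C) (hSv : S₁ ⊆ amin S (realVec v))
    (hall : ∀ w ∈ C, S₁ ⊆ amin S (realVec w) → iv w = iv v) :
    ∃ code : (Fin 3 → ℕ) → {T // T ∈ S.powerset} × Finset (Fin 3),
      ∀ a, IsConical S C S₁ {k | k ∈ remaining S C iv S₁ ∧ code k = a} := by
  classical
  rcases (remaining S C iv S₁).eq_empty_or_nonempty with h | ⟨k₀, hk₀, hk₀S, hr₀⟩
  · refine ⟨fun _ => ⟨⟨∅, by simp⟩, ∅⟩, fun a => ?_⟩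
    rw [h]; simpa using isConical_empty
  -- If the face had an exponent with x_i = 1, a remaining point k₀ would itself start a cancelling
  -- fiber, because L ≠ 0 also supplies an exponent with x_i = 0.
  have hS0 : ∀ ω ∈ S₁, ω (iv v) = 0 := by
    intro ω hω
    by_contra h0
    have h1 := (hC.b1 v hv).le_one ω (hSv hω)
    have h2 := (hL.filter_ne_zero hC hk₀ (by rwa [hk₀S]) hv (by rwa [hk₀S])).1
    exact hr₀ (iv v) (IsBase.isRemoved ⟨hk₀, v, hv, rfl, by rwa [hk₀S], h2, ω, by rwa [hk₀S],
      by omega⟩)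
  have hdesc : ∀ k : Fin 3 → ℕ, ∃ k', (∀ m, 1 ≤ k m) → amin S (realVec k) = S₁ →
      IsDescent S (iv v) (realVec k) k' := by
    intro k
    by_cases h : (∀ m, 1 ≤ k m) ∧ amin S (realVec k) = S₁
    · obtain ⟨k', hk'⟩ := exists_isDescent (i := iv v) hS (k := realVec k)
        (fun m => Nat.cast_pos.2 (h.1 m)) (by rw [h.2]; exact hS0)
      exact ⟨k', fun _ _ => hk'⟩
    · exact ⟨0, fun h1 h2 => absurd ⟨h1, h2⟩ h⟩
  choose d hd using hdesc
  -- Points are classified by the face of their descent point, zero coordinates included. The type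
  -- of codes is finite.
  refine ⟨fun k => ⟨⟨amin S (d k), Finset.mem_powerset.2 amin_subset⟩,
    Finset.univ.filter fun m => d k m = 0⟩, fun a => ?_⟩
  set M := {k | k ∈ remaining S C iv S₁ ∧ (⟨⟨amin S (d k), Finset.mem_powerset.2 amin_subset⟩,
    Finset.univ.filter fun m => d k m = 0⟩ : {T // T ∈ S.powerset} × Finset (Fin 3)) = a} with hM
  rcases M.eq_empty_or_nonempty with h | ⟨k₁, hk₁⟩
  · rw [h]; exact isConical_empty
  have hface : ∀ k k', k ∈ M → ((⟨⟨amin S (d k'), Finset.mem_powerset.2 amin_subset⟩,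
      Finset.univ.filter fun m => d k' m = 0⟩ : {T // T ∈ S.powerset} × Finset (Fin 3)) = a ↔
      amin S (d k') = amin S (d k) ∧ ∀ m, d k' m = 0 ↔ d k m = 0) := by
    rintro k k' ⟨-, rfl⟩
    simp [Prod.ext_iff, Finset.ext_iff]
  have hsub : ∀ k ∈ M, S₁ ⊆ amin S (d k) := by
    rintro k ⟨⟨hk, hkS, -⟩, -⟩ ω hω
    exact ((hd k hk hkS).mem_amin.1 (by rwa [hkS])).1
  have hnot : ∀ w ∈ C, ¬ FaceLE S (d k₁) (realVec w) := by
    intro w hw hF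
    have hwi := hall w hw ((hsub k₁ hk₁).trans hF.1)
    exact hk₁.1.2.2 (iv v) ((hd k₁ hk₁.1.1 hk₁.1.2.1).isRemoved hC hk₁.1.1 hw hwi hF)
  -- the descent point detects whether a point is removed
  have hrem : ∀ k, (∀ m, 1 ≤ k m) → amin S (realVec k) = S₁ → amin S (d k) = amin S (d k₁) →
      (∀ m, d k m = 0 ↔ d k₁ m = 0) → k ∈ M := by
    intro k hk hkS h1 h2
    refine ⟨⟨hk, hkS, fun i hi => ?_⟩, (hface k₁ k hk₁).2 ⟨h1, h2⟩⟩
    obtain ⟨w, hw, hwi, hkw⟩ := hi.exists_mem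
    have hiv : i = iv v := by rw [← hwi]; exact hall w hw (hkS ▸ hkw)
    subst hiv
    obtain ⟨k', t, hk', hadd⟩ := hi
    obtain ⟨hk'1, u, hu, hui, hku, h3, Q, hQ, hQi⟩ := id hk'
    have ht : 0 < t := by
      rcases Nat.eq_zero_or_pos t with rfl | ht
      · simp only [Pi.single_zero, add_zero] at hadd
        rw [← hadd, hkS] at hQ
        have := hS0 Q hQ
        omega
      · exact ht
    -- Uniqueness of descent identifies the start of a removing fiber with the descent point, whose
    -- face would then lie in a facet of C.
    have hdk : d k = realVec k' := (hd k hk hkS).unique ⟨realVec_nonneg k', ⟨t, Nat.cast_pos.2 ht,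
      by rw [hadd, realVec_add, realVec_single]⟩, h3, .inl ⟨Q, hQ, hQi ▸ one_pos⟩⟩
    refine hnot u hu ⟨?_, fun m hm => ?_⟩
    · rw [← h1, hdk]; exact hku
    · have h4 := (h2 m).2 hm
      rw [hdk] at h4
      exact absurd h4 (Nat.cast_pos.2 (hk'1 m)).ne'
  have hsingle : ∀ ω ∈ S, ω (iv v) = 0 → ω ∈ amin S (realVec (Pi.single (iv v) 1)) := by
    intro ω hω h0
    rw [realVec_single]
    exact mem_amin_single hω h0 (by simp)
  have hS₁ : S₁ ⊆ S := hk₀S ▸ amin_subset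
  have hS₁e : S₁ ⊆ amin S (realVec (Pi.single (iv v) 1)) := fun ω hω =>
    hsingle ω (hS₁ hω) (hS0 ω hω)
  -- The generators are e_i, which moves k without moving d k, and the rays of the face of the
  -- descent points in the class, which move both.
  refine ⟨insert (Pi.single (iv v) 1) {w | IsRay S w ∧ FaceLE S (d k₁) (realVec w)},
    ((finite_rays S).subset fun w hw => hw.1).insert _, ?_, ?_, ?_⟩
  · rintro w (rfl | hw)
    · refine ⟨isRay_single S _, hS₁e, fun hmem => ?_⟩
      obtain ⟨A, hA⟩ := amin_nonempty hS (realVec k₀)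
      rw [hk₀S] at hA
      refine hC.pos _ hmem A (hS₁e hA) ?_
      rw [realVec_single, ip_single, hS0 A hA]
      simp
    · exact ⟨hw.1, (hsub k₁ hk₁).trans hw.2.1, fun hwC => hnot w hwC hw.2⟩
  · rintro k hk w hw
    have hkd := hd k hk.1.1 hk.1.2.1
    obtain ⟨hT, hZ⟩ := (hface k₁ k hk₁).1 hk.2
    rcases hw with rfl | hw
    · have e : amin S (realVec (k + Pi.single (iv v) 1)) = S₁ := by
        rw [amin_add_eq hS (by rw [hk.1.2.1]; exact hS₁e), hk.1.2.1]
      obtain ⟨h1, ⟨t, ht, h2⟩, h3⟩ := hkd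
      have hdk := (hd _ (one_le_add hk.1.1) e).unique ⟨h1, ⟨t + 1, by positivity, by
        rw [realVec_add, h2, realVec_single, add_assoc, ← Pi.single_add, Nat.cast_one]⟩, h3⟩
      exact hrem _ (one_le_add hk.1.1) e (by rw [hdk, hT]) (by rw [hdk]; exact hZ)
    · have hF : FaceLE S (d k) (realVec w) := ⟨hT ▸ hw.2.1, fun m hm => hw.2.2 m ((hZ m).1 hm)⟩
      have e : amin S (realVec (k + w)) = S₁ := by
        rw [amin_add_eq hS (by rw [hk.1.2.1]; exact (hsub k hk).trans hF.1), hk.1.2.1]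
      obtain ⟨h1, h2, h3⟩ := hkd.add (realVec_nonneg w) hF
      rw [← realVec_add] at h1
      have hdk := (hd _ (one_le_add hk.1.1) e).unique h1
      exact hrem _ (one_le_add hk.1.1) e (by rw [hdk, h2, hT]) fun m => by rw [hdk, h3, hZ]
  · rintro k hk
    have hkd := hd k hk.1.1 hk.1.2.1
    obtain ⟨hT, hZ⟩ := (hface k₁ k hk₁).1 hk.2
    obtain ⟨h1, ⟨t, ht, h2⟩, -⟩ := hkd
    have hs : Pi.single (iv v) t = t • realVec (Pi.single (iv v) 1) := by
      rw [realVec_single]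
      ext m
      by_cases hm : m = iv v
      · rw [hm]; simp
      · simp [hm]
    rw [h2, hs]
    refine add_mem (coneSpan_mono (fun w hw => .inr ⟨hw.1, ?_⟩) (mem_coneSpan_rays hS h1))
      (smul_mem_coneSpan ht.le (realVec_mem_coneSpan (Set.mem_insert _ _)))
    exact ⟨hT ▸ hw.2.1, fun m hm => hw.2.2 m ((hZ m).2 hm)⟩

/-- The points of the cone of a face that are not removed can be partitioned into finitely many
sets that are generated by rays outside `C`. -/
theorem exists_partition (hS : S.Nonempty) (hC : B1Config S C iv) (hL : IsPeeling S c L)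
    (hL₁ : L S₁ ≠ 0) : ∃ code : (Fin 3 → ℕ) → {T // T ∈ S.powerset} × Finset (Fin 3),
      ∀ a, IsConical S C S₁ {k | k ∈ remaining S C iv S₁ ∧ code k = a} := by
  classical
  have hconst : IsConical S C S₁ (remaining S C iv S₁) →
      ∃ code : (Fin 3 → ℕ) → {T // T ∈ S.powerset} × Finset (Fin 3),
      ∀ a, IsConical S C S₁ {k | k ∈ remaining S C iv S₁ ∧ code k = a} := by
    intro h
    refine ⟨fun _ => ⟨⟨∅, by simp⟩, ∅⟩, fun a => ?_⟩
    by_cases ha : ((⟨⟨∅, by simp⟩, ∅⟩ : {T // T ∈ S.powerset} × Finset (Fin 3)) = a)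
    · simpa [ha] using h
    · simpa [ha] using isConical_empty
  by_cases h : ∃ v ∈ C, S₁ ⊆ amin S (realVec v)
  · obtain ⟨v, hv, hSv⟩ := h
    by_cases hall : ∀ w ∈ C, S₁ ⊆ amin S (realVec w) → iv w = iv v
    · exact exists_isConical_partition hS hC hL hL₁ hv hSv hall
    · push Not at hall
      obtain ⟨w, hw, hSw, hne⟩ := hall
      exact hconst (isConical_remaining_of_ne hS hC hL hL₁ hw hv hSw hSv hne)
  · push Not at h
    exact hconst (isConical_remaining_of_forall_not hS h)

end Partition

end Igusa

/-! ### Rational functions of z = p^(-s) and lattice sums. -/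

namespace Igusa

open Polynomial in
/-- `G` is on the open unit disc a rational function without poles there or at `z₀`. -/
def IsRationalAt (z₀ : ℂ) (G : ℂ → ℂ) : Prop :=
  ∃ D N : ℂ[X], (∀ z, ‖z‖ < 1 → D.eval z ≠ 0) ∧ D.eval z₀ ≠ 0 ∧
    ∀ z, ‖z‖ < 1 → G z * D.eval z = N.eval z

section Rational

variable {z₀ : ℂ} {G H : ℂ → ℂ}

theorem isRationalAt_zero : IsRationalAt z₀ fun _ => 0 := ⟨1, 0, by simp, by simp, by simp⟩

theorem IsRationalAt.add (hG : IsRationalAt z₀ G) (hH : IsRationalAt z₀ H) :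
    IsRationalAt z₀ fun z => G z + H z := by
  obtain ⟨D, N, h1, h2, h3⟩ := hG
  obtain ⟨D', N', h1', h2', h3'⟩ := hH
  refine ⟨D * D', N * D' + N' * D, fun z hz => ?_, ?_, fun z hz => ?_⟩
  · rw [Polynomial.eval_mul]; exact mul_ne_zero (h1 z hz) (h1' z hz)
  · rw [Polynomial.eval_mul]; exact mul_ne_zero h2 h2'
  · simp only [Polynomial.eval_mul, Polynomial.eval_add, ← h3 z hz, ← h3' z hz]; ring

theorem IsRationalAt.const_mul (c : ℂ) (hG : IsRationalAt z₀ G) :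
    IsRationalAt z₀ fun z => c * G z := by
  obtain ⟨D, N, h1, h2, h3⟩ := hG
  refine ⟨D, Polynomial.C c * N, h1, h2, fun z hz => ?_⟩
  rw [Polynomial.eval_mul, Polynomial.eval_C, ← h3 z hz, mul_assoc]

theorem IsRationalAt.sum {α : Type*} (s : Finset α) {G : α → ℂ → ℂ}
    (h : ∀ a ∈ s, IsRationalAt z₀ (G a)) : IsRationalAt z₀ fun z => ∑ a ∈ s, G a z := by
  classical
  induction s using Finset.induction_on with
  | empty => simpa using isRationalAt_zero
  | insert a s ha ih =>
    simp only [Finset.sum_insert ha]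
    exact (h a (Finset.mem_insert_self _ _)).add (ih fun b hb => h b (Finset.mem_insert_of_mem hb))

theorem IsRationalAt.congr (hG : IsRationalAt z₀ G) (h : ∀ z, ‖z‖ < 1 → H z = G z) :
    IsRationalAt z₀ H := by
  obtain ⟨D, N, h1, h2, h3⟩ := hG
  exact ⟨D, N, h1, h2, fun z hz => by rw [h z hz, h3 z hz]⟩

end Rational

/-- The minimum of `k · ω` for `ω ∈ S`. -/
noncomputable def minPair (S : Finset (Fin 3 →₀ ℕ)) (k : Fin 3 → ℕ) : ℕ :=
  sInf ((fun ω : Fin 3 →₀ ℕ => ∑ m, k m * ω m) '' (S : Set (Fin 3 →₀ ℕ)))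

open Classical in
/-- The contribution of the multi-order `k` to the zeta function, as a function of `z = p ^ (-s)`. -/
noncomputable def latticeTerm (S : Finset (Fin 3 →₀ ℕ)) (p : ℕ) (L : Finset (Fin 3 →₀ ℕ) → ℂ)
    (z : ℂ) (k : Fin 3 → ℕ) : ℂ :=
  if ∀ m, 1 ≤ k m then L (amin S (realVec k)) * ((p : ℂ)⁻¹ ^ (∑ m, k m) * z ^ minPair S k) else 0

section Sums

variable {S : Finset (Fin 3 →₀ ℕ)} {C : Set (Fin 3 → ℕ)} {iv : (Fin 3 → ℕ) → Fin 3}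
  {i j l : Fin 3} {c : ℂ} {L : Finset (Fin 3 →₀ ℕ) → ℂ} {S₁ : Finset (Fin 3 →₀ ℕ)} {p : ℕ}
  {z z₀ : ℂ}

theorem ip_realVec (k : Fin 3 → ℕ) (ω : Fin 3 →₀ ℕ) :
    ip (realVec k) ω = ((∑ m, k m * ω m : ℕ) : ℝ) := by simp [ip, realVec]

theorem minPair_eq {k : Fin 3 → ℕ} {A : Fin 3 →₀ ℕ} (hA : A ∈ amin S (realVec k)) :
    minPair S k = ∑ m, k m * A m := by
  refine le_antisymm (Nat.sInf_le ⟨A, amin_subset hA, rfl⟩) (le_csInf ⟨_, A, amin_subset hA, rfl⟩ ?_)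
  rintro _ ⟨ω, hω, rfl⟩
  have := (mem_amin.1 hA).2 ω hω
  rw [ip_realVec, ip_realVec] at this
  exact_mod_cast this

theorem minPair_le {k : Fin 3 → ℕ} {ω : Fin 3 →₀ ℕ} (hω : ω ∈ S) :
    minPair S k ≤ ∑ m, k m * ω m := Nat.sInf_le ⟨ω, hω, rfl⟩

theorem weight_eq {k : Fin 3 → ℕ} {A : Fin 3 →₀ ℕ} (hA : A ∈ amin S (realVec k)) :
    (p : ℂ)⁻¹ ^ (∑ m, k m) * z ^ minPair S k = ∏ m, ((p : ℂ)⁻¹ * z ^ A m) ^ k m := by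
  have h : ∑ m, k m * A m = ∑ m, A m * k m := Finset.sum_congr rfl fun m _ => mul_comm _ _
  rw [minPair_eq hA, h]
  simp only [mul_pow, Finset.prod_mul_distrib, Finset.prod_pow_eq_pow_sum, ← pow_mul]

theorem latticeTerm_eq {k : Fin 3 → ℕ} {A : Fin 3 →₀ ℕ} (hk : ∀ m, 1 ≤ k m)
    (hA : A ∈ amin S (realVec k)) : latticeTerm S p L z k =
      L (amin S (realVec k)) * ∏ m, ((p : ℂ)⁻¹ * z ^ A m) ^ k m := by
  rw [latticeTerm, if_pos hk, weight_eq hA]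

theorem norm_inv_natCast_lt_one (hp : 2 ≤ p) : ‖(p : ℂ)⁻¹‖ < 1 := by
  rw [norm_inv, Complex.norm_natCast]
  exact inv_lt_one_of_one_lt₀ (by exact_mod_cast hp)

theorem norm_inv_mul_pow_lt_one (hp : 2 ≤ p) (hz : ‖z‖ < 1) (n : ℕ) :
    ‖(p : ℂ)⁻¹ * z ^ n‖ < 1 := by
  rw [norm_mul, norm_pow]
  exact mul_lt_one_of_nonneg_of_lt_one_left (norm_nonneg _) (norm_inv_natCast_lt_one hp)
    (pow_le_one₀ (norm_nonneg _) hz.le)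

theorem summable_latticeTerm (hp : 2 ≤ p) (hz : ‖z‖ < 1) : Summable (latticeTerm S p L z) := by
  have h1 := (summable_norm_prod_and_tsum_prod (fun (_ : Fin 3) n => (p : ℂ)⁻¹ ^ n) fun _ => by
    simpa only [norm_pow] using
      summable_geometric_of_lt_one (norm_nonneg _) (norm_inv_natCast_lt_one hp)).1
  refine Summable.of_norm_bounded (h1.mul_left (∑ T ∈ S.powerset, ‖L T‖)) fun k => ?_
  rw [latticeTerm]
  split_ifs
  · rw [norm_mul, norm_mul, Finset.prod_pow_eq_pow_sum]
    refine mul_le_mul (Finset.single_le_sum (f := fun T => ‖L T‖) (fun _ _ => norm_nonneg _)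
      (Finset.mem_powerset.2 amin_subset)) ?_ (by positivity)
      (Finset.sum_nonneg fun _ _ => norm_nonneg _)
    rw [norm_pow z]
    exact mul_le_of_le_one_right (norm_nonneg _) (pow_le_one₀ (norm_nonneg _) hz.le)
  · rw [norm_zero]
    exact mul_nonneg (Finset.sum_nonneg fun _ _ => norm_nonneg _) (norm_nonneg _)

/-- All points of M have a common minimal exponent A, so each term is L(S₁) times a monomial in p⁻¹
z^(A m). Since A is also minimal for every generator w, the denominator factors are 1 - p^(-σ(w))
z^(m(w)), non-zero on the disc and at z₀. -/
theorem isRationalAt_tsum_conical (hp : 2 ≤ p) {M : Set (Fin 3 → ℕ)} (hM : IsConical S C S₁ M)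
    (hM1 : ∀ k ∈ M, (∀ m, 1 ≤ k m) ∧ amin S (realVec k) = S₁) (hS : S.Nonempty)
    (hz₀ : ∀ w, IsRay S w → w ∉ C → (p : ℂ)⁻¹ ^ (∑ m, w m) * z₀ ^ minPair S w ≠ 1) :
    IsRationalAt z₀ fun z => ∑' k, M.indicator (latticeTerm S p L z) k := by
  rcases M.eq_empty_or_nonempty with rfl | ⟨k₁, hk₁⟩
  · simpa using isRationalAt_zero
  obtain ⟨A, hA⟩ := amin_nonempty hS (realVec k₁)
  rw [(hM1 k₁ hk₁).2] at hA
  obtain ⟨V, hVf, hV, hadd, hcone⟩ := hM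
  let e := hVf.toFinset.equivFin.symm
  let v : Fin hVf.toFinset.card → Fin 3 → ℕ := fun j => (e j).1
  have hvV : ∀ j, v j ∈ V := fun j => hVf.mem_toFinset.1 (e j).2
  have hrange : realVec '' V = Set.range fun j => realVec (v j) := by
    ext x
    constructor
    · rintro ⟨w, hw, rfl⟩
      exact ⟨e.symm ⟨w, hVf.mem_toFinset.2 hw⟩, by simp [v]⟩
    · rintro ⟨j, rfl⟩
      exact ⟨v j, hvV j, rfl⟩
  obtain ⟨P, hP⟩ := exists_polynomial_tsum_mul_prod M v (fun j => (hV _ (hvV j)).1.ne_zero)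
    (fun k hk j => hadd k hk _ (hvV j)) fun k hk => by
      have h := hcone k hk
      rw [coneSpan, hrange, Submodule.mem_span_range_iff_exists_fun] at h
      obtain ⟨c, hc⟩ := h
      refine ⟨fun j => c j, fun j => (c j).2, fun i => ?_⟩
      have := congrFun hc i
      rw [Finset.sum_apply] at this
      exact this.symm
  let x : Fin 3 → Polynomial ℂ := fun m => Polynomial.C (p : ℂ)⁻¹ * Polynomial.X ^ A m
  have hx : ∀ m z, (x m).eval z = (p : ℂ)⁻¹ * z ^ A m := fun m z => by simp [x]
  have hAv : ∀ j, A ∈ amin S (realVec (v j)) := fun j => (hV _ (hvV j)).2.1 hA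
  refine ⟨∏ j, (1 - ∏ m, x m ^ v j m), Polynomial.C (L S₁) * MvPolynomial.aeval x P,
    fun z hz => ?_, ?_, fun z hz => ?_⟩
  · simp only [Polynomial.eval_prod, Polynomial.eval_sub, Polynomial.eval_one, Polynomial.eval_pow,
      hx]
    refine Finset.prod_ne_zero_iff.2 fun j _ h => ?_
    rw [← weight_eq (hAv j)] at h
    have h1 : ‖(p : ℂ)⁻¹ ^ (∑ m, v j m) * z ^ minPair S (v j)‖ < 1 := by
      rw [norm_mul, norm_pow, norm_pow]
      refine mul_lt_one_of_nonneg_of_lt_one_left (by positivity) ?_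
        (pow_le_one₀ (norm_nonneg _) hz.le)
      refine pow_lt_one₀ (norm_nonneg _) (norm_inv_natCast_lt_one hp) fun h0 => ?_
      refine (hV _ (hvV j)).1.ne_zero (funext fun m => ?_)
      exact Finset.sum_eq_zero_iff.1 h0 m (Finset.mem_univ m)
    rw [← sub_eq_zero.1 h, norm_one] at h1
    exact lt_irrefl _ h1
  · simp only [Polynomial.eval_prod, Polynomial.eval_sub, Polynomial.eval_one, Polynomial.eval_pow,
      hx]
    refine Finset.prod_ne_zero_iff.2 fun j _ h => ?_
    rw [← weight_eq (hAv j)] at h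
    exact hz₀ _ (hV _ (hvV j)).1 (hV _ (hvV j)).2.2 (sub_eq_zero.1 h).symm
  · have hPz := hP (fun m => (p : ℂ)⁻¹ * z ^ A m) fun m => norm_inv_mul_pow_lt_one hp hz _
    have h1 : ∑' k, M.indicator (latticeTerm S p L z) k =
        L S₁ * ∑' k : M, ∏ m, ((p : ℂ)⁻¹ * z ^ A m) ^ k.1 m := by
      rw [← tsum_subtype, ← tsum_mul_left]
      refine tsum_congr fun k => ?_
      rw [latticeTerm_eq (hM1 _ k.2).1 (by rw [(hM1 _ k.2).2]; exact hA), (hM1 _ k.2).2]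
    have h2 : (MvPolynomial.aeval x P).eval z =
        MvPolynomial.eval (fun m => (p : ℂ)⁻¹ * z ^ A m) P := by
      have h3 : (fun m => (p : ℂ)⁻¹ * z ^ A m) = fun m => Polynomial.evalRingHom z (x m) := by
        ext m; simp [hx]
      rw [h3, MvPolynomial.aeval_def, ← Polynomial.coe_evalRingHom, MvPolynomial.hom_eval₂,
        MvPolynomial.eval, MvPolynomial.coe_eval₂Hom]
      congr 1
      ext r; simp
    beta_reduce
    rw [h1, Polynomial.eval_mul, Polynomial.eval_C, h2, ← hPz]
    simp only [Polynomial.eval_prod, Polynomial.eval_sub, Polynomial.eval_one, Polynomial.eval_pow,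
      hx]
    rw [mul_assoc]

end Sums

end Igusa

/-! ### Evaluation of the full lattice sum. -/

namespace Igusa

section Total

variable {S : Finset (Fin 3 →₀ ℕ)} {C : Set (Fin 3 → ℕ)} {iv : (Fin 3 → ℕ) → Fin 3}
  {i j l : Fin 3} {L : Finset (Fin 3 →₀ ℕ) → ℂ} {S₁ : Finset (Fin 3 →₀ ℕ)} {p : ℕ}
  {z z₀ : ℂ}

theorem tsum_inv_pow_succ (hp : 2 ≤ p) : ∑' t : ℕ, (p : ℂ)⁻¹ ^ (t + 1) = ((p : ℂ) - 1)⁻¹ := by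
  have hp0 : (p : ℂ) ≠ 0 := by exact_mod_cast (by omega : p ≠ 0)
  have hp1 : (p : ℂ) - 1 ≠ 0 := sub_ne_zero.2 (by exact_mod_cast (by omega : p ≠ 1))
  simp only [pow_succ]
  rw [tsum_mul_right, tsum_geometric_of_norm_lt_one (norm_inv_natCast_lt_one hp)]
  field_simp

/-- The sum over a removed fiber vanishes. -/
theorem tsum_fiber_eq_zero (hC : B1Config S C iv) (hp : 2 ≤ p)
    (hL : IsPeeling S (-((p : ℂ) - 1)⁻¹) L) {k : Fin 3 → ℕ} (hk : IsBase S C iv i k)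
    (hz : ‖z‖ < 1) : ∑' t : ℕ, latticeTerm S p L z (k + Pi.single i t) = 0 := by
  obtain ⟨h1, v, hv, hvi, hkv, ⟨A, hA, hAi⟩, Q, hQ, hQi⟩ := id hk
  have hB := hC.b1 v hv
  rw [hvi] at hB
  have hpeel := hL.2 k h1 i Q hQ hQi fun ω hω hne => by
    by_contra h0
    have h3 := hB.le_one ω (hkv hω)
    exact hne (hB.unique (realVec k) (fun m => Nat.cast_pos.2 (h1 m)) ω (hkv hω) Q (hkv hQ)
      (by omega) hQi (ip_eq_of_mem_amin hω hQ))
  set S₀ := (amin S (realVec k)).filter fun ω => ω i = 0 with hS₀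
  set x : Fin 3 → ℂ := fun m => (p : ℂ)⁻¹ * z ^ A m with hx
  -- For positive steps the face is S₀ and the minimum is still k·A, as A i = 0. The terms form a
  -- geometric series of ratio 1/p, whose sum cancels the term at k by the peeling factor -1/(p -
  -- 1).
  have hterm : ∀ t : ℕ, latticeTerm S p L z (k + Pi.single i (t + 1)) =
      (L S₀ * ∏ m, x m ^ k m) * (p : ℂ)⁻¹ ^ (t + 1) := by
    intro t
    have hset : amin S (realVec (k + Pi.single i (t + 1))) = S₀ := by
      ext ω
      rw [hk.amin_add (Nat.succ_pos t), hS₀, Finset.mem_filter]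
    have hA' : A ∈ amin S (realVec (k + Pi.single i (t + 1))) := by
      rw [hset, hS₀, Finset.mem_filter]; exact ⟨hA, hAi⟩
    rw [latticeTerm_eq (one_le_add h1) hA', hset]
    simp only [Pi.add_apply, pow_add, Finset.prod_mul_distrib]
    rw [Finset.prod_eq_single i (f := fun m => x m ^ (Pi.single i (t + 1) : Fin 3 → ℕ) m)
      (fun m _ hm => by simp [hm]) (by simp), Pi.single_eq_same]
    simp only [hx, hAi, pow_zero, mul_one]
    ring
  have hs : Summable fun t : ℕ => latticeTerm S p L z (k + Pi.single i t) :=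
    (summable_latticeTerm hp hz).comp_injective fun t t' h => by
      simpa using h
  rw [hs.tsum_eq_zero_add]
  simp only [hterm]
  rw [tsum_mul_left, tsum_inv_pow_succ hp, Pi.single_zero, add_zero, latticeTerm_eq h1 hA, hpeel]
  ring

/-- For a fixed direction the removed set is a disjoint union of cancelling fibers. -/
theorem tsum_removed_eq_zero (hC : B1Config S C iv) (hp : 2 ≤ p)
    (hL : IsPeeling S (-((p : ℂ) - 1)⁻¹) L) (hz : ‖z‖ < 1) (i : Fin 3) :
    ∑' k, {k | IsRemoved S C iv i k}.indicator (latticeTerm S p L z) k = 0 := by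
  let e : {k // IsBase S C iv i k} × ℕ → (Fin 3 → ℕ) := fun q => q.1.1 + Pi.single i q.2
  have he : Function.Injective e := fun q q' h => by
    obtain ⟨h1, h2⟩ := q.1.2.unique q'.1.2 h
    exact Prod.ext (Subtype.ext h1) h2
  have hrange : {k | IsRemoved S C iv i k} = Set.range e := by
    ext k
    constructor
    · rintro ⟨k', t, hk', rfl⟩
      exact ⟨⟨⟨k', hk'⟩, t⟩, rfl⟩
    · rintro ⟨q, rfl⟩
      exact ⟨q.1.1, q.2, q.1.2, rfl⟩
  have hs : Summable fun q => latticeTerm S p L z (e q) :=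
    (summable_latticeTerm hp hz).comp_injective he
  rw [hrange, ← tsum_subtype, tsum_range _ he, hs.tsum_prod]
  refine (tsum_congr fun b => ?_).trans tsum_zero
  exact tsum_fiber_eq_zero hC hp hL b.2 hz

/-- Points removed in more than one direction have zero terms, so the three removed sets can be
subtracted as if they were disjoint. -/
theorem tsum_latticeTerm_eq (hS : S.Nonempty) (hC : B1Config S C iv) (hp : 2 ≤ p)
    (hL : IsPeeling S (-((p : ℂ) - 1)⁻¹) L) (hz : ‖z‖ < 1) : ∑' k, latticeTerm S p L z k =
      ∑' k, {k | ∀ i, ¬ IsRemoved S C iv i k}.indicator (latticeTerm S p L z) k := by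
  classical
  have hpt : ∀ k, latticeTerm S p L z k =
      {k | ∀ i, ¬ IsRemoved S C iv i k}.indicator (latticeTerm S p L z) k +
        ∑ i, {k | IsRemoved S C iv i k}.indicator (latticeTerm S p L z) k := by
    intro k
    by_cases h : ∀ i, ¬ IsRemoved S C iv i k
    · rw [Set.indicator_of_mem (by exact h), Finset.sum_eq_zero, add_zero]
      exact fun i _ => Set.indicator_apply_eq_zero.2 fun hi => absurd hi (h i)
    · rw [Set.indicator_of_notMem (by exact h), zero_add]
      push Not at h
      obtain ⟨i, hi⟩ := h
      rw [Finset.sum_eq_single i, Set.indicator_of_mem (by exact hi)]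
      · intro j _ hj
        by_cases hj' : IsRemoved S C iv j k
        · rw [Set.indicator_of_mem (by exact hj'), latticeTerm]
          split_ifs
          · rw [eq_zero_of_isRemoved hS hC hL hj hj' hi, zero_mul]
          · rfl
        · exact Set.indicator_apply_eq_zero.2 fun h => absurd h hj'
      · simp
  have hs := summable_latticeTerm (S := S) (L := L) hp hz
  rw [tsum_congr hpt, Summable.tsum_add (hs.indicator _) (summable_sum fun i _ => hs.indicator _),
    Summable.tsum_finsetSum fun i _ => hs.indicator _,
    Finset.sum_eq_zero fun i _ => tsum_removed_eq_zero hC hp hL hz i, add_zero]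

/-- The zeta sum is a rational function of `z` without pole at `z₀`. -/
theorem isRationalAt_tsum_latticeTerm (hS : S.Nonempty) (hC : B1Config S C iv) (hp : 2 ≤ p)
    (hL : IsPeeling S (-((p : ℂ) - 1)⁻¹) L)
    (hz₀ : ∀ w, IsRay S w → w ∉ C → (p : ℂ)⁻¹ ^ (∑ m, w m) * z₀ ^ minPair S w ≠ 1) :
    IsRationalAt z₀ fun z => ∑' k, latticeTerm S p L z k := by
  classical
  have hcode : ∀ S₁, ∃ code : (Fin 3 → ℕ) → {T // T ∈ S.powerset} × Finset (Fin 3), L S₁ ≠ 0 →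
      ∀ a, IsConical S C S₁ {k | k ∈ remaining S C iv S₁ ∧ code k = a} := by
    intro S₁
    by_cases h : L S₁ = 0
    · exact ⟨fun _ => ⟨⟨∅, by simp⟩, ∅⟩, fun h' => absurd h h'⟩
    · obtain ⟨code, hcode⟩ := exists_partition hS hC hL h
      exact ⟨code, fun _ => hcode⟩
  choose code hcode using hcode
  set M : Finset (Fin 3 →₀ ℕ) → {T // T ∈ S.powerset} × Finset (Fin 3) → Set (Fin 3 → ℕ) :=
    fun S₁ a => {k | k ∈ remaining S C iv S₁ ∧ code S₁ k = a} with hM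
  have hpt : ∀ z k, {k | ∀ i, ¬ IsRemoved S C iv i k}.indicator (latticeTerm S p L z) k =
      ∑ S₁ ∈ S.powerset, ∑ a, (M S₁ a).indicator (latticeTerm S p L z) k := by
    intro z k
    by_cases hk : (∀ m, 1 ≤ k m) ∧ ∀ i, ¬ IsRemoved S C iv i k
    · rw [Set.indicator_of_mem (by exact hk.2), Finset.sum_eq_single (amin S (realVec k)),
        Finset.sum_eq_single (code (amin S (realVec k)) k), Set.indicator_of_mem]
      · exact ⟨⟨hk.1, rfl, hk.2⟩, rfl⟩
      · exact fun a _ ha => Set.indicator_of_notMem (fun h => ha h.2.symm) _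
      · simp
      · refine fun S₁ _ hS₁ => Finset.sum_eq_zero fun a _ => Set.indicator_of_notMem (fun h => ?_) _
        exact hS₁ h.1.2.1.symm
      · exact fun h => absurd (Finset.mem_powerset.2 amin_subset) h
    · rw [Finset.sum_eq_zero fun S₁ _ => Finset.sum_eq_zero fun a _ => Set.indicator_of_notMem
        (fun h => hk ⟨h.1.1, h.1.2.2⟩) _]
      by_cases h : ∀ m, 1 ≤ k m
      · exact Set.indicator_apply_eq_zero.2 fun h' => absurd ⟨h, h'⟩ hk
      · rw [Set.indicator_apply_eq_zero]
        intro _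
        rw [latticeTerm, if_neg h]
  have hgood : ∀ S₁ a, IsRationalAt z₀ fun z => ∑' k, (M S₁ a).indicator (latticeTerm S p L z) k := by
    intro S₁ a
    by_cases h : L S₁ = 0
    · refine isRationalAt_zero.congr fun z _ => ?_
      refine (tsum_congr fun k => ?_).trans tsum_zero
      rw [Set.indicator_apply_eq_zero]
      rintro ⟨⟨hk, hkS, -⟩, -⟩
      rw [latticeTerm, if_pos hk, hkS, h, zero_mul]
    · exact isRationalAt_tsum_conical hp (hcode S₁ h a) (fun k hk => ⟨hk.1.1, hk.1.2.1⟩) hS hz₀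
  refine (IsRationalAt.sum S.powerset fun S₁ _ => IsRationalAt.sum Finset.univ fun a _ =>
    hgood S₁ a).congr fun z hz => ?_
  have hs := summable_latticeTerm (S := S) (L := L) hp hz
  rw [tsum_latticeTerm_eq hS hC hp hL hz, tsum_congr (hpt z),
    Summable.tsum_finsetSum fun S₁ _ => summable_sum fun a _ => hs.indicator _]
  exact Finset.sum_congr rfl fun S₁ _ => Summable.tsum_finsetSum fun a _ => hs.indicator _

end Total

end Igusa

/-! ### Character sums over the torus of 𝔽_p. -/

namespace Igusa

section CharacterSums

variable {p : ℕ} [Fact p.Prime] {f : MvPolynomial (Fin 3) ℤ_[p]} {ψ : MulChar (ZMod p) ℂ}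

theorem sum_units_eq (F : ZMod p → ℂ) : ∑ t : (ZMod p)ˣ, F t = ∑ x, F x - F 0 := by
  classical
  rw [← Finset.sum_erase_eq_sub (Finset.mem_univ 0)]
  refine Finset.sum_bij (fun t _ => (t : ZMod p)) (fun t _ => by simp) (fun _ _ _ _ h => Units.ext h)
    (fun x hx => ⟨Units.mk0 x (Finset.ne_of_mem_erase hx), by simp, rfl⟩) fun _ _ => rfl

/-- The map t ↦ u t + g permutes 𝔽_p, where ψ sums to zero; only the term t = 0 is missing. -/
theorem sum_units_mulChar (hψ : ψ ≠ 1) {u : ZMod p} (hu : u ≠ 0) (g : ZMod p) :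
    ∑ t : (ZMod p)ˣ, ψ (u * t + g) = -ψ g := by
  rw [sum_units_eq fun x => ψ (u * x + g)]
  have h : ∑ x, ψ (u * x + g) = ∑ x, ψ x :=
    Equiv.sum_comp ((Equiv.mulLeft₀ u hu).trans (Equiv.addRight g)) fun x => ψ x
  rw [h, MulChar.sum_eq_zero_of_ne_one hψ, mul_zero, zero_add, zero_sub]

/-- The sum of `ψ(f_T)` over the torus of `𝔽_p`, where `f_T` is the part of `f` supported on `T`. -/
noncomputable def torusSum (f : MvPolynomial (Fin 3) ℤ_[p]) (ψ : MulChar (ZMod p) ℂ)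
    (T : Finset (Fin 3 →₀ ℕ)) : ℂ :=
  ∑ a : Fin 3 → (ZMod p)ˣ, ψ (∑ ω ∈ T, PadicInt.toZMod (f.coeff ω) * ∏ m, (a m : ZMod p) ^ ω m)

theorem eval_map_sum_monomial (T : Finset (Fin 3 →₀ ℕ)) (x : Fin 3 → ZMod p) :
    MvPolynomial.eval x ((∑ ω ∈ T, MvPolynomial.monomial ω (f.coeff ω)).map PadicInt.toZMod) =
      ∑ ω ∈ T, PadicInt.toZMod (f.coeff ω) * ∏ m, x m ^ ω m := by
  simp only [map_sum, MvPolynomial.map_monomial, MvPolynomial.eval_monomial]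
  exact Finset.sum_congr rfl fun ω _ => by rw [Finsupp.prod_fintype _ _ fun _ => pow_zero _]

/-- The coefficients at the vertices of a non-degenerate polynomial are units. -/
theorem toZMod_coeff_ne_zero (hf : f ≠ 0) (hnd : IsNondegenerate f) {k : Fin 3 → ℕ}
    (hk : ∀ m, 1 ≤ k m) {i : Fin 3} {Q : Fin 3 →₀ ℕ} (hQ : Q ∈ amin f.support (realVec k))
    (hQi : Q i = 1) (hω : ∀ ω ∈ amin f.support (realVec k), ω ≠ Q → ω i = 0) :
    PadicInt.toZMod (f.coeff Q) ≠ 0 := by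
  classical
  intro h0
  -- Tilting k to n k - e_i singles out Q: on the face only Q gains from the tilt, and off the face
  -- k·ω is larger by at least 1, which times n outweighs ω i. The summand 2 keeps all coordinates
  -- positive, so {Q} spans a compact face, whose polynomial would vanish modulo p.
  set n : ℕ := 2 + ∑ ω ∈ f.support, ω i with hn
  set v : Fin 3 → ℝ := (n : ℝ) • realVec k - Pi.single i 1 with hv
  have hn2 : (2 : ℝ) ≤ n := by exact_mod_cast (by omega : 2 ≤ n)
  have hvpos : ∀ m, 0 < v m := fun m => by
    have hkm : (1 : ℝ) ≤ k m := by exact_mod_cast hk m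
    have h1 : (2 : ℝ) ≤ n * k m := by nlinarith
    by_cases hm : m = i
    · subst hm
      simp only [hv, Pi.sub_apply, Pi.smul_apply, smul_eq_mul, realVec, Pi.single_eq_same]
      linarith
    · simp only [hv, Pi.sub_apply, Pi.smul_apply, smul_eq_mul, realVec, ne_eq, hm,
        not_false_eq_true, Pi.single_eq_of_ne]
      linarith
  have hip : ∀ ω, ip v ω = n * ip (realVec k) ω - ω i := fun ω => by
    rw [hv, ip_sub, ip_smul, ip_single, one_mul]
  have hlt : ∀ ω ∈ f.support, ω ≠ Q → ip v Q < ip v ω := by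
    intro ω hωS hne
    rw [hip, hip, hQi]
    by_cases h1 : ω ∈ amin f.support (realVec k)
    · rw [hω ω h1 hne, ip_eq_of_mem_amin h1 hQ]
      simp
    · have h2 := ip_lt_of_notMem_amin hQ hωS h1
      rw [ip_realVec, ip_realVec] at h2 ⊢
      have h3 : (∑ m, k m * Q m) + 1 ≤ ∑ m, k m * ω m := by exact_mod_cast h2
      have h4 : ω i ≤ ∑ ω ∈ f.support, ω i :=
        Finset.single_le_sum (f := fun ω : Fin 3 →₀ ℕ => ω i) (fun _ _ => Nat.zero_le _) hωS
      have h5 : n * ((∑ m, k m * Q m) + 1) ≤ n * ∑ m, k m * ω m := Nat.mul_le_mul_left _ h3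
      have h6 : n * (∑ m, k m * Q m) + ω i < n * (∑ m, k m * ω m) + 1 := by
        rw [mul_add, mul_one] at h5
        omega
      have h7 : (n : ℝ) * (∑ m, k m * Q m : ℕ) + ω i < n * (∑ m, k m * ω m : ℕ) + 1 := by
        exact_mod_cast h6
      push_cast at h7 ⊢
      linarith
  have hamin : amin f.support v = {Q} := by
    ext ω
    rw [Finset.mem_singleton]
    refine ⟨fun h => ?_, ?_⟩
    · by_contra hne
      exact absurd ((mem_amin.1 h).2 Q (amin_subset hQ)) (not_le.2 (hlt ω (amin_subset h) hne))
    · intro h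
      rw [h]
      refine mem_amin.2 ⟨amin_subset hQ, fun ω hωS => ?_⟩
      by_cases h : ω = Q
      · rw [h]
      · exact (hlt ω hωS h).le
  have hpart := facePart_faceSet (f := f) fun m => (hvpos m).le
  rw [hamin, Finset.sum_singleton] at hpart
  refine hnd _ (isFace_faceSet hf fun m => (hvpos m).le) (isCompact_faceSet hvpos) (fun _ => 1)
    (fun _ => one_ne_zero) ?_
  rw [hpart, MvPolynomial.map_monomial, h0]
  simp

theorem prod_mul_mulSingle_pow (i : Fin 3) (a : Fin 3 → (ZMod p)ˣ) (t : (ZMod p)ˣ)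
    (ω : Fin 3 →₀ ℕ) : ∏ m, ((a * Pi.mulSingle i t : Fin 3 → (ZMod p)ˣ) m : ZMod p) ^ ω m =
      (∏ m, (a m : ZMod p) ^ ω m) * (t : ZMod p) ^ ω i := by
  simp only [Pi.mul_apply, Units.val_mul, mul_pow, Finset.prod_mul_distrib]
  rw [Finset.prod_eq_single i (f := fun m =>
    (((Pi.mulSingle i t : Fin 3 → (ZMod p)ˣ) m : (ZMod p)ˣ) : ZMod p) ^ ω m)
    (fun m _ hm => by simp [hm]) (by simp), Pi.mulSingle_eq_same]

/-- Average over the action of t on the i-th coordinate: the monomial of Q is multiplied by t and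
the others are fixed, so the inner sum over t is -ψ(f_T(a)). -/
theorem torusSum_insert (hψ : ψ ≠ 1) {i : Fin 3} {Q : Fin 3 →₀ ℕ} {T : Finset (Fin 3 →₀ ℕ)}
    (hc : PadicInt.toZMod (f.coeff Q) ≠ 0) (hQi : Q i = 1) (hT : ∀ ω ∈ T, ω i = 0) :
    ((p : ℂ) - 1) * torusSum f ψ (insert Q T) = -torusSum f ψ T := by
  classical
  have hQT : Q ∉ T := fun h => by
    have := hT Q h
    omega
  have hval : ∀ (a : Fin 3 → (ZMod p)ˣ) (t : (ZMod p)ˣ),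
      ∑ ω ∈ insert Q T, PadicInt.toZMod (f.coeff ω) *
        ∏ m, ((a * Pi.mulSingle i t : Fin 3 → (ZMod p)ˣ) m : ZMod p) ^ ω m =
      (PadicInt.toZMod (f.coeff Q) * ∏ m, (a m : ZMod p) ^ Q m) * t +
        ∑ ω ∈ T, PadicInt.toZMod (f.coeff ω) * ∏ m, (a m : ZMod p) ^ ω m := by
    intro a t
    rw [Finset.sum_insert hQT, prod_mul_mulSingle_pow, hQi, pow_one, ← mul_assoc]
    congr 1
    refine Finset.sum_congr rfl fun ω hω => ?_
    rw [prod_mul_mulSingle_pow, hT ω hω, pow_zero, mul_one]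
  have hsum : ∀ t : (ZMod p)ˣ, torusSum f ψ (insert Q T) = ∑ a : Fin 3 → (ZMod p)ˣ,
      ψ ((PadicInt.toZMod (f.coeff Q) * ∏ m, (a m : ZMod p) ^ Q m) * t +
        ∑ ω ∈ T, PadicInt.toZMod (f.coeff ω) * ∏ m, (a m : ZMod p) ^ ω m) := fun t => by
    rw [torusSum, ← Equiv.sum_comp (Equiv.mulRight (Pi.mulSingle i t))]
    exact Finset.sum_congr rfl fun a _ => by rw [Equiv.coe_mulRight, hval]
  calc ((p : ℂ) - 1) * torusSum f ψ (insert Q T)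
      = ∑ _t : (ZMod p)ˣ, torusSum f ψ (insert Q T) := by
        rw [Finset.sum_const, Finset.card_univ, ZMod.card_units, nsmul_eq_mul,
          Nat.cast_sub (Fact.out : p.Prime).one_lt.le, Nat.cast_one]
    _ = _ := Finset.sum_congr rfl fun t _ => hsum t
    _ = _ := Finset.sum_comm
    _ = ∑ a : Fin 3 → (ZMod p)ˣ,
        -ψ (∑ ω ∈ T, PadicInt.toZMod (f.coeff ω) * ∏ m, (a m : ZMod p) ^ ω m) :=
      Finset.sum_congr rfl fun a _ => sum_units_mulChar hψ (mul_ne_zero hc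
        (Finset.prod_ne_zero_iff.2 fun m _ => pow_ne_zero _ (a m).ne_zero)) _
    _ = -torusSum f ψ T := by rw [Finset.sum_neg_distrib, torusSum]

/-- The character sums of a non-degenerate polynomial. -/
theorem isPeeling_torusSum (hf : f ≠ 0) (hnd : IsNondegenerate f) (hψ : ψ ≠ 1) :
    IsPeeling f.support (-((p : ℂ) - 1)⁻¹) (torusSum f ψ) := by
  classical
  refine ⟨by simp [torusSum, MulChar.map_zero], fun k hk i Q hQ hQi hω => ?_⟩
  have hc := toZMod_coeff_ne_zero hf hnd hk hQ hQi hω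
  have hT : amin f.support (realVec k) =
      insert Q ((amin f.support (realVec k)).filter fun ω => ω i = 0) := by
    ext ω
    rw [Finset.mem_insert, Finset.mem_filter]
    constructor
    · intro h
      by_cases hne : ω = Q
      · exact .inl hne
      · exact .inr ⟨h, hω ω h hne⟩
    · rintro (h | h)
      · rw [h]; exact hQ
      · exact h.1
  have hp1 : (p : ℂ) - 1 ≠ 0 :=
    sub_ne_zero.2 (by exact_mod_cast (Fact.out : p.Prime).one_lt.ne')
  have h := torusSum_insert hψ hc hQi (T := (amin f.support (realVec k)).filter fun ω => ω i = 0)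
    fun ω hω => (Finset.mem_filter.1 hω).2
  rw [← hT] at h
  rw [neg_mul, ← mul_neg, ← h, inv_mul_cancel_left₀ hp1]

/-- The polynomial `p ^ (-N(k)) f(p ^ k x)`. -/
noncomputable def scaled (f : MvPolynomial (Fin 3) ℤ_[p]) (k : Fin 3 → ℕ) :
    MvPolynomial (Fin 3) ℤ_[p] :=
  ∑ ω ∈ f.support, MvPolynomial.monomial ω
    (f.coeff ω * (p : ℤ_[p]) ^ ((∑ m, k m * ω m) - minPair f.support k))

theorem eval_scaleHom (f : MvPolynomial (Fin 3) ℤ_[p]) (k : Fin 3 → ℕ) (x : Fin 3 → ℤ_[p]) :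
    MvPolynomial.eval (scaleHom p k x) f =
      (p : ℤ_[p]) ^ minPair f.support k * MvPolynomial.eval x (scaled f k) := by
  rw [scaled, map_sum, MvPolynomial.eval_eq', Finset.mul_sum]
  refine Finset.sum_congr rfl fun ω hω => ?_
  rw [MvPolynomial.eval_monomial, Finsupp.prod_fintype _ _ fun _ => pow_zero _]
  simp only [scaleHom_apply, mul_pow, Finset.prod_mul_distrib, ← pow_mul,
    Finset.prod_pow_eq_pow_sum]
  have := pow_add (p : ℤ_[p]) (minPair f.support k) ((∑ m, k m * ω m) - minPair f.support k)
  rw [Nat.add_sub_cancel' (minPair_le hω)] at this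
  rw [this]
  ring

/-- Off the minimal exponents a positive power of p remains, so only the initial form survives
reduction; this is where non-degeneracy of compact faces enters. -/
theorem map_scaled (hf : f ≠ 0) (k : Fin 3 → ℕ) : (scaled f k).map PadicInt.toZMod =
    (∑ ω ∈ amin f.support (realVec k), MvPolynomial.monomial ω (f.coeff ω)).map
      PadicInt.toZMod := by
  obtain ⟨A, hA⟩ := amin_nonempty (MvPolynomial.support_nonempty.2 hf) (realVec k)
  rw [scaled, map_sum, map_sum]
  simp only [MvPolynomial.map_monomial]
  symm
  refine Finset.sum_subset_zero_on_sdiff amin_subset (fun ω hω => ?_) fun ω hω => ?_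
  · obtain ⟨hωS, hω⟩ := Finset.mem_sdiff.1 hω
    have h := ip_lt_of_notMem_amin hA hωS hω
    rw [ip_realVec, ip_realVec] at h
    have h' : ∑ m, k m * A m < ∑ m, k m * ω m := by exact_mod_cast h
    rw [minPair_eq hA, map_mul, map_pow, map_natCast, CharP.cast_eq_zero,
      zero_pow (Nat.sub_pos_of_lt h').ne', mul_zero, map_zero]
  · rw [minPair_eq hω, Nat.sub_self, pow_zero, mul_one]

/-- The zeta function of a non-degenerate polynomial is a sum over the multi-orders. -/
theorem twistedZetaIntegral_eq (hf : f ≠ 0) (hnd : IsNondegenerate f) (χ : ℤ_[p]ˣ →* ℂˣ)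
    (hχ : χ ≠ 1) (hχ1 : ∀ u : ℤ_[p]ˣ, (p : ℤ_[p]) ∣ (u : ℤ_[p]) - 1 → χ u = 1)
    (hψ : ∀ u : ℤ_[p]ˣ, (χ u : ℂ) = ψ (PadicInt.toZMod (u : ℤ_[p]))) {s : ℂ} (hs : 0 < s.re) :
    twistedZetaIntegral f χ s = (p : ℂ)⁻¹ ^ 3 *
      ∑' k, latticeTerm f.support p (torusSum f ψ) ((p : ℂ) ^ (-s)) k := by
  have h := hasSum_twistedZetaIntegral f χ hχ hχ1 hψ hs (scaled f) (minPair f.support)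
    (fun k _ => eval_scaleHom f k) fun k hk a h => by
      have hk0 : ∀ m, 0 < realVec k m := fun m => Nat.cast_pos.2 (hk m)
      refine hnd _ (isFace_faceSet hf fun m => (hk0 m).le) (isCompact_faceSet hk0)
        (fun i => (a i : ZMod p)) (fun i => (a i).ne_zero) ?_
      rw [facePart_faceSet fun m => (hk0 m).le, ← map_scaled hf]
      exact h
  rw [← h.tsum_eq, ← tsum_mul_left,
    ← tsum_subtype_eq_of_support_subset (s := {k : Fin 3 → ℕ | ∀ i, 1 ≤ k i})]
  · refine tsum_congr fun k => ?_
    rw [latticeTerm, if_pos k.2, torusSum, Finset.sum_mul, Finset.mul_sum]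
    refine Finset.sum_congr rfl fun a _ => ?_
    rw [map_scaled hf, eval_map_sum_monomial, Finset.sum_add_distrib, pow_add]
    simp only [Finset.sum_const, Finset.card_univ, Fintype.card_fin, smul_eq_mul, mul_one]
    rw [mul_inv, inv_pow, inv_pow]
    ring
  · intro k hk
    by_contra hne
    have h0 : latticeTerm f.support p (torusSum f ψ) ((p : ℂ) ^ (-s)) k = 0 := by
      exact if_neg hne
    exact hk (by simp [h0])

end CharacterSums

end Igusa

namespace Igusa

/-! ### Poles -/

section Poles

variable {p : ℕ} {z₀ s₀ : ℂ} {G Z : ℂ → ℂ}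

theorem norm_natCast_cpow_neg_lt_one (hp : 2 ≤ p) {s : ℂ} (hs : 0 < s.re) :
    ‖(p : ℂ) ^ (-s)‖ < 1 := by
  rw [Complex.norm_natCast_cpow_of_pos (by omega), Complex.neg_re]
  exact Real.rpow_lt_one_of_one_lt_of_neg (by exact_mod_cast hp) (by linarith)

theorem analyticAt_eval_cpow (hp : 2 ≤ p) (P : Polynomial ℂ) (s : ℂ) :
    AnalyticAt ℂ (fun s : ℂ => P.eval ((p : ℂ) ^ (-s))) s := by
  have hp0 : (p : ℂ) ≠ 0 := by exact_mod_cast (by omega : p ≠ 0)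
  have h1 : Differentiable ℂ fun s : ℂ => (p : ℂ) ^ (-s) := fun s =>
    differentiableAt_id.neg.const_cpow (.inl hp0)
  exact (P.differentiable.comp h1).analyticAt s

/-- Two meromorphic functions that agree on a half-plane have the same order everywhere. -/
theorem meromorphicOrderAt_eq_of_eqOn {Z Z' : ℂ → ℂ} (hZ : Meromorphic Z) (hZ' : Meromorphic Z')
    (h : ∀ s : ℂ, 0 < s.re → Z s = Z' s) (s₀ : ℂ) :
    meromorphicOrderAt Z s₀ = meromorphicOrderAt Z' s₀ := by
  have hsub : Meromorphic (Z - Z') := fun s => (hZ s).sub (hZ' s)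
  have hopen : IsOpen {s : ℂ | 0 < s.re} := isOpen_lt continuous_const Complex.continuous_re
  have h1 : meromorphicOrderAt (Z - Z') 1 = ⊤ := by
    rw [meromorphicOrderAt_eq_top_iff]
    refine Filter.Eventually.filter_mono nhdsWithin_le_nhds ?_
    filter_upwards [hopen.mem_nhds (show (1 : ℂ) ∈ {s : ℂ | 0 < s.re} by simp)] with s hs
    rw [Pi.sub_apply, h s hs, sub_self]
  have h2 : meromorphicOrderAt (Z - Z') s₀ = ⊤ := by
    by_contra hne
    exact (hsub.exists_meromorphicOrderAt_ne_top_iff_forall.1 ⟨s₀, hne⟩) 1 h1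
  rw [meromorphicOrderAt_eq_top_iff] at h2
  refine meromorphicOrderAt_congr ?_
  filter_upwards [h2] with s hs
  exact sub_eq_zero.1 hs

/-- The half-plane Re s > 0 maps into the unit disc, but p^(-s₀) need not lie there; regularity at
s₀ uses that the denominator does not vanish at this point. -/
theorem IsRationalAt.exists_meromorphic (hp : 2 ≤ p) (hG : IsRationalAt ((p : ℂ) ^ (-s₀)) G) :
    ∃ Z : ℂ → ℂ, Meromorphic Z ∧ AnalyticAt ℂ Z s₀ ∧
      ∀ s : ℂ, 0 < s.re → Z s = G ((p : ℂ) ^ (-s)) := by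
  obtain ⟨D, N, h1, h2, h3⟩ := hG
  refine ⟨fun s => N.eval ((p : ℂ) ^ (-s)) / D.eval ((p : ℂ) ^ (-s)), fun s => ?_, ?_, ?_⟩
  · exact (analyticAt_eval_cpow hp N s).meromorphicAt.div
      (analyticAt_eval_cpow hp D s).meromorphicAt
  · exact (analyticAt_eval_cpow hp N s₀).div (analyticAt_eval_cpow hp D s₀) h2
  · intro s hs
    have hz := norm_natCast_cpow_neg_lt_one hp hs
    rw [div_eq_iff (h1 _ hz), h3 _ hz]

end Poles

/-! ### The rays of the facets contributing to s₀. -/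

section Contributing

variable {p : ℕ} [Fact p.Prime] {f : MvPolynomial (Fin 3) ℤ_[p]} {s₀ : ℂ}

/-- The primitive normals of the facets that contribute to `s₀`. -/
def contributingRays (f : MvPolynomial (Fin 3) ℤ_[p]) (s₀ : ℂ) : Set (Fin 3 → ℕ) :=
  {w | IsRay f.support w ∧
    (p : ℂ) ^ ((sigmaVal w : ℂ) + (minPair f.support w : ℂ) * s₀) = 1}

theorem mVal_eq_minPair (hf : f ≠ 0) (w : Fin 3 → ℕ) : mVal f w = minPair f.support w := by
  obtain ⟨A, hA⟩ := amin_nonempty (MvPolynomial.support_nonempty.2 hf) (realVec w)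
  rw [mVal_eq_ip hA, minPair_eq hA, ip_realVec]

theorem contributes_faceSet (hf : f ≠ 0) {w : Fin 3 → ℕ} (hw : w ∈ contributingRays f s₀) :
    IsFacet (newtonPolyhedron f) (faceSet f (realVec w)) ∧
      Contributes f (faceSet f (realVec w)) s₀ := by
  refine ⟨isFacet_faceSet hf hw.1, w, isPrimitiveNormal_faceSet hw.1, ?_⟩
  rw [mVal_eq_minPair hf, Complex.ofReal_natCast]
  exact hw.2

theorem cpow_sigma_add (w : Fin 3 → ℕ) (n : ℕ) :
    (p : ℂ) ^ ((sigmaVal w : ℂ) + (n : ℂ) * s₀) =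
      ((p : ℂ)⁻¹ ^ (∑ m, w m) * ((p : ℂ) ^ (-s₀)) ^ n)⁻¹ := by
  have hp0 : (p : ℂ) ≠ 0 := by exact_mod_cast (Fact.out : p.Prime).ne_zero
  rw [Complex.cpow_add _ _ hp0, Complex.cpow_natCast, mul_comm (n : ℂ), Complex.cpow_mul_nat,
    Complex.cpow_neg, mul_inv, inv_pow, inv_pow, inv_inv, inv_inv, sigmaVal]

/-- If m(w) = 0, the contribution condition reads p^(σ(w)) = 1, which forces w = 0. -/
theorem minPair_ne_zero {w : Fin 3 → ℕ} (hw : w ∈ contributingRays f s₀) :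
    minPair f.support w ≠ 0 := by
  intro h0
  have h := hw.2
  rw [h0, cpow_sigma_add, pow_zero, mul_one, inv_pow, inv_inv] at h
  have h' : p ^ (∑ m, w m) = 1 := by exact_mod_cast h
  have h1 : ∑ m, w m = 0 := by
    by_contra hne
    exact absurd h' (Nat.one_lt_pow hne (Fact.out : p.Prime).one_lt).ne'
  exact hw.1.ne_zero (funext fun m => Finset.sum_eq_zero_iff.1 h1 m (Finset.mem_univ m))

theorem exists_b1Config (hf : f ≠ 0)
    (hB1 : ∀ τ, IsFacet (newtonPolyhedron f) τ → Contributes f τ s₀ → ∃ i, IsB1For i τ)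
    (hpair : ∀ τ τ', IsFacet (newtonPolyhedron f) τ → Contributes f τ s₀ →
      IsFacet (newtonPolyhedron f) τ' → Contributes f τ' s₀ →
      (∃ i, IsB1For i τ ∧ IsB1For i τ') ∨ (τ ∩ τ').Subsingleton) :
    ∃ iv, B1Config f.support (contributingRays f s₀) iv := by
  have hiv : ∀ w, ∃ i, w ∈ contributingRays f s₀ → IsB1For i (faceSet f (realVec w)) := by
    intro w
    by_cases hw : w ∈ contributingRays f s₀
    · obtain ⟨h1, h2⟩ := contributes_faceSet hf hw
      obtain ⟨i, hi⟩ := hB1 _ h1 h2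
      exact ⟨i, fun _ => hi⟩
    · exact ⟨0, fun h => absurd h hw⟩
  choose iv hiv using hiv
  refine ⟨iv, fun v hv => hv.1, fun v hv => b1Data_of_isB1For (hiv v hv), fun v hv ω hω h => ?_,
    fun v hv v' hv' => ?_⟩
  · rw [ip_realVec, ← minPair_eq hω] at h
    exact minPair_ne_zero hv (by exact_mod_cast h)
  · obtain ⟨h1, h2⟩ := contributes_faceSet hf hv
    obtain ⟨h1', h2'⟩ := contributes_faceSet hf hv'
    rcases hpair _ _ h1 h2 h1' h2' with ⟨i, hi, hi'⟩ | hsub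
    · exact .inl ⟨i, b1Data_of_isB1For hi, b1Data_of_isB1For hi'⟩
    · refine .inr fun ω hω hω' ω' hω₁ hω₁' => expPoint_injective (hsub ?_ ?_)
      · exact ⟨(expPoint_mem_faceSet_iff (realVec_nonneg v) (amin_subset hω)).2 hω,
          (expPoint_mem_faceSet_iff (realVec_nonneg v') (amin_subset hω)).2 hω'⟩
      · exact ⟨(expPoint_mem_faceSet_iff (realVec_nonneg v) (amin_subset hω₁)).2 hω₁,
          (expPoint_mem_faceSet_iff (realVec_nonneg v') (amin_subset hω₁)).2 hω₁'⟩

end Contributing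

end Igusa

theorem proposition8p5 (p : ℕ) [Fact p.Prime] (f : MvPolynomial (Fin 3) ℤ_[p])
    (hf : f ≠ 0) (hf0 : MvPolynomial.eval 0 f = 0) (hnd : Igusa.IsNondegenerate f)
    (χ : ℤ_[p]ˣ →* ℂˣ) (hχ : χ ≠ 1)
    (hχ1 : ∀ u : ℤ_[p]ˣ, (p : ℤ_[p]) ∣ (u : ℤ_[p]) - 1 → χ u = 1)
    (s₀ : ℂ) (hs₀ : Igusa.IsCandidatePole f s₀)
    (hB1 : ∀ τ, Igusa.IsFacet (Igusa.newtonPolyhedron f) τ → Igusa.Contributes f τ s₀ →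
      ∃ i, Igusa.IsB1For i τ)
    (hpair : ∀ τ τ', Igusa.IsFacet (Igusa.newtonPolyhedron f) τ → Igusa.Contributes f τ s₀ →
      Igusa.IsFacet (Igusa.newtonPolyhedron f) τ' → Igusa.Contributes f τ' s₀ →
      (∃ i, Igusa.IsB1For i τ ∧ Igusa.IsB1For i τ') ∨ (τ ∩ τ').Subsingleton) :
    (∃ Z : ℂ → ℂ, Igusa.IsTwistedZeta f χ Z) ∧
      ∀ Z : ℂ → ℂ, Igusa.IsTwistedZeta f χ Z → ¬ Igusa.IsPole Z s₀ := by
  open Igusa in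
  have hp : 2 ≤ p := (Fact.out : p.Prime).two_le
  obtain ⟨ψ, hψ1, hψ⟩ := exists_mulChar_of_trivial χ hχ hχ1
  obtain ⟨iv, hC⟩ := exists_b1Config hf hB1 hpair
  have hG := (isRationalAt_tsum_latticeTerm (z₀ := (p : ℂ) ^ (-s₀))
    (MvPolynomial.support_nonempty.2 hf) hC hp (isPeeling_torusSum hf hnd hψ1)
    -- A ray whose factor 1 - p^(-σ(w)) z₀^(m(w)) vanishes is contributing by definition, so rays
    -- outside C are harmless.
    fun w hw hwC h => hwC ⟨hw, by rw [cpow_sigma_add, h, inv_one]⟩).const_mul ((p : ℂ)⁻¹ ^ 3)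
  obtain ⟨Z₀, hZ₀, hZ₀a, hZ₀s⟩ := hG.exists_meromorphic hp
  have hZ₀t : ∀ s : ℂ, 0 < s.re → Z₀ s = twistedZetaIntegral f χ s := fun s hs => by
    rw [hZ₀s s hs, twistedZetaIntegral_eq hf hnd χ hχ hχ1 hψ hs]
  refine ⟨⟨Z₀, hZ₀, hZ₀t⟩, fun Z hZ hpole => ?_⟩
  have h := meromorphicOrderAt_eq_of_eqOn hZ.1 hZ₀
    (fun s hs => (hZ.2 s hs).trans (hZ₀t s hs).symm) s₀
  rw [IsPole, h] at hpole
  exact absurd hZ₀a.meromorphicOrderAt_nonneg (not_le.2 hpole)
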